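/- Let $\mathbb{K}$ be a field of characteristic $0$ and let $\overline{\mathbf{C}}=(\mathbf{C},\perp)$ be an orthogonal category, i.e. a category with a symmetric relation $\perp$ on pairs of morphisms with common target such that $f_1\perp f_2$ implies $g f_1 h_1\perp g f_2 h_2$ for all composable $g,h_1,h_2$. An AQFT on $\overline{\mathbf{C}}$ is a functor $\mathfrak{A}:\mathbf{C}\to\mathbf{Alg}_{\mathbb{K}}$ to associative unital $\mathbb{K}$-algebras such that the images of $\mathfrak{A}(f_1)$ and $\mathfrak{A}(f_2)$ commute whenever $f_1\perp f_2$; morphisms of AQFTs are natural transformations. A 2AQFT is a pseudo-morphism of (symmetric, coloured) $2$-operads from the operad whose operations $(c_1,\dots,c_n)\to t$ are the tuples $(f_i:c_i\to t)_{i=1}^n$ of pairwise orthogonal morphisms to the $2$-category $\mathbf{Pr}_{\mathbb{K}}$ of locally presentable $\mathbb{K}$-linear categories, $\mathbb{K}$-linear cocontinuous functors and natural transformations (with the Kelly–Deligne tensor product, so that an operation of arity $n$ is sent to a functor of $n$ variables that is $\mathbb{K}$-linear and cocontinuous in each variable); together with pseudo-transformations and modifications, 2AQFTs form a $2$-category $\mathbf{2AQFT}(\overline{\mathbf{C}})$.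 The inclusion $\iota(\mathfrak{A})$ of an AQFT assigns to $c$ the category $\mathbf{Mod}_{\mathfrak{A}(c)}$ of right modules and to $(f_i)_{i=1}^n$ the functor $(V_i)_i\mapsto \big(\bigotimes_i V_i\big)\otimes_{\bigotimes_i\mathfrak{A}(c_i)}\mathfrak{A}(t)$. The truncation $\pi(\mathfrak{B})$ of a 2AQFT $\mathfrak{B}$ is the AQFT that assigns to $c$ the endomorphism algebra of the pointing of $\mathfrak{B}(c)$, i.e. of the object determined by the operation of arity $0$. The inclusion is left biadjoint to the truncation, with unit $\eta_{\mathfrak A}:\mathfrak{A}\cong\pi\iota(\mathfrak{A})$ given by left multiplications on the free module of rank one. The counit $\epsilon_{\mathfrak{B}}:\iota\pi(\mathfrak{B})\to\mathfrak{B}$ is the $1$-morphism, unique up to isomorphism, with adjunct $\pi(\epsilon_{\mathfrak{B}})\,\eta_{\pi(\mathfrak{B})}=\mathrm{id}_{\pi(\mathfrak{B})}$. The 2AQFT $\mathfrak{B}$ is called truncated if $\epsilon_{\mathfrak{B}}$ is an equivalence in $\mathbf{2AQFT}(\overline{\mathbf{C}})$. Let $G$ be a finite group and $(\mathfrak{A},\rho)$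 a $G$-equivariant AQFT, i.e. an AQFT $\mathfrak{A}$ on $\overline{\mathbf{C}}$ with a group homomorphism $\rho:G\to\mathrm{Aut}(\mathfrak{A})$. The categorified orbifold theory $\mathfrak{A}^G$ is the 2AQFT that assigns to $c$ the category of $G$-equivariant right $\mathfrak{A}(c)$-modules, i.e. right $\mathfrak{A}(c)$-modules $V$ with a $\mathbb{K}$-linear representation of $G$ such that $g\cdot(v\,a)=(g\cdot v)\,\rho_g(a)$, and whose factorization products and coherences are those of $\iota(\mathfrak{A})$ with the diagonal $G$-actions. For $c\in\mathbf{C}$ write $A=\mathfrak{A}(c)$ and let $\mathcal{O}(G)=\mathrm{Map}(G,\mathbb{K})$ with its basis of delta functions $(\delta_g)_{g\in G}$. Let $\delta:A\to A\otimes\mathcal{O}(G)$, $\delta(a)=\sum_{g\in G}\rho_g(a)\otimes\delta_g$, be the coaction corresponding to the $G$-action, and let $\mathfrak{A}^G_0(c)=\{a\in A:\delta(a)=a\otimes 1\}$ be its subalgebra of invariants, i.e. of the $G$-invariant elements. The extension $\mathfrak{A}^G_0(c)\subseteq\mathfrak{A}(c)$ is $\mathcal{O}(G)$-Hopf–Galois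 if the map $A\otimes_{\mathfrak{A}^G_0(c)}A\to A\otimes\mathcal{O}(G)$, $a\otimes a'\mapsto(a\otimes 1)\,\delta(a')$, is bijective. Theorem. The categorified orbifold theory $\mathfrak{A}^G$ is truncated if and only if, for every object $c$ of $\mathbf{C}$, the extension $\mathfrak{A}^G_0(c)\subseteq\mathfrak{A}(c)$ is $\mathcal{O}(G)$-Hopf–Galois. -/

import Mathlib

set_option linter.unusedVariables false

open CategoryTheory Limits MulOpposite TensorProduct
open scoped ModuleCat

universe u v w

namespace OrbifoldAQFT

section Balanced

variable {K : Type u} [Field K] {I : Type} {A : I → Type u} [∀ i, Ring (A i)]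
  [∀ i, Algebra K (A i)] {B : Type u} [Ring B] [Algebra K B]

/-- Multi-additive maps `φ : ∏ V i → W` with `φ (…, v i · a, …) = φ (…, v i, …) · f i a`. -/
structure Bal (f : ∀ i, A i →ₐ[K] B) (V : ∀ i, ModuleCat.{u} (A i)ᵐᵒᵖ)
    (W : ModuleCat.{u} Bᵐᵒᵖ) where
  toFun : (∀ i, V i) → W
  map_add : ∀ [DecidableEq I] (v : ∀ i, V i) (i : I) (x y : V i),
    toFun (Function.update v i (x + y)) =
      toFun (Function.update v i x) + toFun (Function.update v i y)
  map_act : ∀ [DecidableEq I] (v : ∀ i, V i) (i : I) (a : A i) (x : V i),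
    toFun (Function.update v i (op a • x)) = op (f i a) • toFun (Function.update v i x)

lemma smul_eq (M : ModuleCat.{u} Bᵐᵒᵖ) (k : K) (m : M) :
    k • m = op (algebraMap K B k) • m := rfl

/-- A balanced map is automatically `K`-multilinear. -/
def Bal.toMultilinear {f : ∀ i, A i →ₐ[K] B} {V : ∀ i, ModuleCat.{u} (A i)ᵐᵒᵖ}
    {W : ModuleCat.{u} Bᵐᵒᵖ} (φ : Bal f V W) : MultilinearMap K (fun i => V i) W where
  toFun := φ.toFun
  map_update_add' := φ.map_add
  map_update_smul' v i k x := by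
    have := φ.map_act v i (algebraMap K _ k) x
    rw [smul_eq, this, AlgHom.commutes, smul_eq]

open Classical in
/-- The balancing relations in `B ⊗ (⨂ i, V i)`, as a right `B`-submodule. -/
noncomputable def balRel (f : ∀ i, A i →ₐ[K] B) (V : ∀ i, ModuleCat.{u} (A i)ᵐᵒᵖ) :
    Submodule Bᵐᵒᵖ (B ⊗[K] (PiTensorProduct K (fun i => (V i : Type u)))) :=
  Submodule.span Bᵐᵒᵖ {z | ∃ (b : B) (v : ∀ i, V i) (i : I) (a : A i),
    z = (f i a * b) ⊗ₜ[K] PiTensorProduct.tprod K v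
      - b ⊗ₜ[K] PiTensorProduct.tprod K (Function.update v i (op a • v i))}

/-- The induced module `(⨂ i, V i) ⊗_{⨂ i, A i} B`: the quotient of `B ⊗ (⨂ i, V i)` by the
balancing relations, which are imposed one tensor factor at a time. -/
noncomputable def facObj (f : ∀ i, A i →ₐ[K] B) (V : ∀ i, ModuleCat.{u} (A i)ᵐᵒᵖ) :
    ModuleCat.{u} Bᵐᵒᵖ :=
  ModuleCat.of Bᵐᵒᵖ ((B ⊗[K] (PiTensorProduct K (fun i => (V i : Type u)))) ⧸ balRel f V)

variable {f : ∀ i, A i →ₐ[K] B} {V : ∀ i, ModuleCat.{u} (A i)ᵐᵒᵖ}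

/-- The class of the pure tensor of the `v i`. -/
noncomputable def gen (f : ∀ i, A i →ₐ[K] B) {V : ∀ i, ModuleCat.{u} (A i)ᵐᵒᵖ} :
    Bal f V (facObj f V) where
  toFun v := (balRel f V).mkQ (1 ⊗ₜ[K] PiTensorProduct.tprod K v)
  map_add v i x y := by
    rw [MultilinearMap.map_update_add, TensorProduct.tmul_add, _root_.map_add]
    rfl
  map_act v i a x := by
    rename_i inst
    classical
    obtain rfl : inst = fun a b => Classical.propDecidable (a = b) := Subsingleton.elim _ _
    have key : (f i a * 1) ⊗ₜ[K] PiTensorProduct.tprod K (Function.update v i x)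
      - (1 : B) ⊗ₜ[K] PiTensorProduct.tprod K (Function.update v i (op a • x)) ∈ balRel f V := by
      refine Submodule.subset_span ⟨1, Function.update v i x, i, a, ?_⟩
      rw [Function.update_self, Function.update_idem]
    refine ((Submodule.Quotient.eq _).2 key).symm.trans ?_
    rw [mul_one]
    change (balRel f V).mkQ _ = op (f i a) • (balRel f V).mkQ _
    rw [← _root_.map_smul, TensorProduct.smul_tmul', op_smul_eq_mul, one_mul]

lemma gen_span : Submodule.span Bᵐᵒᵖ (Set.range (gen f (V := V)).toFun) = ⊤ := by
  rw [eq_top_iff]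
  rintro x -
  obtain ⟨y, rfl⟩ := (balRel f V).mkQ_surjective x
  induction y with
  | zero => exact Submodule.zero_mem _
  | add y z hy hz => rw [_root_.map_add]; exact Submodule.add_mem _ hy hz
  | tmul b t =>
    induction t using PiTensorProduct.induction_on with
    | smul_tprod r v =>
      have : b ⊗ₜ[K] (r • PiTensorProduct.tprod K v) =
        op (r • b) • ((1 : B) ⊗ₜ[K] PiTensorProduct.tprod K v) := by
        rw [TensorProduct.smul_tmul', op_smul_eq_mul, one_mul,
          TensorProduct.smul_tmul]
      rw [this, _root_.map_smul]
      exact Submodule.smul_mem _ _ (Submodule.subset_span ⟨v, rfl⟩)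
    | add y z hy hz => rw [TensorProduct.tmul_add, _root_.map_add]; exact Submodule.add_mem _ hy hz

lemma fac_induction {p : facObj f V → Prop} (h0 : p 0) (ha : ∀ x y, p x → p y → p (x + y))
    (hs : ∀ (b : B) x, p x → p (op b • x)) (hg : ∀ v, p ((gen f).toFun v)) (x) : p x := by
  have : x ∈ Submodule.span Bᵐᵒᵖ (Set.range (gen f (V := V)).toFun) := by simp [gen_span]
  induction this using Submodule.span_induction with
  | mem x h => obtain ⟨v, rfl⟩ := h; exact hg v
  | zero => exact h0
  | add x y _ _ hx hy => exact ha x y hx hy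
  | smul a x _ hx => exact hs a.unop x hx

lemma fac_ext {W : ModuleCat.{u} Bᵐᵒᵖ} {g h : facObj f V ⟶ W}
    (H : ∀ v, g.hom ((gen f).toFun v) = h.hom ((gen f).toFun v)) : g = h := by
  ext x
  induction x using fac_induction with
  | h0 => simp
  | ha x y hx hy => rw [_root_.map_add, _root_.map_add, hx, hy]
  | hs b x hx => rw [_root_.map_smul, _root_.map_smul, hx]
  | hg v => exact H v

/-- `b ⊗ x ↦ φ x · b`. -/
noncomputable def fdescAux {W : ModuleCat.{u} Bᵐᵒᵖ} (φ : Bal f V W) :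
    B →ₗ[Bᵐᵒᵖ] (PiTensorProduct K (fun i => (V i : Type u)) →ₗ[K] W) where
  toFun b :=
    { toFun := fun x => op b • PiTensorProduct.lift φ.toMultilinear x
      map_add' := fun x y => by rw [_root_.map_add, smul_add]
      map_smul' := fun k x => by
        rw [_root_.map_smul, RingHom.id_apply, smul_eq, smul_eq, ← mul_smul, ← mul_smul,
          ← op_mul, ← op_mul, Algebra.commutes] }
  map_add' b b' := by
    refine LinearMap.ext fun v => ?_
    exact add_smul (op b) (op b') (PiTensorProduct.lift φ.toMultilinear _)
  map_smul' b b' := by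
    refine LinearMap.ext fun v => ?_
    exact mul_smul b (op b') (PiTensorProduct.lift φ.toMultilinear _)

/-- The universal property of `facObj`. -/
noncomputable def fdesc {W : ModuleCat.{u} Bᵐᵒᵖ} (φ : Bal f V W) : facObj f V ⟶ W :=
  ModuleCat.ofHom ((balRel f V).liftQ (TensorProduct.AlgebraTensorModule.lift (fdescAux φ))
    (by
      classical
      rw [balRel, Submodule.span_le]
      rintro z ⟨b, v, i, a, rfl⟩
      have := φ.map_act v i a (v i)
      rw [Function.update_eq_self] at this
      rw [SetLike.mem_coe, LinearMap.mem_ker, map_sub, sub_eq_zero]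
      change op (f i a * b) • PiTensorProduct.lift φ.toMultilinear _ =
        op b • PiTensorProduct.lift φ.toMultilinear _
      rw [PiTensorProduct.lift.tprod, PiTensorProduct.lift.tprod, op_mul, mul_smul]
      exact congrArg _ this.symm))

@[simp]
lemma fdesc_gen {W : ModuleCat.{u} Bᵐᵒᵖ} (φ : Bal f V W) (v : ∀ i, V i) :
    (fdesc φ).hom ((gen f).toFun v) = φ.toFun v := by
  change (op (1 : B)) • (PiTensorProduct.lift φ.toMultilinear) _ = _
  rw [op_one, one_smul, PiTensorProduct.lift.tprod]
  rfl

end Balanced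

attribute [irreducible] facObj gen fdesc

section BalancedFunctoriality

variable {K : Type u} [Field K] {I : Type} {A : I → Type u} [∀ i, Ring (A i)]
  [∀ i, Algebra K (A i)] {B : Type u} [Ring B] [Algebra K B]
  {f : ∀ i, A i →ₐ[K] B} {V V' V'' : ∀ i, ModuleCat.{u} (A i)ᵐᵒᵖ} {W W' : ModuleCat.{u} Bᵐᵒᵖ}

@[ext]
lemma Bal.ext {φ ψ : Bal f V W} (h : ∀ v, φ.toFun v = ψ.toFun v) : φ = ψ := by
  cases φ; cases ψ; congr; exact funext h

/-- Composition with a module homomorphism. -/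
def Bal.postcomp (φ : Bal f V W) (h : W ⟶ W') : Bal f V W' where
  toFun v := h.hom (φ.toFun v)
  map_add v i x y := by rw [φ.map_add, _root_.map_add]
  map_act v i a x := by rw [φ.map_act, _root_.map_smul]

/-- Composition with module homomorphisms in all slots. -/
def Bal.precomp (φ : Bal f V' W) (h : ∀ i, V i ⟶ V' i) : Bal f V W where
  toFun v := φ.toFun fun i => (h i).hom (v i)
  map_add v i x y := by
    simp only [Function.apply_update (fun i => (h i).hom), _root_.map_add, φ.map_add]
  map_act v i a x := by
    simp only [Function.apply_update (fun i => (h i).hom), _root_.map_smul, φ.map_act]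

/-- Functoriality of `facObj` in the modules. -/
noncomputable def fmap (f : ∀ i, A i →ₐ[K] B) (h : ∀ i, V i ⟶ V' i) :
    facObj f V ⟶ facObj f V' := fdesc ((gen f).precomp h)

@[simp]
lemma fmap_gen (h : ∀ i, V i ⟶ V' i) (v : ∀ i, V i) :
    (fmap f h).hom ((gen f).toFun v) = (gen f).toFun fun i => (h i).hom (v i) :=
  fdesc_gen _ _

lemma fmap_id : fmap f (fun i => 𝟙 (V i)) = 𝟙 _ := fac_ext fun v => by simp

lemma fmap_comp (h : ∀ i, V i ⟶ V' i) (h' : ∀ i, V' i ⟶ V'' i) :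
    fmap f (fun i => h i ≫ h' i) = fmap f h ≫ fmap f h' := fac_ext fun v => by simp

/-- A balanced map is additive and equivariant in the `i`-th slot. -/
lemma Bal.eq_of_slot [Finite I] {J : I → Type} {A' : ∀ i, J i → Type u} [∀ i j, Ring (A' i j)]
    [∀ i j, Algebra K (A' i j)] {g : ∀ i j, A' i j →ₐ[K] A i}
    {X : ∀ i j, ModuleCat.{u} (A' i j)ᵐᵒᵖ} {φ ψ : Bal f (fun i => facObj (g i) (X i)) W}
    (h : ∀ x : ∀ i j, X i j, φ.toFun (fun i => (gen (g i)).toFun (x i)) =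
      ψ.toFun (fun i => (gen (g i)).toFun (x i))) : φ = ψ := by
  classical
  have := Fintype.ofFinite I
  suffices H : ∀ (s : Finset I) (u : ∀ i, facObj (g i) (X i)),
      (∀ i ∉ s, ∃ x, u i = (gen (g i)).toFun x) → φ.toFun u = ψ.toFun u from
    Bal.ext fun u => H Finset.univ u fun i hi => absurd (Finset.mem_univ i) hi
  intro s
  induction s using Finset.induction_on with
  | empty =>
    intro u hu
    choose x hx using fun i => hu i (Finset.notMem_empty i)
    obtain rfl : u = fun i => (gen (g i)).toFun (x i) := funext hx
    exact h x
  | insert i s his ih =>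
    intro u hu
    have : ∀ y, φ.toFun (Function.update u i y) = ψ.toFun (Function.update u i y) := by
      intro y
      induction y using fac_induction with
      | h0 =>
        have h1 := φ.map_act u i 0 0
        have h2 := ψ.map_act u i 0 0
        simp only [MulOpposite.op_zero, zero_smul] at h1 h2
        rw [h1, h2, _root_.map_zero, MulOpposite.op_zero, zero_smul, zero_smul]
      | ha x y hx hy => rw [φ.map_add, ψ.map_add, hx, hy]
      | hs b x hx => rw [φ.map_act, ψ.map_act, hx]
      | hg v =>
        apply ih
        intro j hj
        by_cases hji : j = i
        · subst hji
          exact ⟨v, by simp⟩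
        · rw [Function.update_of_ne hji]
          exact hu j (by simp [hji, hj])
    simpa using this (u i)

/-- Evaluation at the unique slot. -/
def balEval {e : ∀ _ : Unit, B →ₐ[K] B} (he : ∀ x b, e x b = b) (M : ModuleCat.{u} Bᵐᵒᵖ) :
    Bal e (fun _ => M) M where
  toFun v := v ()
  map_add v i x y := by simp
  map_act v i a x := by simp [he]

/-- The linear map `M → facObj id M`. -/
noncomputable def funitHom {e : ∀ _ : Unit, B →ₐ[K] B} (he : ∀ x b, e x b = b)
    (M : ModuleCat.{u} Bᵐᵒᵖ) : M ⟶ facObj e (fun _ => M) :=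
  ModuleCat.ofHom (Y := facObj e (fun _ => M))
    { toFun := fun m => (gen e (V := fun _ => M)).toFun fun _ => m
      map_add' := fun x y => by
        have := (gen e (V := fun _ => M)).map_add (fun _ => 0) () x y
        simp only [Function.update_eq_const_of_subsingleton] at this
        exact this
      map_smul' := fun a x => by
        have := (gen e (V := fun _ => M)).map_act (fun _ => 0) () a.unop x
        rw [he] at this
        simp only [Function.update_eq_const_of_subsingleton] at this
        exact this }

lemma funitHom_apply {e : ∀ _ : Unit, B →ₐ[K] B} (he : ∀ x b, e x b = b)
    (M : ModuleCat.{u} Bᵐᵒᵖ) (m : M) : (funitHom he M).hom m = (gen e).toFun fun _ => m := rfl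

/-- The unit coherence `M ≅ facObj id M`. -/
noncomputable def funit {e : ∀ _ : Unit, B →ₐ[K] B} (he : ∀ x b, e x b = b)
    (M : ModuleCat.{u} Bᵐᵒᵖ) : M ≅ facObj e (fun _ => M) where
  hom := funitHom he M
  inv := fdesc (balEval he M)
  hom_inv_id := by
    ext x
    rw [ModuleCat.comp_apply, funitHom_apply, fdesc_gen]
    rfl
  inv_hom_id := fac_ext fun v => by
    rw [ModuleCat.comp_apply, fdesc_gen, funitHom_apply]
    rfl

@[simp]
lemma funit_hom {e : ∀ _ : Unit, B →ₐ[K] B} (he : ∀ x b, e x b = b)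
    (M : ModuleCat.{u} Bᵐᵒᵖ) (m : M) : (funit he M).hom.hom m = (gen e).toFun fun _ => m := rfl

/-- The permutation coherence. -/
noncomputable def fperm {J : Type} (σ : J ≃ I) {f' : ∀ j, A (σ j) →ₐ[K] B}
    (hf : ∀ j a, f' j a = f (σ j) a) :
    facObj f V ≅ facObj f' (fun j => V (σ j)) where
  hom := fdesc
    { toFun := fun v => (gen f').toFun fun j => v (σ j)
      map_add := fun v i x y => by
        classical
        obtain ⟨j, rfl⟩ := σ.surjective i
        simp only [Function.update_comp_eq_of_injective' v σ.injective]
        exact (gen f').map_add (fun j => v (σ j)) j x y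
      map_act := fun v i a x => by
        classical
        obtain ⟨j, rfl⟩ := σ.surjective i
        simp only [Function.update_comp_eq_of_injective' v σ.injective]
        rw [← hf]
        exact (gen f').map_act (fun j => v (σ j)) j a x }
  inv := fdesc
    { toFun := fun w => (gen f).toFun (Equiv.piCongrLeft (fun i => (V i : Type u)) σ w)
      map_add := fun w j x y => by
        classical
        have key : ∀ z, Equiv.piCongrLeft (fun i => (V i : Type u)) σ (Function.update w j z) =
          Function.update (Equiv.piCongrLeft (fun i => (V i : Type u)) σ w) (σ j) z := by
          intro z
          rw [← Equiv.eq_symm_apply]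
          funext k
          by_cases hk : k = j
          · subst hk; simp
          · simp [hk]
        rw [key, key, key, (gen f).map_add]
      map_act := fun w j a x => by
        classical
        have key : ∀ z, Equiv.piCongrLeft (fun i => (V i : Type u)) σ (Function.update w j z) =
          Function.update (Equiv.piCongrLeft (fun i => (V i : Type u)) σ w) (σ j) z := by
          intro z
          rw [← Equiv.eq_symm_apply]
          funext k
          by_cases hk : k = j
          · subst hk; simp
          · simp [hk]
        rw [key, key, (gen f).map_act, hf] }
  hom_inv_id := fac_ext fun v => by
    simp only [ModuleCat.hom_comp, LinearMap.comp_apply, fdesc_gen, ModuleCat.hom_id,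
      LinearMap.id_apply]
    congr 1
    exact (Equiv.piCongrLeft (fun i => (V i : Type u)) σ).apply_symm_apply v
  inv_hom_id := fac_ext fun w => by
    simp only [ModuleCat.hom_comp, LinearMap.comp_apply, fdesc_gen, ModuleCat.hom_id,
      LinearMap.id_apply]
    congr 1
    exact (Equiv.piCongrLeft (fun i => (V i : Type u)) σ).symm_apply_apply w

@[simp]
lemma fperm_gen {J : Type} (σ : J ≃ I) {f' : ∀ j, A (σ j) →ₐ[K] B}
    (hf : ∀ j a, f' j a = f (σ j) a) (v : ∀ i, V i) :
    (fperm σ hf (V := V)).hom.hom ((gen f).toFun v) = (gen f').toFun fun j => v (σ j) :=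
  fdesc_gen _ _

section Iterated

variable {J : I → Type} {A' : ∀ i, J i → Type u} [∀ i j, Ring (A' i j)]
  [∀ i j, Algebra K (A' i j)] {g : ∀ i j, A' i j →ₐ[K] A i}
  {X : ∀ i j, ModuleCat.{u} (A' i j)ᵐᵒᵖ} {fg : ∀ p : (Σ i, J i), A' p.1 p.2 →ₐ[K] B}

lemma genGen_update [DecidableEq I] [DecidableEq (Σ i, J i)] [∀ i, DecidableEq (J i)]
    (x : ∀ p : (Σ i, J i), X p.1 p.2) (i : I) (j : J i) (y : X i j) :
    (fun i' => (gen (g i')).toFun fun j' => Function.update x ⟨i, j⟩ y ⟨i', j'⟩) =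
      Function.update (fun i' => (gen (g i')).toFun fun j' => x ⟨i', j'⟩) i
        ((gen (g i)).toFun (Function.update (fun j' => x ⟨i, j'⟩) j y)) := by
  funext i'
  by_cases h : i' = i
  · subst h
    rw [Function.update_self]
    congr 1
    funext j'
    by_cases h' : j' = j
    · subst h'; simp
    · rw [Function.update_of_ne h', Function.update_of_ne (by simpa using h')]
  · rw [Function.update_of_ne h]
    congr 1
    funext j'
    rw [Function.update_of_ne (by simp [h])]

/-- Restriction of a balanced map along the universal balanced maps. -/
noncomputable def genGen (hfg : ∀ i j a, fg ⟨i, j⟩ a = f i (g i j a))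
    (φ : Bal f (fun i => facObj (g i) (X i)) W) : Bal fg (fun p => X p.1 p.2) W where
  toFun x := φ.toFun fun i => (gen (g i)).toFun fun j => x ⟨i, j⟩
  map_add x p y z := by
    classical
    obtain ⟨i, j⟩ := p
    simp only [genGen_update]
    rw [(gen (g i)).map_add, φ.map_add]
  map_act x p a z := by
    classical
    obtain ⟨i, j⟩ := p
    simp only [genGen_update]
    rw [(gen (g i)).map_act, φ.map_act, hfg]

/-- Restriction of scalars of right modules along an algebra map. -/
noncomputable def balTwist (W : ModuleCat.{u} Bᵐᵒᵖ) {A : Type u} [Ring A] [Algebra K A] (f : A →ₐ[K] B) :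
    ModuleCat.{u} Aᵐᵒᵖ :=
  (ModuleCat.restrictScalars (RingHom.op (f : A →+* B))).obj W

/-- Balanced maps extend uniquely along the universal balanced maps. -/
lemma genGen_surjective [Finite I]
    (hcomm : ∀ i j, i ≠ j → ∀ a b, Commute (f i a) (f j b))
    (hfg : ∀ i j a, fg ⟨i, j⟩ a = f i (g i j a)) (φ : Bal fg (fun p => X p.1 p.2) W) :
    ∃ ψ : Bal f (fun i => facObj (g i) (X i)) W, genGen hfg ψ = φ := by
  classical
  have := Fintype.ofFinite I
  -- the product of the `f i (b i)`
  have hc : ∀ (s : Finset I) (b : ∀ i, A i),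
      (s : Set I).Pairwise (Function.onFun Commute fun i => f i (b i)) :=
    fun s b i _ j _ hij => hcomm i j hij _ _
  let E : ∀ i, (∀ i, A i) → B := fun i b =>
    (Finset.univ.erase i).noncommProd (fun j => f j (b j)) (hc _ b)
  let m : (∀ i, A i) → B := fun b => Finset.univ.noncommProd (fun j => f j (b j)) (hc _ b)
  have hm : ∀ b i, m b = E i b * f i (b i) := fun b i =>
    (Finset.noncommProd_erase_mul _ (Finset.mem_univ i) _ (hc _ b)).symm
  have hE : ∀ b i y, E i (Function.update b i y) = E i b := fun b i y =>
    Finset.noncommProd_congr rfl (fun j hj => by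
      rw [Function.update_of_ne (Finset.ne_of_mem_erase hj)]) _
  have hEc : ∀ b i a, Commute (f i a) (E i b) := fun b i a =>
    Finset.noncommProd_commute _ _ _ _ fun j hj =>
      hcomm i j (Finset.ne_of_mem_erase hj).symm _ _
  have hmu : ∀ b i y, m (Function.update b i y) = E i b * f i y := fun b i y => by
    rw [hm _ i, hE, Function.update_self]
  have hm1 : m 1 = 1 := by
    change Finset.univ.noncommProd _ _ = 1
    rw [Finset.noncommProd_eq_pow_card _ _ _ 1 (by simp), one_pow]
  let mm : MultilinearMap K A B := MultilinearMap.mk' m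
    (fun b i x y => by simp only [hmu, _root_.map_add, mul_add])
    (fun b i k x => by simp only [hmu, _root_.map_smul, mul_smul_comm])
  -- formal sums of symbols `gen x · b`
  let M : I → Type u := fun i => (∀ j, X i j) →₀ A i
  let op' : W → (B →ₗ[K] W) := fun y =>
    { toFun := fun b => op b • y
      map_add' := fun b b' => by rw [MulOpposite.op_add, add_smul]
      map_smul' := fun k b => by
        rw [RingHom.id_apply, smul_eq, ← mul_smul, ← op_mul, ← Algebra.commutes,
          Algebra.smul_def] }
  let Φ : ((∀ i j, X i j) →₀ PiTensorProduct K A) →ₗ[K] W :=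
    Finsupp.lsum K fun x => (op' (φ.toFun fun p => x p.1 p.2)).comp (PiTensorProduct.lift mm)
  let F : MultilinearMap K M W :=
    Φ.compMultilinearMap
      ((PiTensorProduct.ofFinsuppEquiv (R := K) (κ := fun i => ∀ j, X i j)
        (M := A)).toLinearMap.compMultilinearMap (PiTensorProduct.tprod K))
  have hF : ∀ (x : ∀ i j, X i j) (b : ∀ i, A i), F (fun i => Finsupp.single (x i) (b i)) =
      op (m b) • φ.toFun (fun p => x p.1 p.2) := by
    intro x b
    change Φ (PiTensorProduct.ofFinsuppEquiv (R := K) (κ := fun i => ∀ j, X i j) (M := A)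
      (PiTensorProduct.tprod K fun i => Finsupp.single (x i) (b i))) = _
    rw [PiTensorProduct.ofFinsuppEquiv_tprod_single]
    refine (Finsupp.lsum_single _ _ _ _).trans ?_
    change op (PiTensorProduct.lift mm _) • φ.toFun (fun p => x p.1 p.2) = _
    rw [PiTensorProduct.lift.tprod]
    rfl
  let q : ∀ i, M i →ₗ[K] facObj (g i) (X i) := fun i =>
    Finsupp.lsum K fun x =>
      { toFun := fun b => op b • (gen (g i)).toFun x
        map_add' := fun b b' => by rw [MulOpposite.op_add, add_smul]
        map_smul' := fun k b => by
          rw [RingHom.id_apply, smul_eq, ← mul_smul, ← op_mul, ← Algebra.commutes,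
            Algebra.smul_def] }
  have hq : ∀ i x b, q i (Finsupp.single x b) = op b • (gen (g i)).toFun x := fun i x b => by
    exact Finsupp.lsum_single _ _ _ _
  let R : ∀ i, A i → (M i →ₗ[K] M i) := fun i a =>
    Finsupp.mapRange.linearMap (LinearMap.mulRight K a)
  have hR : ∀ i a x b, R i a (Finsupp.single x b) = Finsupp.single x (b * a) := fun i a x b =>
    Finsupp.mapRange_single (hf := _root_.map_zero _)
  have hqR : ∀ i a y, q i (R i a y) = op a • q i y := by
    intro i a y
    induction y using Finsupp.induction_linear with
    | zero => simp
    | add y z hy hz => simp only [_root_.map_add, hy, hz, smul_add]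
    | single x b => rw [hR, hq, hq, op_mul, mul_smul]
  have hqs : ∀ i, Function.Surjective (q i) := by
    intro i y
    induction y using fac_induction with
    | h0 => exact ⟨0, _root_.map_zero _⟩
    | ha x y hx hy =>
      obtain ⟨x, rfl⟩ := hx
      obtain ⟨y, rfl⟩ := hy
      exact ⟨x + y, _root_.map_add _ _ _⟩
    | hs b x hx =>
      obtain ⟨x, rfl⟩ := hx
      exact ⟨R i b x, hqR i b x⟩
    | hg v => exact ⟨Finsupp.single v 1, by rw [hq, op_one, one_smul]⟩
  choose s hs using fun i =>
    (q i).exists_rightInverse_of_surjective (LinearMap.range_eq_top.2 (hqs i))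
  have hs' : ∀ i y, q i (s i y) = y := fun i y => LinearMap.congr_fun (hs i) y
  have hspan : ∀ i, Submodule.span K (Set.range (fun p : (∀ j, X i j) × A i =>
      (Finsupp.single p.1 p.2 : M i))) = ⊤ := by
    intro i
    rw [eq_top_iff]
    rintro y -
    induction y using Finsupp.induction_linear with
    | zero => exact Submodule.zero_mem _
    | add y z hy hz => exact Submodule.add_mem _ hy hz
    | single x b => exact Submodule.subset_span ⟨(x, b), rfl⟩
  have hupd : ∀ (L : ∀ i, M i →ₗ[K] M i) (i : I) (u : ∀ i, M i),
      (fun i' => (Function.update (fun i => (LinearMap.id : M i →ₗ[K] M i)) i (L i)) i' (u i')) =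
        Function.update u i (L i (u i)) := by
    intro L i u
    funext i'
    by_cases h : i' = i
    · subst h; simp
    · simp [h]
  have hsingle : ∀ (x : ∀ i j, X i j) (b : ∀ i, A i) (i : I) (y) (c : A i),
      Function.update (fun i => (Finsupp.single (x i) (b i) : M i)) i (Finsupp.single y c) =
        fun i' => Finsupp.single (Function.update x i y i') (Function.update b i c i') := by
    intro x b i y c
    funext i'
    by_cases h : i' = i
    · subst h; simp
    · simp [h]
  -- right multiplication in one slot
  have hFR : ∀ (i : I) (a : A i) (u : ∀ i, M i) ,
      F (Function.update u i (R i a (u i))) = op (f i a) • F u := by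
    intro i a u
    let T : W →ₗ[K] W :=
      { toFun := fun y => op (f i a) • y
        map_add' := fun y z => smul_add _ _ _
        map_smul' := fun k y => by
          rw [RingHom.id_apply, smul_eq, smul_eq, ← mul_smul, ← mul_smul, ← op_mul, ← op_mul,
            Algebra.commutes] }
    have := MultilinearMap.ext_of_span_eq_top hspan
      (φ := F.compLinearMap (Function.update (fun i => LinearMap.id) i (R i a)))
      (φ' := T.compMultilinearMap F) (by
        intro p
        have h1 := hupd (fun i' => if h : i' = i then R i' (h ▸ a) else 0) i
          (fun i => Finsupp.single (p i).1 (p i).2)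
        simp only [dite_true] at h1
        rw [MultilinearMap.compLinearMap_apply, h1, hR, hsingle, hF, Function.update_eq_self]
        change _ = op (f i a) • F _
        rw [hF, ← mul_smul, ← op_mul, hmu, hm (fun i => (p i).2) i, _root_.map_mul, mul_assoc])
    have h2 := congrArg (fun G => G u) this
    have h1 := hupd (fun i' => if h : i' = i then R i' (h ▸ a) else 0) i u
    simp only [dite_true] at h1
    simp only [MultilinearMap.compLinearMap_apply, h1] at h2
    exact h2
  -- `F` only depends on the images under `q`
  have hFe : ∀ (i : I) (u : ∀ i, M i), F (Function.update u i (s i (q i (u i)))) = F u := by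
    intro i u
    have := MultilinearMap.ext_of_span_eq_top hspan
      (φ := F.compLinearMap (Function.update (fun i => LinearMap.id) i ((s i).comp (q i))))
      (φ' := F) (by
        intro p
        rw [MultilinearMap.compLinearMap_apply, hupd (fun i => (s i).comp (q i))]
        let x : ∀ i j, X i j := fun i => (p i).1
        let b : ∀ i, A i := fun i => (p i).2
        have hu2 : ∀ [DecidableEq (J i)] (v : ∀ j, X i j) (j : J i) (y : X i j),
            (fun p : Σ i, J i => Function.update x i (Function.update v j y) p.1 p.2) =
              Function.update (fun p : Σ i, J i => Function.update x i v p.1 p.2) ⟨i, j⟩ y := by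
          intro _ v j y
          funext p
          obtain ⟨i', j'⟩ := p
          by_cases h : i' = i
          · subst h
            by_cases h' : j' = j
            · subst h'; simp
            · simp [Function.update_self, h']
          · rw [Function.update_of_ne (by simp [h])]
            simp [h]
        let θ : Bal (g i) (X i) (balTwist W (f i)) :=
          { toFun := fun y => op (E i b) • φ.toFun fun p => Function.update x i y p.1 p.2
            map_add := fun v j y z => by
              simp only [hu2]
              rw [φ.map_add]
              exact smul_add (A := W) (op (E i b)) _ _
            map_act := fun v j a y => by
              simp only [hu2]
              rw [φ.map_act, hfg, ← mul_smul, ← op_mul, (hEc b i (g i j a)).eq, op_mul, mul_smul]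
              rfl }
        have hθ : ∀ y : M i, (fdesc θ).hom (q i y) =
            F (Function.update (fun i => Finsupp.single (x i) (b i)) i y) := by
          intro y
          induction y using Finsupp.induction_linear with
          | zero => rw [_root_.map_zero, _root_.map_zero, MultilinearMap.map_update_zero]; rfl
          | add y z hy hz =>
            rw [_root_.map_add, _root_.map_add, MultilinearMap.map_update_add, hy, hz]; rfl
          | single y c =>
            rw [hq, _root_.map_smul, fdesc_gen, hsingle, hF, hmu, op_mul, mul_smul]
            rfl
        rw [← hθ, LinearMap.comp_apply, hs', hθ, Function.update_eq_self])
    have h2 := congrArg (fun G => G u) this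
    simp only [MultilinearMap.compLinearMap_apply, hupd (fun i => (s i).comp (q i))] at h2
    exact h2
  have hFq1 : ∀ (i : I) (u : ∀ i, M i) (y z : M i), q i y = q i z →
      F (Function.update u i y) = F (Function.update u i z) := by
    intro i u y z h
    have h1 := hFe i (Function.update u i y)
    have h2 := hFe i (Function.update u i z)
    rw [Function.update_self, Function.update_idem] at h1 h2
    rw [← h1, ← h2, h]
  have hFq : ∀ u u' : ∀ i, M i, (∀ i, q i (u i) = q i (u' i)) → F u = F u' := by
    intro u u' h
    suffices H : ∀ (t : Finset I) (u : ∀ i, M i), (∀ i, q i (u i) = q i (u' i)) →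
        (∀ i ∉ t, u i = u' i) → F u = F u' from
      H Finset.univ u h fun i hi => absurd (Finset.mem_univ i) hi
    intro t
    induction t using Finset.induction_on with
    | empty => intro u _ hu; congr 1; exact funext fun i => hu i (Finset.notMem_empty i)
    | insert i t hit ih =>
      intro u hq hu
      have h1 := hFq1 i u (u i) (u' i) (hq i)
      rw [Function.update_eq_self] at h1
      rw [h1]
      apply ih
      · intro j
        by_cases hj : j = i
        · subst hj; simp
        · simp [hj, hq]
      · intro j hjt
        by_cases hj : j = i
        · subst hj; simp
        · rw [Function.update_of_ne hj]; exact hu j (by simp [hj, hjt])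
  refine ⟨{ toFun := fun u => F fun i => s i (u i), map_add := ?_, map_act := ?_ }, ?_⟩
  · intro inst u i y z
    simp only [Function.apply_update (fun i => s i), _root_.map_add, F.map_update_add]
  · intro inst u i a y
    obtain rfl := Subsingleton.elim inst (fun a b => Classical.propDecidable (a = b))
    have h1 := hFR i a (Function.update (fun i => s i (u i)) i (s i y))
    simp only [Function.apply_update (fun i => s i)]
    rw [← h1, Function.update_self, Function.update_idem]
    apply hFq1
    rw [hqR, hs', hs']
  · ext x
    change F _ = _
    rw [hFq _ (fun i => Finsupp.single (fun j => x ⟨i, j⟩) 1) fun i => by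
      rw [hs', hq, op_one, one_smul]]
    refine (hF (fun i j => x ⟨i, j⟩) 1).trans ?_
    rw [hm1, op_one, one_smul]

end Iterated

end BalancedFunctoriality

section Multifunctors

variable (K : Type u) [Field K]

/-- A locally presentable `K`-linear category. -/
structure PrCat where
  carrier : Type (u + 1)
  [cat : Category.{u} carrier]
  [preadditive : Preadditive carrier]
  [linear : Linear K carrier]
  [presentable : IsLocallyPresentable.{u} carrier]

instance : CoeSort (PrCat.{u} K) (Type (u + 1)) := ⟨PrCat.carrier⟩

attribute [instance] PrCat.cat PrCat.preadditive PrCat.linear PrCat.presentable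

variable {I : Type} {D : I → Type (u + 1)} [∀ i, Category.{u} (D i)]

open Classical in
/-- The functor `y ↦ (…, X j, …, y, …, X k, …)` which varies the `i`-th entry only. -/
noncomputable def slot (X : ∀ i, D i) (i : I) : D i ⥤ ∀ j, D j :=
  Functor.pi' (Function.update (fun j => (Functor.const (D i)).obj (X j)) i (𝟭 (D i)))

lemma slot_self (X : ∀ i, D i) (i : I) : slot X i ⋙ Pi.eval _ i = 𝟭 (D i) := by
  classical
  refine (Functor.pi'_eval _ _).trans ?_
  exact Function.update_self ..

lemma slot_ne (X : ∀ i, D i) {i j : I} (h : j ≠ i) :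
    slot X i ⋙ Pi.eval _ j = (Functor.const (D i)).obj (X j) := by
  classical
  refine (Functor.pi'_eval _ _).trans ?_
  exact Function.update_of_ne h ..

lemma slot_iso {X : ∀ i, D i} {i j : I} (h : j ≠ i) {x y : D i} (f : x ⟶ y) :
    IsIso ((slot X i).map f j) := by
  have : IsIso ((slot X i ⋙ Pi.eval _ j).map f) := by rw [slot_ne X h]; exact IsIso.id _
  exact this

variable {T : Type (u + 1)} [Category.{u} T] [∀ i, Preadditive (D i)] [∀ i, Linear K (D i)]
  [Preadditive T] [Linear K T]

/-- Functors of several variables which are `K`-linear and cocontinuous in each variable. -/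
structure IsMulti (F : (∀ i, D i) ⥤ T) : Prop where
  additive : ∀ X i, (slot X i ⋙ F).Additive
  linear : ∀ X i, (slot X i ⋙ F).Linear K
  cocontinuous : ∀ X i, PreservesColimitsOfSize.{u, u} (slot X i ⋙ F)

variable {K}

lemma isMulti_of {F : (∀ i, D i) ⥤ T}
    (hadd : ∀ (X Y : ∀ i, D i) (i : I) (p q r : X ⟶ Y), (∀ j ≠ i, p j = q j ∧ p j = r j) →
      p i = q i + r i → F.map p = F.map q + F.map r)
    (hsmul : ∀ (X Y : ∀ i, D i) (i : I) (p q : X ⟶ Y) (k : K), (∀ j ≠ i, p j = q j) →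
      p i = k • q i → F.map p = k • F.map q)
    (hcolim : ∀ (i : I) (J : Type u) [Category.{u} J] (P : J ⥤ ∀ j, D j) (c : Cocone P),
      (∀ j ≠ i, ∀ x, IsIso (c.ι.app x j)) → Nonempty (IsColimit ((Pi.eval _ i).mapCocone c)) →
      Nonempty (IsColimit (F.mapCocone c))) : IsMulti K F := by
  have h1 : ∀ (X : ∀ i, D i) (i j : I), j ≠ i → ∀ {x y : D i} (f g : x ⟶ y),
      (slot X i).map f j = (slot X i).map g j := by
    intro X i j h x y f g
    have : (slot X i ⋙ Pi.eval _ j).map f = (slot X i ⋙ Pi.eval _ j).map g := by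
      rw [slot_ne X h]; rfl
    exact this
  have h2 : ∀ (X : ∀ i, D i) (i : I) {x y : D i} (f g : x ⟶ y),
      (slot X i).map (f + g) i = (slot X i).map f i + (slot X i).map g i := by
    intro X i x y f g
    have : (slot X i ⋙ Pi.eval _ i).map (f + g) =
      (slot X i ⋙ Pi.eval _ i).map f + (slot X i ⋙ Pi.eval _ i).map g := by rw [slot_self X i]; rfl
    exact this
  have h3 : ∀ (X : ∀ i, D i) (i : I) {x y : D i} (f : x ⟶ y) (k : K),
      (slot X i).map (k • f) i = k • (slot X i).map f i := by
    intro X i x y f k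
    have : (slot X i ⋙ Pi.eval _ i).map (k • f) =
      k • (slot X i ⋙ Pi.eval _ i).map f := by rw [slot_self X i]; rfl
    exact this
  refine ⟨fun X i => ⟨fun {x y f g} => ?_⟩, fun X i => ⟨fun {x y} f k => ?_⟩, fun X i => ⟨⟨fun {P} => ⟨fun {c} hc => ?_⟩⟩⟩⟩
  · exact hadd _ _ i _ _ _ (fun j hj => ⟨h1 X i j hj _ _, h1 X i j hj _ _⟩) (h2 X i f g)
  · exact hsmul _ _ i _ _ _ (fun j hj => h1 X i j hj _ _) (h3 X i f k)
  · refine hcolim i _ (P ⋙ slot X i) ((slot X i).mapCocone c) (fun j hj x => slot_iso hj _) ?_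
    have : PreservesColimit P (slot X i ⋙ Pi.eval _ i) := by rw [slot_self X i]; infer_instance
    exact ⟨isColimitOfPreserves (slot X i ⋙ Pi.eval _ i) hc⟩

end Multifunctors

section Orthogonal

/-- An orthogonality relation on a category. -/
structure Orthogonality (C : Type v) [Category.{w} C] where
  Perp : ∀ {c₁ c₂ t : C}, (c₁ ⟶ t) → (c₂ ⟶ t) → Prop
  symm : ∀ {c₁ c₂ t : C} {f₁ : c₁ ⟶ t} {f₂ : c₂ ⟶ t}, Perp f₁ f₂ → Perp f₂ f₁
  comp : ∀ {c₁ c₂ t : C} {f₁ : c₁ ⟶ t} {f₂ : c₂ ⟶ t}, Perp f₁ f₂ →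
    ∀ {d₁ d₂ s : C} (g : t ⟶ s) (h₁ : d₁ ⟶ c₁) (h₂ : d₂ ⟶ c₂), Perp (h₁ ≫ f₁ ≫ g) (h₂ ≫ f₂ ≫ g)

variable {C : Type v} [Category.{w} C]

/-- The operations `c → t` of the operad of an orthogonal category: tuples of pairwise orthogonal
morphisms. The tuple is indexed by a finite type. -/
@[ext]
structure POp (P : Orthogonality C) {I : Type} (c : I → C) (t : C) where
  hom : ∀ i, c i ⟶ t
  perp : ∀ i j, i ≠ j → P.Perp (hom i) (hom j)

variable {P : Orthogonality C}

/-- Operadic composition. -/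
def POp.comp {I : Type} {J : I → Type} {c : I → C} {d : ∀ i, J i → C} {t : C} (f : POp P c t)
    (g : ∀ i, POp P (d i) (c i)) : POp P (fun p : Σ i, J i => d p.1 p.2) t where
  hom p := (g p.1).hom p.2 ≫ f.hom p.1
  perp := by
    rintro ⟨i, j⟩ ⟨i', j'⟩ h
    by_cases hi : i = i'
    · subst hi
      have := P.comp ((g i).perp j j' (by rintro rfl; exact h rfl)) (f.hom i) (𝟙 _) (𝟙 _)
      simpa using this
    · have := P.comp (f.perp i i' hi) (𝟙 _) ((g i).hom j) ((g i').hom j')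
      simpa using this

/-- The operadic unit. -/
def POp.one (P : Orthogonality C) (t : C) : POp P (fun _ : Unit => t) t :=
  ⟨fun _ => 𝟙 t, fun _ _ h => absurd rfl h⟩

/-- A morphism as an operation of arity one. -/
def POp.unary {c t : C} (f : c ⟶ t) : POp P (fun _ : Unit => c) t :=
  ⟨fun _ => f, fun _ _ h => absurd rfl h⟩

/-- The permutation action. -/
def POp.perm {I J : Type} (σ : J ≃ I) {c : I → C} {t : C} (f : POp P c t) :
    POp P (fun j => c (σ j)) t :=
  ⟨fun j => f.hom (σ j), fun _ _ h => f.perp _ _ fun h' => h (σ.injective h')⟩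

/-- The operation of arity zero. -/
def POp.zero (P : Orthogonality C) (t : C) : POp P (fun i : Empty => i.elim) t :=
  ⟨fun i => i.elim, fun i => i.elim⟩

end Orthogonal

/-- `(Σ _ : Unit, I) ≃ I`. -/
def sigmaUnitLeft (I : Type) : (Σ _ : Unit, I) ≃ I := ⟨fun p => p.2, fun i => ⟨(), i⟩, fun _ => rfl, fun _ => rfl⟩

/-- `(Σ _ : I, Unit) ≃ I`. -/
def sigmaUnitRight (I : Type) : (Σ _ : I, Unit) ≃ I := ⟨fun p => p.1, fun i => ⟨i, ()⟩, fun _ => rfl, fun _ => rfl⟩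

/-- Categorified algebraic quantum field theories: pseudo-morphisms from the operad of an orthogonal
category to the multicategory of locally presentable `K`-linear categories, whose multimorphisms are
the functors of several variables that are `K`-linear and cocontinuous in each variable, i.e. the
`1`-morphisms out of the Kelly-Deligne tensor product.  The coherence
isomorphisms `comp`, `unit` are those for operadic composition and operadic units, and `perm` is
the one for permutations of the inputs (with `f' = f · σ`). -/
structure TwoAQFT (K : Type u) [Field K] {C : Type v} [Category.{w} C] (P : Orthogonality C) where
  cat : C → PrCat.{u} K
  prod : ∀ {I : Type} [Finite I] {c : I → C} {t : C}, POp P c t → (∀ i, cat (c i)) ⥤ cat t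
  isMulti : ∀ {I : Type} [Finite I] {c : I → C} {t : C} (f : POp P c t), IsMulti K (prod f)
  comp : ∀ {I : Type} [Finite I] {J : I → Type} [∀ i, Finite (J i)] {c : I → C}
    {d : ∀ i, J i → C} {t : C} (f : POp P c t) (g : ∀ i, POp P (d i) (c i))
    (X : ∀ i j, cat (d i j)),
    (prod f).obj (fun i => (prod (g i)).obj (X i)) ≅ (prod (f.comp g)).obj (fun p => X p.1 p.2)
  unit : ∀ {t : C} (X : cat t), X ≅ (prod (POp.one P t)).obj (fun _ => X)
  perm : ∀ {I J : Type} [Finite I] [Finite J] (σ : J ≃ I) {c : I → C} {t : C} (f : POp P c t)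
    (f' : POp P (fun j => c (σ j)) t) (_ : f' = f.perm σ)
    (X : ∀ i, cat (c i)), (prod f).obj X ≅ (prod f').obj (fun j => X (σ j))
  comp_naturality : ∀ {I : Type} [Finite I] {J : I → Type} [∀ i, Finite (J i)] {c : I → C}
    {d : ∀ i, J i → C} {t : C} (f : POp P c t) (g : ∀ i, POp P (d i) (c i))
    {X Y : ∀ i j, cat (d i j)} (h : ∀ i j, X i j ⟶ Y i j),
    (prod f).map (fun i => (prod (g i)).map (h i)) ≫ (comp f g Y).hom =
      (comp f g X).hom ≫ (prod (f.comp g)).map (fun p => h p.1 p.2)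
  unit_naturality : ∀ {t : C} {X Y : cat t} (h : X ⟶ Y),
    h ≫ (unit Y).hom = (unit X).hom ≫ (prod (POp.one P t)).map (fun _ => h)
  perm_naturality : ∀ {I J : Type} [Finite I] [Finite J] (σ : J ≃ I) {c : I → C} {t : C}
    (f : POp P c t) (f' : POp P (fun j => c (σ j)) t) (hf : f' = f.perm σ)
    {X Y : ∀ i, cat (c i)} (h : ∀ i, X i ⟶ Y i),
    (prod f).map h ≫ (perm σ f f' hf Y).hom =
      (perm σ f f' hf X).hom ≫ (prod f').map (fun j => h (σ j))
  assoc : ∀ {I : Type} [Finite I] {J : I → Type} [∀ i, Finite (J i)] {L : ∀ i, J i → Type}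
    [∀ i j, Finite (L i j)] {c : I → C} {d : ∀ i, J i → C} {e : ∀ i j, L i j → C} {t : C}
    (f : POp P c t) (g : ∀ i, POp P (d i) (c i)) (h : ∀ i j, POp P (e i j) (d i j))
    (X : ∀ i j l, cat (e i j l)),
    (comp f g fun i j => (prod (h i j)).obj (X i j)).hom ≫
        (comp (f.comp g) (fun p => h p.1 p.2) (fun p => X p.1 p.2)).hom =
      (prod f).map (fun i => (comp (g i) (h i) (X i)).hom) ≫
        (comp f (fun i => (g i).comp (h i)) (fun i p => X i p.1 p.2)).hom ≫
        (perm (Equiv.sigmaAssoc L) (f.comp fun i => (g i).comp (h i))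
          ((f.comp g).comp fun p => h p.1 p.2) (POp.ext (funext fun _ => (Category.assoc ..).symm))
          (fun q => X q.1 q.2.1 q.2.2)).hom
  unit_comp : ∀ {I : Type} [Finite I] {c : I → C} {t : C} (f : POp P c t) (X : ∀ i, cat (c i)),
    (unit ((prod f).obj X)).hom ≫ (comp (POp.one P t) (fun _ => f) (fun _ => X)).hom =
      (perm (sigmaUnitLeft I) f ((POp.one P t).comp fun _ => f)
        (POp.ext (funext fun _ => Category.comp_id _)) X).hom
  comp_unit : ∀ {I : Type} [Finite I] {c : I → C} {t : C} (f : POp P c t) (X : ∀ i, cat (c i)),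
    (prod f).map (fun i => (unit (X i)).hom) ≫
        (comp f (fun i => POp.one P (c i)) (fun i _ => X i)).hom =
      (perm (sigmaUnitRight I) f (f.comp fun i => POp.one P (c i))
        (POp.ext (funext fun _ => Category.id_comp _)) X).hom
  perm_refl : ∀ {I : Type} [Finite I] {c : I → C} {t : C} (f : POp P c t) (X : ∀ i, cat (c i)),
    perm (Equiv.refl I) f f rfl X = Iso.refl _
  perm_trans : ∀ {I J L : Type} [Finite I] [Finite J] [Finite L] (σ : J ≃ I) (τ : L ≃ J)
    {c : I → C} {t : C} (f : POp P c t) (X : ∀ i, cat (c i)),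
    (perm σ f (f.perm σ) rfl X).hom ≫
        (perm τ (f.perm σ) ((f.perm σ).perm τ) rfl (fun j => X (σ j))).hom =
      (perm (τ.trans σ) f ((f.perm σ).perm τ) rfl X).hom
  perm_comp : ∀ {I I' : Type} [Finite I] [Finite I'] (σ : I' ≃ I) {J : I → Type}
    [∀ i, Finite (J i)] {c : I → C} {d : ∀ i, J i → C} {t : C} (f : POp P c t)
    (g : ∀ i, POp P (d i) (c i)) (X : ∀ i j, cat (d i j)),
    (comp f g X).hom ≫ (perm (Equiv.sigmaCongrLeft (β := J) σ) (f.comp g)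
        ((f.perm σ).comp fun i => g (σ i)) rfl (fun p => X p.1 p.2)).hom =
      (perm σ f (f.perm σ) rfl fun i => (prod (g i)).obj (X i)).hom ≫
        (comp (f.perm σ) (fun i => g (σ i)) (fun i => X (σ i))).hom
  comp_perm : ∀ {I : Type} [Finite I] {J J' : I → Type} [∀ i, Finite (J i)] [∀ i, Finite (J' i)]
    (τ : ∀ i, J' i ≃ J i) {c : I → C} {d : ∀ i, J i → C} {t : C} (f : POp P c t)
    (g : ∀ i, POp P (d i) (c i)) (X : ∀ i j, cat (d i j)),
    (comp f g X).hom ≫ (perm (Equiv.sigmaCongrRight τ) (f.comp g)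
        (f.comp fun i => (g i).perm (τ i)) rfl (fun p => X p.1 p.2)).hom =
      (prod f).map (fun i => (perm (τ i) (g i) _ rfl (X i)).hom) ≫
        (comp f (fun i => (g i).perm (τ i)) (fun i j => X i (τ i j))).hom

namespace TwoAQFT

variable {K : Type u} [Field K] {C : Type v} [Category.{w} C] {P : Orthogonality C}

/-- The `1`-morphisms of categorified algebraic quantum field theories: pseudo-transformations. -/
structure Hom (A B : TwoAQFT K P) where
  app : ∀ c, A.cat c ⥤ B.cat c
  additive : ∀ c, (app c).Additive
  linear : ∀ c, (app c).Linear K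
  cocontinuous : ∀ c, PreservesColimitsOfSize.{u, u} (app c)
  iso : ∀ {I : Type} [Finite I] {c : I → C} {t : C} (f : POp P c t) (X : ∀ i, A.cat (c i)),
    (B.prod f).obj (fun i => (app (c i)).obj (X i)) ≅ (app t).obj ((A.prod f).obj X)
  naturality : ∀ {I : Type} [Finite I] {c : I → C} {t : C} (f : POp P c t)
    {X Y : ∀ i, A.cat (c i)} (h : ∀ i, X i ⟶ Y i),
    (B.prod f).map (fun i => (app (c i)).map (h i)) ≫ (iso f Y).hom =
      (iso f X).hom ≫ (app t).map ((A.prod f).map h)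
  comp : ∀ {I : Type} [Finite I] {J : I → Type} [∀ i, Finite (J i)] {c : I → C}
    {d : ∀ i, J i → C} {t : C} (f : POp P c t) (g : ∀ i, POp P (d i) (c i))
    (X : ∀ i j, A.cat (d i j)),
    (B.comp f g fun i j => (app (d i j)).obj (X i j)).hom ≫
        (iso (f.comp g) fun p => X p.1 p.2).hom =
      (B.prod f).map (fun i => (iso (g i) (X i)).hom) ≫
        (iso f fun i => (A.prod (g i)).obj (X i)).hom ≫ (app t).map (A.comp f g X).hom
  unit : ∀ {t : C} (X : A.cat t),
    (B.unit ((app t).obj X)).hom ≫ (iso (POp.one P t) fun _ => X).hom =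
      (app t).map (A.unit X).hom
  perm : ∀ {I J : Type} [Finite I] [Finite J] (σ : J ≃ I) {c : I → C} {t : C} (f : POp P c t)
    (X : ∀ i, A.cat (c i)),
    (B.perm σ f (f.perm σ) rfl fun i => (app (c i)).obj (X i)).hom ≫
        (iso (f.perm σ) fun j => X (σ j)).hom =
      (iso f X).hom ≫ (app t).map (A.perm σ f (f.perm σ) rfl X).hom

attribute [instance] Hom.additive Hom.linear Hom.cocontinuous

/-- The identity `1`-morphism. -/
def Hom.id (A : TwoAQFT K P) : Hom A A where
  app c := 𝟭 (A.cat c)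
  additive _ := inferInstance
  linear _ := inferInstance
  cocontinuous _ := inferInstance
  iso f X := Iso.refl _
  naturality f _ _ h := by simp
  comp f g X := by
    have : (A.prod f).map (fun i => 𝟙 ((A.prod (g i)).obj (X i))) = 𝟙 _ := (A.prod f).map_id _
    simp [this]
  unit X := by simp
  perm σ _ _ f X := by simp

/-- Composition of `1`-morphisms. -/
def Hom.trans {A B D : TwoAQFT K P} (ζ : Hom A B) (κ : Hom B D) : Hom A D where
  app c := ζ.app c ⋙ κ.app c
  additive _ := inferInstance
  linear _ := inferInstance
  cocontinuous _ := inferInstance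
  iso f X := κ.iso f (fun i => (ζ.app _).obj (X i)) ≪≫ (κ.app _).mapIso (ζ.iso f X)
  naturality f X Y h := by
    have h1 := κ.naturality f fun i => (ζ.app _).map (h i)
    have h2 := congrArg (κ.app _).map (ζ.naturality f h)
    simp only [Functor.map_comp] at h2
    simp only [Iso.trans_hom, Functor.mapIso_hom, Functor.comp_map, Category.assoc]
    rw [← h2, ← Category.assoc, ← Category.assoc, ← h1]
  comp f g X := by
    have h1 := κ.comp f g fun i j => (ζ.app _).obj (X i j)
    have h2 := congrArg (κ.app _).map (ζ.comp f g X)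
    have h3 := κ.naturality f fun i => (ζ.iso (g i) (X i)).hom
    have h4 := (D.prod f).map_comp (fun i => (κ.iso (g i) fun j => (ζ.app _).obj (X i j)).hom)
      (fun i => (κ.app _).map (ζ.iso (g i) (X i)).hom)
    simp only [Functor.map_comp] at h2
    simp only [Iso.trans_hom, Functor.mapIso_hom, Functor.comp_map, Category.assoc]
    refine (Category.assoc _ _ _).symm.trans ?_
    refine (congrArg (· ≫ _) h1).trans ?_
    simp only [Category.assoc]
    rw [h2]
    refine Eq.trans ?_ (congrArg (· ≫ _) h4).symm
    simp only [Category.assoc]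
    congr 1
    simp only [← Category.assoc]
    congr 2
    exact h3.symm
  unit X := by
    have h1 := κ.unit ((ζ.app _).obj X)
    have h2 := congrArg (κ.app _).map (ζ.unit X)
    simp only [Functor.map_comp] at h2
    simp only [Iso.trans_hom, Functor.mapIso_hom, Functor.comp_map]
    rw [← h2, ← h1, Category.assoc]
    rfl
  perm σ _ _ f X := by
    have h1 := κ.perm σ f fun i => (ζ.app _).obj (X i)
    have h2 := congrArg (κ.app _).map (ζ.perm σ f X)
    simp only [Functor.map_comp] at h2
    simp only [Iso.trans_hom, Functor.mapIso_hom, Functor.comp_map, Category.assoc]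
    rw [← h2, ← Category.assoc, ← Category.assoc, ← h1]
    rfl

/-- The `2`-morphisms: modifications. -/
@[ext]
structure Modification {A B : TwoAQFT K P} (ζ κ : Hom A B) where
  app : ∀ c, ζ.app c ⟶ κ.app c
  comm : ∀ {I : Type} [Finite I] {c : I → C} {t : C} (f : POp P c t) (X : ∀ i, A.cat (c i)),
    (B.prod f).map (fun i => (app (c i)).app (X i)) ≫ (κ.iso f X).hom =
      (ζ.iso f X).hom ≫ (app t).app ((A.prod f).obj X)

instance (A B : TwoAQFT K P) : Category (Hom A B) where
  Hom := Modification
  id ζ := ⟨fun _ => 𝟙 _, fun f X => by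
    have : (B.prod f).map (fun i => 𝟙 ((ζ.app _).obj (X i))) = 𝟙 _ := (B.prod f).map_id _
    simp [this]⟩
  comp Γ Δ := ⟨fun c => Γ.app c ≫ Δ.app c, fun f X => by
    have h := (B.prod f).map_comp (fun i => (Γ.app _).app (X i)) (fun i => (Δ.app _).app (X i))
    refine (congrArg (· ≫ _) h).trans ?_
    rw [Category.assoc, Δ.comm, ← Category.assoc, Γ.comm, Category.assoc]
    rfl⟩
  id_comp Γ := Modification.ext (funext fun _ => Category.id_comp _)
  comp_id Γ := Modification.ext (funext fun _ => Category.comp_id _)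
  assoc Γ Δ Θ := Modification.ext (funext fun _ => Category.assoc ..)

/-- Equivalences in the `2`-category of categorified algebraic quantum field theories. -/
def IsEquivalence {A B : TwoAQFT K P} (ζ : Hom A B) : Prop :=
  ∃ κ : Hom B A, Nonempty (Hom.id A ≅ ζ.trans κ) ∧ Nonempty (κ.trans ζ ≅ Hom.id B)

end TwoAQFT

namespace TwoAQFT

variable {K : Type u} [Field K] {C : Type v} [Category.{w} C] {P : Orthogonality C}
  (A : TwoAQFT K P)

instance {I : Type} {J : I → Type} [∀ i, IsEmpty (J i)] : IsEmpty (Σ i, J i) :=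
  ⟨fun p => isEmptyElim p.2⟩

/-- The pointing given by the operation of arity zero. -/
def pt (t : C) : A.cat t := (A.prod (POp.zero P t)).obj fun i => i.elim

lemma obj_eq_pt {c : Empty → C} {t : C} (f : POp P c t) (X : ∀ i, A.cat (c i)) :
    (A.prod f).obj X = A.pt t := by
  obtain rfl : c = fun i => i.elim := funext fun i => i.elim
  obtain rfl : f = POp.zero P t := POp.ext (funext fun i => i.elim)
  obtain rfl : X = fun i => i.elim := funext fun i => i.elim
  rfl

/-- The identification of all operations of arity zero. -/
def emptyIso {I : Type} [Finite I] [IsEmpty I] {c : I → C} {t : C} (f : POp P c t)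
    (X : ∀ i, A.cat (c i)) : (A.prod f).obj X ≅ A.pt t :=
  A.perm (Equiv.equivOfIsEmpty Empty I) f _ rfl X ≪≫ eqToIso (A.obj_eq_pt _ _)

lemma emptyIso_eq {I : Type} [Finite I] [IsEmpty I] {c : I → C} {t : C} (f : POp P c t)
    (X : ∀ i, A.cat (c i)) (τ : Empty ≃ I) :
    A.emptyIso f X = A.perm τ f _ rfl X ≪≫ eqToIso (A.obj_eq_pt _ _) := by
  obtain rfl : τ = Equiv.equivOfIsEmpty Empty I := Subsingleton.elim _ _
  rfl

lemma emptyIso_perm {I J : Type} [Finite I] [Finite J] [IsEmpty I] [IsEmpty J] (σ : J ≃ I)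
    {c : I → C} {t : C} (f : POp P c t) (f' : POp P (fun j => c (σ j)) t) (hf : f' = f.perm σ)
    (X : ∀ i, A.cat (c i)) :
    (A.perm σ f f' hf X).hom ≫ (A.emptyIso f' fun j => X (σ j)).hom = (A.emptyIso f X).hom := by
  subst hf
  rw [A.emptyIso_eq f X ((Equiv.equivOfIsEmpty Empty J).trans σ), emptyIso, Iso.trans_hom,
    Iso.trans_hom, ← Category.assoc]
  exact congrArg (· ≫ _) (A.perm_trans σ _ f X)

lemma emptyIso_empty {c : Empty → C} {t : C} (f : POp P c t) (X : ∀ i, A.cat (c i)) :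
    A.emptyIso f X = eqToIso (A.obj_eq_pt f X) := by
  rw [A.emptyIso_eq f X (Equiv.refl _)]
  have := A.perm_refl f X
  refine (congrArg (· ≪≫ _) this).trans ?_
  exact Iso.refl_trans _

/-- The operations preserve the pointings. -/
def ptIso {I : Type} [Finite I] {c : I → C} {t : C} (f : POp P c t) :
    (A.prod f).obj (fun i => A.pt (c i)) ≅ A.pt t :=
  A.comp f (fun i => POp.zero P (c i)) (fun _ j => j.elim) ≪≫ A.emptyIso _ _

lemma map_emptyIso {I : Type} [Finite I] {J : I → Type} [∀ i, Finite (J i)] [∀ i, IsEmpty (J i)]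
    {c : I → C} {d : ∀ i, J i → C} {t : C} (f : POp P c t) (g : ∀ i, POp P (d i) (c i))
    (X : ∀ i j, A.cat (d i j)) :
    (A.prod f).map (fun i => (A.emptyIso (g i) (X i)).hom) ≫ (A.ptIso f).hom =
      (A.comp f g X).hom ≫ (A.emptyIso _ _).hom := by
  have key : ∀ (d : I → Empty → C) (g : ∀ i, POp P (d i) (c i)) (X : ∀ i j, A.cat (d i j)),
      (A.prod f).map (fun i => eqToHom (A.obj_eq_pt (g i) (X i))) ≫ (A.ptIso f).hom =
        (A.comp f g X).hom ≫ (A.emptyIso _ _).hom := by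
    intro d g X
    obtain rfl : d = fun _ i => i.elim := funext fun _ => funext fun i => i.elim
    obtain rfl : g = fun i => POp.zero P (c i) := funext fun i => POp.ext (funext fun i => i.elim)
    obtain rfl : X = fun _ i => i.elim := funext fun _ => funext fun i => i.elim
    refine (congrArg (· ≫ _) ((A.prod f).map_id _)).trans ?_
    exact Category.id_comp _
  let τ : ∀ i, Empty ≃ J i := fun i => Equiv.equivOfIsEmpty Empty (J i)
  have h1 := A.comp_perm τ f g X
  have h2 := key _ (fun i => (g i).perm (τ i)) (fun i j => X i (τ i j))
  have h3 := A.emptyIso_perm (Equiv.sigmaCongrRight τ) (f.comp g) _ rfl fun p => X p.1 p.2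
  have h4 := (A.prod f).map_comp (fun i => (A.perm (τ i) (g i) _ rfl (X i)).hom)
    (fun i => eqToHom (A.obj_eq_pt _ _))
  refine (congrArg (· ≫ _) h4).trans ?_
  rw [Category.assoc]
  refine (congrArg (_ ≫ ·) h2).trans ?_
  rw [← h3, ← Category.assoc, ← Category.assoc]
  exact congrArg (· ≫ _) h1.symm

lemma ptIso_comp {I : Type} [Finite I] {J : I → Type} [∀ i, Finite (J i)] {c : I → C}
    {d : ∀ i, J i → C} {t : C} (f : POp P c t) (g : ∀ i, POp P (d i) (c i)) :
    (A.comp f g fun i j => A.pt (d i j)).hom ≫ (A.ptIso (f.comp g)).hom =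
      (A.prod f).map (fun i => (A.ptIso (g i)).hom) ≫ (A.ptIso f).hom := by
  have h1 := A.assoc f g (fun i j => POp.zero P (d i j)) (fun _ _ i => i.elim)
  have h2 := A.map_emptyIso f (fun i => (g i).comp fun j => POp.zero P (d i j))
    (fun i p => p.2.elim)
  have h3 := A.emptyIso_perm (Equiv.sigmaAssoc fun (i : I) (j : J i) => Empty)
    (f.comp fun i => (g i).comp fun j => POp.zero P (d i j))
    ((f.comp g).comp fun p => POp.zero P (d p.1 p.2))
    (POp.ext (funext fun p => p.2.elim)) (fun q => q.2.2.elim)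
  have h4 := (A.prod f).map_comp
    (fun i => (A.comp (g i) (fun j => POp.zero P (d i j)) fun _ j => j.elim).hom)
    (fun i => (A.emptyIso ((g i).comp fun j => POp.zero P (d i j)) fun p => p.2.elim).hom)
  refine Eq.trans ?_ (congrArg (· ≫ _) h4).symm
  rw [Category.assoc, h2, ← h3]
  refine (Category.assoc _ _ _).symm.trans ((congrArg (· ≫ _) h1).trans ?_)
  exact (Category.assoc _ _ _).trans (congrArg (_ ≫ ·) (Category.assoc _ _ _))

lemma ptIso_perm {I J : Type} [Finite I] [Finite J] (σ : J ≃ I) {c : I → C} {t : C}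
    (f : POp P c t) :
    (A.perm σ f (f.perm σ) rfl fun i => A.pt (c i)).hom ≫ (A.ptIso (f.perm σ)).hom =
      (A.ptIso f).hom := by
  have h1 := A.perm_comp σ f (fun i => POp.zero P (c i)) (fun _ j => j.elim)
  have h2 := A.emptyIso_perm (Equiv.sigmaCongrLeft (β := fun _ => Empty) σ)
    (f.comp fun i => POp.zero P (c i)) ((f.perm σ).comp fun i => POp.zero P (c (σ i))) rfl
    fun p => p.2.elim
  refine (Category.assoc _ _ _).symm.trans ((congrArg (· ≫ _) h1.symm).trans ?_)
  exact (Category.assoc _ _ _).trans (congrArg (_ ≫ ·) h2)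

lemma ptIso_one (t : C) :
    (A.unit (A.pt t)).hom ≫ (A.ptIso (POp.one P t)).hom = 𝟙 _ := by
  have h1 := A.unit_comp (POp.zero P t) (fun i => i.elim)
  have h2 := A.emptyIso_perm (sigmaUnitLeft Empty) (POp.zero P t)
    ((POp.one P t).comp fun _ => POp.zero P t) (POp.ext (funext fun p => p.2.elim)) fun i => i.elim
  refine (Category.assoc _ _ _).symm.trans ((congrArg (· ≫ _) h1).trans (h2.trans ?_))
  exact congrArg Iso.hom (A.emptyIso_empty _ _)

/-- The multiplication maps on the endomorphisms of the pointings. -/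
def mul {I : Type} [Finite I] {c : I → C} {t : C} (f : POp P c t) (h : ∀ i, End (A.pt (c i))) :
    End (A.pt t) :=
  (A.ptIso f).inv ≫ (A.prod f).map h ≫ (A.ptIso f).hom

lemma mul_iff {I : Type} [Finite I] {c : I → C} {t : C} (f : POp P c t)
    (h : ∀ i, End (A.pt (c i))) (x : End (A.pt t)) :
    A.mul f h = x ↔ (A.prod f).map h ≫ (A.ptIso f).hom = (A.ptIso f).hom ≫ x :=
  Iso.inv_comp_eq _

lemma hom_mul {I : Type} [Finite I] {c : I → C} {t : C} (f : POp P c t)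
    (h : ∀ i, End (A.pt (c i))) :
    (A.ptIso f).hom ≫ A.mul f h = (A.prod f).map h ≫ (A.ptIso f).hom :=
  ((A.mul_iff f h _).1 rfl).symm

lemma mul_mul {I : Type} [Finite I] {c : I → C} {t : C} (f : POp P c t)
    (h h' : ∀ i, End (A.pt (c i))) : A.mul f (h * h') = A.mul f h * A.mul f h' := by
  rw [mul_iff]
  have h1 : (A.prod f).map (h * h') = (A.prod f).map h' ≫ (A.prod f).map h :=
    (A.prod f).map_comp _ _
  rw [h1, Category.assoc]
  change _ = _ ≫ (A.mul f h' ≫ A.mul f h)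
  rw [← hom_mul, ← Category.assoc, ← Category.assoc, ← hom_mul]

lemma mul_one {I : Type} [Finite I] {c : I → C} {t : C} (f : POp P c t) : A.mul f 1 = 1 := by
  rw [mul_iff]
  have h1 : (A.prod f).map (1 : ∀ i, End (A.pt (c i))) = 𝟙 _ := (A.prod f).map_id _
  rw [h1]
  exact (Category.id_comp _).trans (Category.comp_id _).symm

lemma mul_comp {I : Type} [Finite I] {J : I → Type} [∀ i, Finite (J i)] {c : I → C}
    {d : ∀ i, J i → C} {t : C} (f : POp P c t) (g : ∀ i, POp P (d i) (c i))
    (h : ∀ i j, End (A.pt (d i j))) :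
    A.mul (f.comp g) (fun p => h p.1 p.2) = A.mul f fun i => A.mul (g i) (h i) := by
  rw [mul_iff, ← cancel_epi (A.comp f g fun i j => A.pt (d i j)).hom]
  have h1 := A.comp_naturality f g h
  have h2 := A.ptIso_comp f g
  have h3 : (fun i => (A.prod (g i)).map (h i) ≫ (A.ptIso (g i)).hom) =
    (fun i => (A.ptIso (g i)).hom ≫ A.mul (g i) (h i)) :=
    funext fun i => (A.hom_mul (g i) (h i)).symm
  have h4 := ((A.prod f).map_comp (fun i => (A.prod (g i)).map (h i))
    (fun i => (A.ptIso (g i)).hom)).symm.trans ((congrArg (A.prod f).map h3).trans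
      ((A.prod f).map_comp (fun i => (A.ptIso (g i)).hom) (fun i => A.mul (g i) (h i))))
  rw [← Category.assoc]
  refine (congrArg (· ≫ _) h1.symm).trans ?_
  refine (Category.assoc _ _ _).trans ((congrArg (_ ≫ ·) h2).trans ?_)
  refine Eq.trans ?_ ((congrArg (· ≫ _) h2.symm).trans (Category.assoc _ _ _))
  rw [Category.assoc, hom_mul, ← Category.assoc, ← Category.assoc]
  exact congrArg (· ≫ _) h4

lemma mul_perm {I J : Type} [Finite I] [Finite J] (σ : J ≃ I) {c : I → C} {t : C}
    (f : POp P c t) (f' : POp P (fun j => c (σ j)) t) (hf : f' = f.perm σ)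
    (h : ∀ i, End (A.pt (c i))) : A.mul f' (fun j => h (σ j)) = A.mul f h := by
  subst hf
  rw [mul_iff, ← cancel_epi (A.perm σ f _ rfl fun i => A.pt (c i)).hom]
  have h1 := A.perm_naturality σ f _ rfl h
  have h2 := A.ptIso_perm σ f
  rw [← Category.assoc]
  refine (congrArg (· ≫ _) h1.symm).trans ?_
  refine (Category.assoc _ _ _).trans ((congrArg (_ ≫ ·) h2).trans ?_)
  refine Eq.trans ?_ ((congrArg (· ≫ _) h2.symm).trans (Category.assoc _ _ _))
  rw [hom_mul]

lemma mul_id {t : C} (h : End (A.pt t)) : A.mul (POp.one P t) (fun _ => h) = h := by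
  rw [mul_iff, ← cancel_epi (A.unit (A.pt t)).hom]
  have h1 := A.unit_naturality h
  have h2 := A.ptIso_one t
  rw [← Category.assoc, ← Category.assoc]
  refine (congrArg (· ≫ _) h1.symm).trans ?_
  refine Eq.trans ?_ (congrArg (· ≫ _) h2.symm)
  rw [Category.assoc, h2]
  exact (Category.comp_id h).trans (Category.id_comp h).symm

lemma mul_unary_comp {c d t : C} (f : c ⟶ d) (g : d ⟶ t) (h : End (A.pt c)) :
    A.mul (POp.unary (P := P) (f ≫ g)) (fun _ => h) =
      A.mul (POp.unary (P := P) g) fun _ => A.mul (POp.unary (P := P) f) fun _ => h := by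
  rw [← A.mul_comp (POp.unary g) (fun _ => POp.unary f) fun _ _ => h]
  exact (A.mul_perm (sigmaUnitLeft Unit) (POp.unary (f ≫ g)) _ rfl fun _ => h).symm

lemma mul_single {I : Type} [Finite I] [DecidableEq I] {c : I → C} {t : C} (f : POp P c t) (k : I)
    (h : End (A.pt (c k))) :
    A.mul f (Pi.mulSingle k h) = A.mul (POp.unary (P := P) (f.hom k)) fun _ => h := by
  let g : ∀ i, POp P (fun _ : PLift (i = k) => c i) (c i) := fun i =>
    ⟨fun _ => 𝟙 _, fun _ _ h => absurd (Subsingleton.elim _ _) h⟩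
  let h' : ∀ i, PLift (i = k) → End (A.pt (c i)) := fun i e => e.down ▸ h
  have h1 : (fun i => A.mul (g i) (h' i)) = Pi.mulSingle k h := by
    funext i
    by_cases hi : i = k
    · subst hi
      rw [Pi.mulSingle_eq_same]
      let σ : PLift (i = i) ≃ Unit := ⟨fun _ => (), fun _ => ⟨rfl⟩, fun _ => rfl, fun _ => rfl⟩
      exact (A.mul_perm σ (POp.one P (c i)) (g i) rfl fun _ => h).trans (A.mul_id h)
    · rw [Pi.mulSingle_eq_of_ne hi]
      have : h' i = 1 := funext fun e => absurd e.down hi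
      rw [this, A.mul_one]
  rw [← h1, ← A.mul_comp f g h']
  let σ : Unit ≃ (Σ i, PLift (i = k)) := ⟨fun _ => ⟨k, ⟨rfl⟩⟩, fun _ => (), fun _ => rfl, by
    rintro ⟨i, ⟨rfl⟩⟩; rfl⟩
  exact (A.mul_perm σ (f.comp g) (POp.unary (f.hom k))
    (POp.ext (funext fun _ => (Category.id_comp _).symm)) fun p => h' p.1 p.2).symm

end TwoAQFT

section Truncation

variable (K : Type u) [Field K] {C : Type v} [Category.{w} C] (P : Orthogonality C)

/-- The `⊥`-commutativity property of a functor to algebras. -/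
def PerpCommutative : ObjectProperty (C ⥤ AlgCat.{u} K) := fun F =>
  ∀ ⦃c₁ c₂ t : C⦄ (f₁ : c₁ ⟶ t) (f₂ : c₂ ⟶ t), P.Perp f₁ f₂ → ∀ (a : F.obj c₁) (b : F.obj c₂),
    (F.map f₁).hom a * (F.map f₂).hom b = (F.map f₂).hom b * (F.map f₁).hom a

/-- The category of algebraic quantum field theories. -/
abbrev AQFT := (PerpCommutative.{u, v, w} K P).FullSubcategory

variable {K P}

lemma slot_unit {D : Unit → Type (u + 1)} [∀ i, Category.{u} (D i)] (X : ∀ i, D i) :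
    slot X () = Functor.pi' fun j => 𝟭 (D j) := by
  classical
  refine Functor.pi_ext _ _ fun j => ?_
  rw [Functor.pi'_eval]
  exact slot_self X j

lemma IsMulti.unit_add {D : Unit → Type (u + 1)} [∀ i, Category.{u} (D i)]
    [∀ i, Preadditive (D i)] [∀ i, Linear K (D i)] {T : Type (u + 1)} [Category.{u} T]
    [Preadditive T] [Linear K T] {F : (∀ i, D i) ⥤ T} (hF : IsMulti K F) {X Y : ∀ i, D i}
    (f g : ∀ i, X i ⟶ Y i) : F.map (fun i => f i + g i) = F.map f + F.map g := by
  have := hF.additive X ()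
  rw [slot_unit] at this
  exact (Functor.pi' (fun j => 𝟭 (D j)) ⋙ F).map_add (f := f ()) (g := g ())

lemma IsMulti.unit_smul {D : Unit → Type (u + 1)} [∀ i, Category.{u} (D i)]
    [∀ i, Preadditive (D i)] [∀ i, Linear K (D i)] {T : Type (u + 1)} [Category.{u} T]
    [Preadditive T] [Linear K T] {F : (∀ i, D i) ⥤ T} (hF : IsMulti K F) {X Y : ∀ i, D i}
    (f : ∀ i, X i ⟶ Y i) (k : K) : F.map (fun i => k • f i) = k • F.map f := by
  have := hF.linear X ()
  rw [slot_unit] at this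
  exact (Functor.pi' (fun j => 𝟭 (D j)) ⋙ F).map_smul k (f ())

namespace TwoAQFT

variable (A B : TwoAQFT K P)

/-- The action of a morphism on the endomorphism algebras of the pointings. -/
def mulHom {c d : C} (f : c ⟶ d) : End (A.pt c) →ₐ[K] End (A.pt d) :=
  AlgHom.ofLinearMap
    { toFun := fun h => A.mul (POp.unary f) fun _ => h
      map_add' := fun h h' => by
        have := (A.isMulti (POp.unary (P := P) f)).unit_add (X := fun _ => A.pt c)
          (Y := fun _ => A.pt c) (fun _ => h) (fun _ => h')
        rw [mul, this, Preadditive.add_comp, Preadditive.comp_add]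
        rfl
      map_smul' := fun k h => by
        have := (A.isMulti (POp.unary (P := P) f)).unit_smul (X := fun _ => A.pt c)
          (Y := fun _ => A.pt c) (fun _ => h) k
        rw [mul, this, Linear.smul_comp, Linear.comp_smul]
        rfl }
    (A.mul_one _) (fun h h' => A.mul_mul _ (fun _ => h) (fun _ => h'))

lemma mulHom_apply {c d : C} (f : c ⟶ d) (h : End (A.pt c)) :
    A.mulHom f h = A.mul (POp.unary f) fun _ => h := rfl

/-- The truncation of a categorified algebraic quantum field theory, on objects. -/
def trunc : AQFT K P where
  obj :=
    { obj := fun c => AlgCat.of K (End (A.pt c))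
      map := fun f => AlgCat.ofHom (A.mulHom f)
      map_id := fun c => AlgCat.hom_ext _ (AlgHom.ext fun h => A.mul_id h)
      map_comp := fun f g => AlgCat.hom_ext _ (AlgHom.ext fun h => A.mul_unary_comp f g h) }
  property c₁ c₂ t f₁ f₂ h a b := by
    let c : Bool → C := fun b => b.rec c₂ c₁
    let p : POp P c t := ⟨fun b => b.rec f₂ f₁, by
      rintro (_ | _) (_ | _) hb
      · exact absurd rfl hb
      · exact P.symm h
      · exact h
      · exact absurd rfl hb⟩
    have h1 := A.mul_single p true a
    have h2 := A.mul_single p false b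
    refine (congrArg₂ (· * ·) h1 h2).symm.trans
      (Eq.trans ?_ (congrArg₂ (· * ·) h2 h1))
    change A.mul p _ * A.mul p _ = A.mul p _ * A.mul p _
    rw [← A.mul_mul, ← A.mul_mul]
    exact congrArg (A.mul p)
      (Pi.mulSingle_commute (f := fun i => End (A.pt (c i))) (by decide : true ≠ false) a b).eq

variable {A B}

/-- `1`-morphisms preserve the pointings. -/
def Hom.ptIso (ζ : Hom A B) (t : C) : B.pt t ≅ (ζ.app t).obj (A.pt t) :=
  (B.emptyIso (POp.zero P t) fun i => (ζ.app _).obj i.elim).symm ≪≫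
    ζ.iso (POp.zero P t) fun i => i.elim

lemma Hom.emptyIso_ptIso (ζ : Hom A B) (t : C) :
    (B.emptyIso (POp.zero P t) fun i => (ζ.app _).obj i.elim).hom ≫ (ζ.ptIso t).hom =
      (ζ.iso (POp.zero P t) fun i => i.elim).hom :=
  Iso.hom_inv_id_assoc _ _

lemma Hom.iso_emptyIso (ζ : Hom A B) {I : Type} [Finite I] [IsEmpty I] {c : I → C} {t : C}
    (f : POp P c t) (X : ∀ i, A.cat (c i)) :
    (ζ.iso f X).hom ≫ (ζ.app t).map (A.emptyIso f X).hom =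
      (B.emptyIso f fun i => (ζ.app _).obj (X i)).hom ≫ (ζ.ptIso t).hom := by
  have key : ∀ {c : Empty → C} (f : POp P c t) (X : ∀ i, A.cat (c i)),
      (ζ.iso f X).hom ≫ (ζ.app t).map (A.emptyIso f X).hom =
        (B.emptyIso f fun i => (ζ.app _).obj (X i)).hom ≫ (ζ.ptIso t).hom := by
    intro c f X
    obtain rfl : c = fun i => i.elim := funext fun i => i.elim
    obtain rfl : f = POp.zero P t := POp.ext (funext fun i => i.elim)
    obtain rfl : X = fun i => i.elim := funext fun i => i.elim
    rw [A.emptyIso_empty]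
    refine Eq.trans ?_ (ζ.emptyIso_ptIso t).symm
    exact (congrArg (_ ≫ ·) ((ζ.app t).map_id _)).trans (Category.comp_id _)
  let τ := Equiv.equivOfIsEmpty Empty I
  rw [← A.emptyIso_perm τ f _ rfl X, ← B.emptyIso_perm τ f _ rfl fun i => (ζ.app _).obj (X i),
    Functor.map_comp, ← Category.assoc, ← ζ.perm, Category.assoc, Category.assoc]
  exact congrArg (_ ≫ ·) (key _ _)

lemma Hom.ptIso_iso (ζ : Hom A B) {I : Type} [Finite I] {c : I → C} {t : C} (f : POp P c t) :
    (B.ptIso f).hom ≫ (ζ.ptIso t).hom = (B.prod f).map (fun i => (ζ.ptIso (c i)).hom) ≫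
      (ζ.iso f fun i => A.pt (c i)).hom ≫ (ζ.app t).map (A.ptIso f).hom := by
  have h1 := B.map_emptyIso f (fun i => POp.zero P (c i)) fun i j => (ζ.app _).obj j.elim
  have h2 := ζ.iso_emptyIso (f.comp fun i => POp.zero P (c i)) fun p => p.2.elim
  have h3 := ζ.comp f (fun i => POp.zero P (c i)) fun i j => j.elim
  have h4 := (B.prod f).map_comp
    (fun i => (B.emptyIso (POp.zero P (c i)) fun j => (ζ.app _).obj j.elim).hom)
    (fun i => (ζ.ptIso (c i)).hom)
  have h5 := congrArg (B.prod f).map (funext fun i => ζ.emptyIso_ptIso (c i))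
  have hi : IsIso (fun i => (B.emptyIso (POp.zero P (c i)) fun j => (ζ.app _).obj j.elim).hom :
      (fun i => (B.prod (POp.zero P (c i))).obj fun j => (ζ.app _).obj j.elim) ⟶
        fun i => B.pt (c i)) := (isIso_pi_iff _).2 fun i => inferInstance
  replace h4 := h4.symm.trans h5
  rw [← cancel_epi ((B.prod f).map
    fun i => (B.emptyIso (POp.zero P (c i)) fun j => (ζ.app _).obj j.elim).hom)]
  refine (Category.assoc _ _ _).symm.trans ((congrArg (· ≫ _) h1).trans ?_)
  refine Eq.trans ?_ (Category.assoc _ _ _)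
  refine Eq.trans ?_ (congrArg (· ≫ _) h4.symm)
  refine (Category.assoc _ _ _).trans ((congrArg (_ ≫ ·) h2.symm).trans ?_)
  refine (Category.assoc _ _ _).symm.trans ((congrArg (· ≫ _) h3).trans ?_)
  refine (Category.assoc _ _ _).trans (congrArg (_ ≫ ·) ((Category.assoc _ _ _).trans (congrArg (_ ≫ ·) ?_)))
  exact ((ζ.app t).map_comp _ _).symm

lemma Hom.mul_conj (ζ : Hom A B) {I : Type} [Finite I] {c : I → C} {t : C} (f : POp P c t)
    (h : ∀ i, End (A.pt (c i))) (h' : ∀ i, End (B.pt (c i)))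
    (hh : ∀ i, h' i ≫ (ζ.ptIso (c i)).hom = (ζ.ptIso (c i)).hom ≫ (ζ.app (c i)).map (h i)) :
    B.mul f h' ≫ (ζ.ptIso t).hom = (ζ.ptIso t).hom ≫ (ζ.app t).map (A.mul f h) := by
  have h1 := ζ.ptIso_iso f
  have h2 := ζ.naturality f h
  have h3 := congrArg (ζ.app t).map (A.hom_mul f h)
  rw [Functor.map_comp, Functor.map_comp] at h3
  have h4 := ((B.prod f).map_comp h' fun i => (ζ.ptIso (c i)).hom).symm.trans
    ((congrArg (B.prod f).map (funext hh)).trans ((B.prod f).map_comp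
      (fun i => (ζ.ptIso (c i)).hom) fun i => (ζ.app (c i)).map (h i)))
  rw [← cancel_epi (B.ptIso f).hom, ← Category.assoc, hom_mul, Category.assoc, h1,
    ← Category.assoc]
  refine (congrArg (· ≫ _) h4).trans ?_
  refine Eq.trans ?_ ((congrArg (· ≫ _) h1.symm).trans (Category.assoc _ _ _))
  refine (Category.assoc _ _ _).trans (Eq.trans ?_ (Category.assoc _ _ _).symm)
  refine congrArg (_ ≫ ·) ?_
  refine (Category.assoc _ _ _).symm.trans ((congrArg (· ≫ _) h2).trans ?_)
  exact (Category.assoc _ _ _).trans ((congrArg (_ ≫ ·) h3.symm).trans (Category.assoc _ _ _).symm)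

/-- The truncation of a `1`-morphism. -/
def truncHom (ζ : Hom A B) : trunc A ⟶ trunc B :=
  ObjectProperty.homMk
    { app := fun c => AlgCat.ofHom (AlgHom.ofLinearMap
        { toFun := fun h => ((ζ.ptIso c).hom ≫ (ζ.app c).map h ≫ (ζ.ptIso c).inv : End (B.pt c))
          map_add' := fun h h' => by
            rw [Functor.map_add, Preadditive.add_comp, Preadditive.comp_add]
          map_smul' := fun k h => by
            rw [Functor.map_smul, Linear.smul_comp, Linear.comp_smul]; rfl }
        (by
          change (ζ.ptIso c).hom ≫ (ζ.app c).map (𝟙 _) ≫ (ζ.ptIso c).inv = 𝟙 _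
          rw [CategoryTheory.Functor.map_id, Category.id_comp, Iso.hom_inv_id])
        (fun h h' => by
          change (ζ.ptIso c).hom ≫ (ζ.app c).map (h' ≫ h) ≫ (ζ.ptIso c).inv =
            (_ ≫ (ζ.app c).map h' ≫ _) ≫ _ ≫ (ζ.app c).map h ≫ _
          simp))
      naturality := fun c d f => AlgCat.hom_ext _ (AlgHom.ext fun h => by
        change (ζ.ptIso d).hom ≫ (ζ.app d).map (A.mulHom f h) ≫ (ζ.ptIso d).inv =
          B.mul (POp.unary f) fun _ => (ζ.ptIso c).hom ≫ (ζ.app c).map h ≫ (ζ.ptIso c).inv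
        rw [← Category.assoc, Iso.comp_inv_eq]
        exact (ζ.mul_conj (POp.unary f) (fun _ => h) _ fun _ => by simp).symm) }

end TwoAQFT

end Truncation

section Factorization

variable {K : Type u} [Field K] {I : Type} {A : I → Type u} [∀ i, Ring (A i)]
  [∀ i, Algebra K (A i)] {B : Type u} [Ring B] [Algebra K B] (f : ∀ i, A i →ₐ[K] B)

/-- The functor `(V i) ↦ facObj f V`. -/
noncomputable def facFunctor : (∀ i, ModuleCat.{u} (A i)ᵐᵒᵖ) ⥤ ModuleCat.{u} Bᵐᵒᵖ where
  obj V := facObj f V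
  map h := fmap f h
  map_id _ := fmap_id
  map_comp h h' := fmap_comp h h'

lemma colimit_induction {R : Type u} [Ring R] {J : Type u} [Category.{u} J]
    {F : J ⥤ ModuleCat.{u} R} {c : Cocone F} (hc : IsColimit c) {p : c.pt → Prop} (h0 : p 0)
    (ha : ∀ x y, p x → p y → p (x + y)) (hι : ∀ j x, p ((c.ι.app j).hom x)) (x : c.pt) : p x := by
  let S : Submodule R c.pt := ⨆ j, LinearMap.range (c.ι.app j).hom
  have hS : S = ⊤ := by
    have h : ModuleCat.ofHom S.mkQ = (0 : c.pt ⟶ ModuleCat.of R (c.pt ⧸ S)) := hc.hom_ext fun j => by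
      ext y
      simp only [comp_zero, ModuleCat.hom_comp, LinearMap.comp_apply]
      exact (Submodule.Quotient.mk_eq_zero _).2
        (Submodule.mem_iSup_of_mem j (LinearMap.mem_range_self _ _))
    rw [eq_top_iff]
    intro y _
    exact (Submodule.Quotient.mk_eq_zero _).1
      (LinearMap.congr_fun (congrArg ModuleCat.Hom.hom h) y)
  have hx : x ∈ S := by rw [hS]; trivial
  refine Submodule.iSup_induction _ (motive := p) hx ?_ h0 ha
  rintro j _ ⟨y, rfl⟩
  exact hι j y

variable {f} in
lemma gen_update_comp [DecidableEq I] {V V' : ∀ i, ModuleCat.{u} (A i)ᵐᵒᵖ} (h : ∀ i, V i ⟶ V' i)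
    (w : ∀ j, V j) (v : ∀ j, V' j) (i : I) (y : V i) (hw : ∀ j, j ≠ i → (h j).hom (w j) = v j) :
    (fmap f h).hom ((gen f).toFun (Function.update w i y)) =
      (gen f).toFun (Function.update v i ((h i).hom y)) := by
  rw [fmap_gen]
  congr 1
  funext j
  by_cases hj : j = i
  · subst hj; simp
  · simp [hj, hw]

lemma facFunctor_isColimit (i : I) {J : Type u} [Category.{u} J]
    (F : J ⥤ ∀ j, ModuleCat.{u} (A j)ᵐᵒᵖ) (c : Cocone F) (hiso : ∀ j, j ≠ i → ∀ x, IsIso (c.ι.app x j))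
    (hc : IsColimit ((Pi.eval _ i).mapCocone c)) :
    Nonempty (IsColimit ((facFunctor f).mapCocone c)) := by
  classical
  choose r hr using fun (v : ∀ j, c.pt j) (x : J) (j : I) =>
    show ∃ y : F.obj x j, j ≠ i → (c.ι.app x j).hom y = v j from by
      by_cases hj : j = i
      · exact ⟨0, fun h => absurd hj h⟩
      · have := hiso j hj x
        exact ⟨(inv (c.ι.app x j)).hom (v j), fun _ => by
          rw [← ModuleCat.comp_apply, IsIso.inv_hom_id]; rfl⟩
  have hinj : ∀ (x : J) (j : I), j ≠ i → Function.Injective (c.ι.app x j).hom := fun x j hj => by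
    have := hiso j hj x
    exact (ConcreteCategory.bijective_of_isIso (c.ι.app x j)).1
  have hsurj : ∀ (x : J) (j : I), j ≠ i → Function.Surjective (c.ι.app x j).hom := fun x j hj => by
    have := hiso j hj x
    exact (ConcreteCategory.bijective_of_isIso (c.ι.app x j)).2
  have hw : ∀ {x y : J} (φ : x ⟶ y) (j : I) (z : F.obj x j),
      (c.ι.app y j).hom ((F.map φ j).hom z) = (c.ι.app x j).hom z := fun φ j z => by
    rw [← ModuleCat.comp_apply]
    exact congrArg (fun (m : F.obj _ ⟶ c.pt) => (m j).hom z) (c.w φ)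
  let ψ : ∀ (s : Cocone (F ⋙ facFunctor f)) (x : J), Bal f (F.obj x) s.pt := fun s x =>
    (gen f).postcomp (s.ι.app x)
  have hψ : ∀ s x w, (s.ι.app x).hom ((gen f).toFun w) = (ψ s x).toFun w := fun _ _ _ => rfl
  -- the extension in the `i`-th slot
  let t : ∀ (s : Cocone (F ⋙ facFunctor f)) (v : ∀ j, c.pt j),
      Cocone (F ⋙ Pi.eval (fun j => ModuleCat.{u} (A j)ᵐᵒᵖ) i) := fun s v =>
    { pt := balTwist s.pt (f i)
      ι :=
        { app := fun x => ModuleCat.ofHom (X := F.obj x i) (Y := balTwist s.pt (f i))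
            { toFun := fun y => (ψ s x).toFun (Function.update (r v x) i y)
              map_add' := fun y z => (ψ s x).map_add ..
              map_smul' := fun a y => (ψ s x).map_act (r v x) i a.unop y }
          naturality := fun x y φ => by
            refine ModuleCat.hom_ext (LinearMap.ext fun (z : F.obj x i) => ?_)
            change (s.ι.app y).hom ((gen f).toFun (Function.update (r v y) i ((F.map φ i).hom z))) =
              (s.ι.app x).hom ((gen f).toFun (Function.update (r v x) i z))
            refine Eq.trans (congrArg (s.ι.app y).hom ?_)
              (LinearMap.congr_fun (congrArg ModuleCat.Hom.hom (s.w φ)) _)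
            refine (gen_update_comp (F.map φ) (r v x) _ i z fun j hj => ?_).symm
            apply hinj y j hj
            rw [hw, hr v x j hj, hr v y j hj] } }
  let D : ∀ (s : Cocone (F ⋙ facFunctor f)) (v : ∀ j, c.pt j), c.pt i →+ s.pt := fun s v =>
    { toFun := (hc.desc (t s v)).hom
      map_zero' := _root_.map_zero _
      map_add' := _root_.map_add _ }
  have hDl : ∀ s v a y, D s v (op a • y) = op (f i a) • D s v y := fun s v a y =>
    _root_.map_smul (hc.desc (t s v)).hom (op a) y
  have hD : ∀ s v x y (w : ∀ j, F.obj x j), (∀ j, j ≠ i → (c.ι.app x j).hom (w j) = v j) →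
      D s v ((c.ι.app x i).hom y) = (ψ s x).toFun (Function.update w i y) := by
    intro s v x y w hwv
    have h1 := LinearMap.congr_fun (congrArg ModuleCat.Hom.hom (hc.fac (t s v) x)) y
    refine h1.trans ?_
    change (ψ s x).toFun (Function.update (r v x) i y) = _
    congr 1
    funext j
    by_cases hj : j = i
    · subst hj; simp
    · rw [Function.update_of_ne hj, Function.update_of_ne hj]
      apply hinj x j hj
      rw [hr v x j hj, hwv j hj]
  have hind : ∀ {p : c.pt i → Prop} (_h0 : p 0) (_ha : ∀ x y, p x → p y → p (x + y))
      (_hι : ∀ (x : J) (y : F.obj x i), p ((c.ι.app x i).hom y)) (x : c.pt i), p x :=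
    fun h0 ha hι => colimit_induction hc h0 ha hι
  have hDi : ∀ s v z, D s (Function.update v i z) = D s v := by
    intro s v z
    ext y
    induction y using hind with
    | _h0 => simp
    | _ha x y hx hy => rw [_root_.map_add, _root_.map_add, hx, hy]
    | _hι x y =>
      refine (hD s _ x y (r v x) fun j hj => ?_).trans (hD s v x y (r v x) (hr v x)).symm
      rw [hr v x j hj, Function.update_of_ne hj]
  have hup : ∀ (v : ∀ j, c.pt j) (k : I) (x : J) (y : F.obj x k), ∀ j, j ≠ i →
      (c.ι.app x j).hom (Function.update (r v x) k y j) =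
        Function.update v k ((c.ι.app x k).hom y) j := by
    intro v k x y j hj
    by_cases hjk : j = k
    · subst hjk; simp
    · rw [Function.update_of_ne hjk, Function.update_of_ne hjk, hr v x j hj]
  let β : ∀ s : Cocone (F ⋙ facFunctor f), Bal f c.pt s.pt := fun s =>
    { toFun := fun v => D s v (v i)
      map_add := fun {inst} v k x y => by
        obtain rfl := Subsingleton.elim inst (fun a b => Classical.propDecidable (a = b))
        by_cases hk : k = i
        · subst hk
          simp only [hDi, Function.update_self, _root_.map_add]
        · simp only [Function.update_of_ne (Ne.symm hk)]
          generalize v i = z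
          induction z using hind with
          | _h0 => simp
          | _ha z z' hz hz' => simp only [_root_.map_add, hz, hz']; abel
          | _hι x₀ z =>
            obtain ⟨x, rfl⟩ := hsurj x₀ k hk x
            obtain ⟨y, rfl⟩ := hsurj x₀ k hk y
            rw [← _root_.map_add, hD s _ x₀ z _ (hup v k x₀ _), hD s _ x₀ z _ (hup v k x₀ _),
              hD s _ x₀ z _ (hup v k x₀ _)]
            simp only [Function.update_comm hk, (ψ s x₀).map_add]
      map_act := fun {inst} v k a x => by
        obtain rfl := Subsingleton.elim inst (fun a b => Classical.propDecidable (a = b))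
        by_cases hk : k = i
        · subst hk
          simp only [hDi, Function.update_self, hDl]
        · simp only [Function.update_of_ne (Ne.symm hk)]
          generalize v i = z
          induction z using hind with
          | _h0 => simp
          | _ha z z' hz hz' => simp only [_root_.map_add, hz, hz', smul_add]
          | _hι x₀ z =>
            obtain ⟨x, rfl⟩ := hsurj x₀ k hk x
            rw [← _root_.map_smul, hD s _ x₀ z _ (hup v k x₀ _), hD s _ x₀ z _ (hup v k x₀ _)]
            simp only [Function.update_comm hk, (ψ s x₀).map_act] }
  refine ⟨{ desc := fun s => fdesc (β s), fac := fun s x => fac_ext fun w => ?_, uniq := fun s m hm => fac_ext fun v => ?_ }⟩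
  · have h1 := fmap_gen (f := f) (c.ι.app x) w
    refine (congrArg (fdesc (β s)).hom h1).trans ?_
    rw [fdesc_gen]
    refine (hD s _ x (w i) w fun _ _ => rfl).trans ?_
    rw [Function.update_eq_self]
    rfl
  · rw [fdesc_gen]
    rw [← Function.update_eq_self i v]
    change _ = D s _ _
    rw [hDi, Function.update_self]
    generalize v i = z
    induction z using hind with
    | _h0 =>
      have := (gen f).map_act v i 0 0
      simp only [MulOpposite.op_zero, zero_smul, _root_.map_zero] at this
      rw [this, _root_.map_zero, _root_.map_zero]
    | _ha x y hx hy => rw [(gen f).map_add, _root_.map_add, _root_.map_add, hx, hy]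
    | _hι x z =>
      rw [hD s v x z (r v x) (hr v x), ← hψ, ← hm x, ← gen_update_comp (c.ι.app x) _ v i z (hr v x)]
      rfl

variable {f} in
lemma gen_eq_add {V : ∀ i, ModuleCat.{u} (A i)ᵐᵒᵖ} {x y z : ∀ i, V i} (i : I)
    (h : ∀ j, j ≠ i → x j = y j ∧ x j = z j) (hi : x i = y i + z i) :
    (gen f).toFun x = (gen f).toFun y + (gen f).toFun z := by
  classical
  have hy : Function.update x i (y i) = y := funext fun j => by
    by_cases hj : j = i
    · subst hj; simp
    · rw [Function.update_of_ne hj, (h j hj).1]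
  have hz : Function.update x i (z i) = z := funext fun j => by
    by_cases hj : j = i
    · subst hj; simp
    · simp [hj, (h j hj).2]
  rw [← Function.update_eq_self i x, hi, (gen f).map_add, hy, hz]

variable {f} in
lemma gen_eq_smul {V : ∀ i, ModuleCat.{u} (A i)ᵐᵒᵖ} {x y : ∀ i, V i} (i : I) (a : A i)
    (h : ∀ j, j ≠ i → x j = y j) (hi : x i = op a • y i) :
    (gen f).toFun x = op (f i a) • (gen f).toFun y := by
  classical
  have hy : Function.update x i (y i) = y := funext fun j => by
    by_cases hj : j = i
    · subst hj; simp
    · simp [hj, h j hj]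
  rw [← Function.update_eq_self i x, hi, (gen f).map_act, hy]

lemma fmap_add {X Y : ∀ i, ModuleCat.{u} (A i)ᵐᵒᵖ} (i : I) (p q r : ∀ i, X i ⟶ Y i)
    (h : ∀ j ≠ i, p j = q j ∧ p j = r j) (hi : p i = q i + r i) :
    fmap f p = fmap f q + fmap f r := fac_ext fun v => by
  rw [ModuleCat.hom_add, LinearMap.add_apply, fmap_gen, fmap_gen, fmap_gen]
  exact gen_eq_add i (fun j hj => by rw [← (h j hj).1, ← (h j hj).2]; exact ⟨rfl, rfl⟩)
    (by rw [hi]; rfl)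

lemma fmap_smul {X Y : ∀ i, ModuleCat.{u} (A i)ᵐᵒᵖ} (i : I) (p q : ∀ i, X i ⟶ Y i) (k : K)
    (h : ∀ j ≠ i, p j = q j) (hi : p i = k • q i) : fmap f p = k • fmap f q :=
  fac_ext fun v => by
    change (fmap f p).hom _ = op (algebraMap K B k) • (fmap f q).hom _
    rw [fmap_gen, fmap_gen, ← (f i).commutes]
    exact gen_eq_smul i _ (fun j hj => by rw [h j hj]) (by rw [hi]; rfl)

lemma facFunctor_isMulti : IsMulti K (facFunctor f) :=
  isMulti_of (fun _ _ i p q r h hi => fmap_add f i p q r h hi)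
    (fun _ _ i p q k h hi => fmap_smul f i p q k h hi)
    (fun i _ _ F c h hc => facFunctor_isColimit f i F c h hc.some)

end Factorization

section Iterated

variable {K : Type u} [Field K] {I : Type} {A : I → Type u} [∀ i, Ring (A i)]
  [∀ i, Algebra K (A i)] {B : Type u} [Ring B] [Algebra K B] {f : ∀ i, A i →ₐ[K] B}
  {J : I → Type} {A' : ∀ i, J i → Type u} [∀ i j, Ring (A' i j)]
  [∀ i j, Algebra K (A' i j)] {g : ∀ i j, A' i j →ₐ[K] A i}
  {X : ∀ i j, ModuleCat.{u} (A' i j)ᵐᵒᵖ} {fg : ∀ p : (Σ i, J i), A' p.1 p.2 →ₐ[K] B}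
  {W : ModuleCat.{u} Bᵐᵒᵖ}

lemma fac_ext₂ [Finite I] {m n : facObj f (fun i => facObj (g i) (X i)) ⟶ W}
    (H : ∀ x : ∀ i j, X i j, m.hom ((gen f).toFun fun i => (gen (g i)).toFun (x i)) =
      n.hom ((gen f).toFun fun i => (gen (g i)).toFun (x i))) : m = n := by
  have h := Bal.eq_of_slot (φ := (gen f).postcomp m) (ψ := (gen f).postcomp n) H
  exact fac_ext fun v => congrArg (fun φ => φ.toFun v) h

/-- The coherence for composition of operations: `V ⊗_A B ⊗_B D ≅ V ⊗_A D`. -/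
noncomputable def fcomp [Finite I] (hcomm : ∀ i j, i ≠ j → ∀ a b, Commute (f i a) (f j b))
    (hfg : ∀ i j a, fg ⟨i, j⟩ a = f i (g i j a)) :
    facObj f (fun i => facObj (g i) (X i)) ≅ facObj fg (fun p => X p.1 p.2) where
  hom := fdesc (genGen_surjective hcomm hfg (gen fg)).choose
  inv := fdesc (genGen hfg (gen f))
  hom_inv_id := fac_ext₂ fun x => by
    have h := congrArg (fun φ => φ.toFun fun p => x p.1 p.2)
      (genGen_surjective (X := X) hcomm hfg (gen fg)).choose_spec
    rw [ModuleCat.comp_apply, fdesc_gen]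
    refine (congrArg _ h).trans ?_
    rw [fdesc_gen]
    rfl
  inv_hom_id := fac_ext fun x => by
    have h := congrArg (fun φ => φ.toFun x)
      (genGen_surjective (X := X) hcomm hfg (gen fg)).choose_spec
    rw [ModuleCat.comp_apply, fdesc_gen]
    change (fdesc _).hom ((gen f).toFun _) = _
    rw [fdesc_gen]
    exact h

lemma fcomp_gen [Finite I] (hcomm : ∀ i j, i ≠ j → ∀ a b, Commute (f i a) (f j b))
    (hfg : ∀ i j a, fg ⟨i, j⟩ a = f i (g i j a)) (x : ∀ i j, X i j) :
    (fcomp hcomm hfg (X := X)).hom.hom ((gen f).toFun fun i => (gen (g i)).toFun (x i)) =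
      (gen fg).toFun fun p => x p.1 p.2 := by
  have h := congrArg (fun φ => φ.toFun fun p => x p.1 p.2)
    (genGen_surjective (X := X) hcomm hfg (gen fg)).choose_spec
  refine Eq.trans ?_ h
  exact fdesc_gen _ _

lemma fcomp_inv_gen [Finite I] (hcomm : ∀ i j, i ≠ j → ∀ a b, Commute (f i a) (f j b))
    (hfg : ∀ i j a, fg ⟨i, j⟩ a = f i (g i j a)) (x : ∀ p : (Σ i, J i), X p.1 p.2) :
    (fcomp hcomm hfg (X := X)).inv.hom ((gen fg).toFun x) =
      (gen f).toFun fun i => (gen (g i)).toFun fun j => x ⟨i, j⟩ :=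
  fdesc_gen _ _

lemma fac_ext₃ [Finite I] [∀ i, Finite (J i)]
    (hcomm : ∀ i j, i ≠ j → ∀ a b, Commute (f i a) (f j b))
    (hfg : ∀ i j a, fg ⟨i, j⟩ a = f i (g i j a)) {L : ∀ i, J i → Type}
    {A'' : ∀ i j, L i j → Type u} [∀ i j l, Ring (A'' i j l)] [∀ i j l, Algebra K (A'' i j l)]
    {h : ∀ i j l, A'' i j l →ₐ[K] A' i j} {Y : ∀ i j l, ModuleCat.{u} (A'' i j l)ᵐᵒᵖ}
    {m n : facObj f (fun i => facObj (g i) fun j => facObj (h i j) (Y i j)) ⟶ W}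
    (H : ∀ x : ∀ i j l, Y i j l,
      m.hom ((gen f).toFun fun i => (gen (g i)).toFun fun j => (gen (h i j)).toFun (x i j)) =
      n.hom ((gen f).toFun fun i => (gen (g i)).toFun fun j => (gen (h i j)).toFun (x i j))) :
    m = n := by
  rw [← cancel_epi (fcomp hcomm hfg).inv]
  refine fac_ext₂ (f := fg) (g := fun p => h p.1 p.2) (X := fun p => Y p.1 p.2) fun x => ?_
  rw [ModuleCat.comp_apply, ModuleCat.comp_apply, fcomp_inv_gen]
  exact H fun i j => x ⟨i, j⟩

lemma chase {R : Type u} [Ring R] {X Y Z : ModuleCat.{u} R} {m : X ⟶ Y} {n : Y ⟶ Z} {x : X} {y : Y}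
    {z : Z} (h : m.hom x = y) (h' : n.hom y = z) : (m ≫ n).hom x = z := by
  subst h h'; rfl

lemma chase_smul {R : Type u} [Ring R] {X Y : ModuleCat.{u} R} {m : X ⟶ Y} {x : X} {y : Y}
    (h : m.hom x = y) (r : R) : m.hom (r • x) = r • y := by
  subst h; exact _root_.map_smul _ _ _

lemma fmap_gen' {V V' : ∀ i, ModuleCat.{u} (A i)ᵐᵒᵖ} {h : ∀ i, V i ⟶ V' i} {v : ∀ i, V i}
    {v' : ∀ i, V' i} (H : ∀ i, (h i).hom (v i) = v' i) :
    (fmap f h).hom ((gen f).toFun v) = (gen f).toFun v' := by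
  obtain rfl := funext H
  exact fmap_gen h v

lemma fcomp_naturality [Finite I] (hcomm : ∀ i j, i ≠ j → ∀ a b, Commute (f i a) (f j b))
    (hfg : ∀ i j a, fg ⟨i, j⟩ a = f i (g i j a)) {Y : ∀ i j, ModuleCat.{u} (A' i j)ᵐᵒᵖ}
    (h : ∀ i j, X i j ⟶ Y i j) :
    fmap f (fun i => fmap (g i) (h i)) ≫ (fcomp hcomm hfg).hom =
      (fcomp hcomm hfg).hom ≫ fmap fg fun p => h p.1 p.2 := fac_ext₂ fun x =>
  Eq.trans (chase (fmap_gen' fun i => fmap_gen _ _)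
      (fcomp_gen hcomm hfg fun i j => (h i j).hom (x i j)))
    (Eq.symm (chase (fcomp_gen hcomm hfg x) (fmap_gen _ _)))

lemma fcomp_perm [Finite I] (hcomm : ∀ i j, i ≠ j → ∀ a b, Commute (f i a) (f j b))
    (hfg : ∀ i j a, fg ⟨i, j⟩ a = f i (g i j a)) {J' : I → Type} (τ : ∀ i, J' i ≃ J i)
    {g' : ∀ i j, A' i (τ i j) →ₐ[K] A i} (hg : ∀ i j a, g' i j a = g i (τ i j) a)
    {fg' : ∀ p : (Σ i, J' i), A' p.1 (τ p.1 p.2) →ₐ[K] B}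
    (hfg' : ∀ i j a, fg' ⟨i, j⟩ a = f i (g' i j a))
    (hp : ∀ p a, fg' p a = fg (Equiv.sigmaCongrRight τ p) a) :
    (fcomp hcomm hfg (X := X)).hom ≫
        (fperm (V := fun p => X p.1 p.2) (Equiv.sigmaCongrRight τ) hp).hom =
      fmap f (fun i => (fperm (τ i) (hg i) (V := X i)).hom) ≫
        (fcomp (X := fun i j => X i (τ i j)) hcomm hfg').hom :=
  fac_ext₂ fun x =>
    Eq.trans (chase (fcomp_gen hcomm hfg x) (fperm_gen (V := fun p => X p.1 p.2)
        (Equiv.sigmaCongrRight τ) hp fun p => x p.1 p.2))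
      (Eq.symm (chase (fmap_gen' fun i => fperm_gen (τ i) (hg i) (x i))
        (fcomp_gen (X := fun i j => X i (τ i j)) hcomm hfg' fun i j => x i (τ i j))))

lemma fcomp_assoc [Finite I] [∀ i, Finite (J i)]
    (hcomm : ∀ i j, i ≠ j → ∀ a b, Commute (f i a) (f j b))
    (hfg : ∀ i j a, fg ⟨i, j⟩ a = f i (g i j a)) {L : ∀ i, J i → Type}
    {A'' : ∀ i j, L i j → Type u} [∀ i j l, Ring (A'' i j l)] [∀ i j l, Algebra K (A'' i j l)]
    {h : ∀ i j l, A'' i j l →ₐ[K] A' i j} {Y : ∀ i j l, ModuleCat.{u} (A'' i j l)ᵐᵒᵖ}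
    (hcommfg : ∀ i j, i ≠ j → ∀ a b, Commute (fg i a) (fg j b))
    (hcommg : ∀ i, ∀ j k, j ≠ k → ∀ a b, Commute (g i j a) (g i k b))
    {gh : ∀ i, ∀ q : (Σ j, L i j), A'' i q.1 q.2 →ₐ[K] A i}
    (hgh : ∀ i j l a, gh i ⟨j, l⟩ a = g i j (h i j l a))
    {fgh : ∀ q : (Σ p : (Σ i, J i), L p.1 p.2), A'' q.1.1 q.1.2 q.2 →ₐ[K] B}
    (hfgh : ∀ p l a, fgh ⟨p, l⟩ a = fg p (h p.1 p.2 l a))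
    {fgh' : ∀ q : (Σ i, Σ j, L i j), A'' q.1 q.2.1 q.2.2 →ₐ[K] B}
    (hfgh' : ∀ i q a, fgh' ⟨i, q⟩ a = f i (gh i q a))
    (hp : ∀ q a, fgh q a = fgh' (Equiv.sigmaAssoc L q) a) :
    (fcomp hcomm hfg (X := fun i j => facObj (h i j) (Y i j))).hom ≫
        (fcomp hcommfg hfgh (X := fun p => Y p.1 p.2)).hom =
      fmap f (fun i => (fcomp (hcommg i) (hgh i) (X := Y i)).hom) ≫
        (fcomp hcomm hfgh' (X := fun i (q : Σ j, L i j) => Y i q.1 q.2)).hom ≫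
        (fperm (V := fun q : (Σ i, Σ j, L i j) => Y q.1 q.2.1 q.2.2) (Equiv.sigmaAssoc L) hp).hom :=
  fac_ext₃ hcomm hfg fun x =>
    Eq.trans (chase (fcomp_gen hcomm hfg fun i j => (gen (h i j)).toFun (x i j))
        (fcomp_gen hcommfg hfgh (X := fun p => Y p.1 p.2) fun p => x p.1 p.2))
      (Eq.symm (chase (fmap_gen' fun i => fcomp_gen (hcommg i) (hgh i) (X := Y i) (x i))
        (chase (fcomp_gen hcomm hfgh' (X := fun i (q : Σ j, L i j) => Y i q.1 q.2) fun i q => x i q.1 q.2)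
          (fperm_gen (V := fun q : (Σ i, Σ j, L i j) => Y q.1 q.2.1 q.2.2) (Equiv.sigmaAssoc L) hp
            fun q => x q.1 q.2.1 q.2.2))))

end Iterated

section Inclusion

lemma isLocallyPresentable_of {D : Type (u + 1)} [Category.{u} D] [HasColimitsOfSize.{u, u} D]
    (S : D) (U : D ⥤ Type u) [U.Faithful] [U.ReflectsIsomorphisms] [PreservesFilteredColimits U]
    (e : U ≅ coyoneda.obj (Opposite.op S)) : IsLocallyPresentable.{u} D where
  exists_cardinal := by
    have h0 := Cardinal.fact_isRegular_aleph0.{u}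
    have hF : (coyoneda.obj (Opposite.op S)).Faithful := Functor.Faithful.of_iso e
    have hR : (coyoneda.obj (Opposite.op S)).ReflectsIsomorphisms := reflectsIsomorphisms_of_iso e
    refine ⟨_, h0, ?_⟩
    rw [IsCardinalLocallyPresentable.iff_exists_isStrongGenerator]
    refine ⟨.singleton S, inferInstance, ?_, ?_⟩
    · rw [ObjectProperty.isStrongGenerator_iff]
      refine ⟨fun X Y f g h => hF.map_injective ?_, fun X Y i _ hi => ?_⟩
      · ext x
        exact h S (by simp) x
      · have : IsIso ((coyoneda.obj (Opposite.op S)).map i) := by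
          rw [isIso_iff_bijective]
          refine ⟨fun x y h => ?_, hi S (by simp)⟩
          exact (cancel_mono i).1 h
        exact isIso_of_reflects_iso i (coyoneda.obj (Opposite.op S))
    · simp only [ObjectProperty.singleton_le_iff, CategoryTheory.isCardinalPresentable_iff]
      refine ⟨fun J _ hJ => ?_⟩
      rw [isCardinalFiltered_aleph0_iff] at hJ
      exact preservesColimitsOfShape_of_natIso e

instance (R : Type u) [Ring R] : IsLocallyPresentable.{u} (ModuleCat.{u} R) :=
  isLocallyPresentable_of (ModuleCat.of R R) (forget (ModuleCat.{u} R))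
    (NatIso.ofComponents (fun M => Equiv.toIso
      ((LinearMap.ringLmapEquivSelf R ℕ M).symm.toEquiv.trans
        (ModuleCat.homEquiv (M := ModuleCat.of R R)).symm))
      (fun {M N} f => by
        ext x
        refine ModuleCat.hom_ext (LinearMap.ext fun (r : R) => ?_)
        exact (_root_.map_smul f.hom r x).symm))

variable {K : Type u} [Field K] {C : Type v} [Category.{w} C] {P : Orthogonality C}

/-- The algebra maps belonging to an operation. -/
abbrev alg (A : AQFT K P) {I : Type} {c : I → C} {t : C} (f : POp P c t) (i : I) :
    A.obj.obj (c i) →ₐ[K] A.obj.obj t := (A.obj.map (f.hom i)).hom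

lemma alg_commute (A : AQFT K P) {I : Type} {c : I → C} {t : C} (f : POp P c t) (i j : I)
    (h : i ≠ j) (a : A.obj.obj (c i)) (b : A.obj.obj (c j)) : Commute (alg A f i a) (alg A f j b) :=
  A.property _ _ (f.perp i j h) a b

lemma alg_comp (A : AQFT K P) {I : Type} {J : I → Type} {c : I → C} {d : ∀ i, J i → C} {t : C}
    (f : POp P c t) (g : ∀ i, POp P (d i) (c i)) (i : I) (j : J i) (a : A.obj.obj (d i j)) :
    alg A (f.comp g) ⟨i, j⟩ a = alg A f i (alg A (g i) j a) := by
  simp [alg, POp.comp]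

lemma alg_one (A : AQFT K P) {t : C} (x : Unit) (a : A.obj.obj t) :
    alg A (POp.one P t) x a = a := by
  simp [alg, POp.one]

lemma alg_perm (A : AQFT K P) {I J : Type} (σ : J ≃ I) {c : I → C} {t : C} (f : POp P c t)
    (f' : POp P (fun j => c (σ j)) t) (h : f' = f.perm σ) (j : J) (a : A.obj.obj (c (σ j))) :
    alg A f' j a = alg A f (σ j) a := by
  subst h; rfl

/-- The inclusion of algebraic quantum field theories into categorified ones, which assigns the
categories of right modules and the functors given by tensor products and induction. -/
noncomputable def incl (A : AQFT K P) : TwoAQFT K P where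
  cat c := { carrier := ModuleCat.{u} (A.obj.obj c)ᵐᵒᵖ }
  prod f := facFunctor (alg A f)
  isMulti f := facFunctor_isMulti (alg A f)
  comp f g X := fcomp (alg_commute A f) (alg_comp A f g)
  unit X := funit (alg_one A) X
  perm σ _ _ f f' h X := fperm σ (alg_perm A σ f f' h)
  comp_naturality f g X Y h := fcomp_naturality (alg_commute A f) (alg_comp A f g) h
  unit_naturality h := ModuleCat.hom_ext <| LinearMap.ext fun x =>
    Eq.trans (chase rfl (funit_hom _ _ _)) (Eq.symm (chase (funit_hom _ _ x) (fmap_gen _ _)))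
  perm_naturality σ _ _ f f' hf _ _ h := fac_ext fun x =>
    Eq.trans (chase (fmap_gen _ _) (fperm_gen _ _ _))
      (Eq.symm (chase (fperm_gen _ _ x) (fmap_gen _ _)))
  assoc f g h X := fcomp_assoc (alg_commute A f) (alg_comp A f g)
    (alg_commute A _) (fun i => alg_commute A (g i)) (fun i => alg_comp A (g i) (h i))
    (alg_comp A _ _) (alg_comp A f _) _
  unit_comp f X := fac_ext fun x =>
    Eq.trans (chase (funit_hom _ _ _) (fcomp_gen (X := fun _ => X) _ _ fun _ => x))
      (fperm_gen (V := X) (sigmaUnitLeft _) _ x).symm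
  comp_unit f X := fac_ext fun x =>
    Eq.trans (chase (fmap_gen' fun i => funit_hom _ _ _)
      (fcomp_gen (X := fun i _ => X i) _ _ fun i _ => x i))
      (fperm_gen (V := X) (sigmaUnitRight _) _ x).symm
  perm_refl f X := Iso.ext (fac_ext fun x => fperm_gen _ _ _)
  perm_trans σ τ _ _ f X := fac_ext fun x =>
    Eq.trans (chase (fperm_gen _ _ x) (fperm_gen _ _ _)) (fperm_gen (V := X) (τ.trans σ) _ x).symm
  perm_comp σ _ _ _ _ _ f g X := fac_ext₂ fun x =>
    Eq.trans (chase (fcomp_gen _ _ x) (fperm_gen _ _ _))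
      (Eq.symm (chase (fperm_gen _ _ _) (fcomp_gen (X := fun i => X (σ i)) _ _ fun i => x (σ i))))
  comp_perm τ _ _ _ f g X := fcomp_perm (alg_commute A f) (alg_comp A f g) τ (fun _ _ _ => rfl)
    (alg_comp A f _) _

end Inclusion

section Adjunction

section

variable {K : Type u} [Field K] {I : Type} [IsEmpty I] {A : I → Type u} [∀ i, Ring (A i)]
  [∀ i, Algebra K (A i)] {B : Type u} [Ring B] [Algebra K B] {f : ∀ i, A i →ₐ[K] B}
  {V : ∀ i, ModuleCat.{u} (A i)ᵐᵒᵖ}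

/-- Left multiplication on the free module `K ⊗ B ≅ B` of rank one. -/
noncomputable def lmul (a : B) : End (facObj f V) :=
  fdesc
    { toFun := fun v => op a • (gen f).toFun v
      map_add := fun _ i => isEmptyElim i
      map_act := fun _ i => isEmptyElim i }

@[simp]
lemma lmul_gen (a : B) (v : ∀ i, V i) :
    ModuleCat.Hom.hom (lmul a) ((gen f).toFun v) = op a • (gen f).toFun v :=
  fdesc_gen _ _

/-- Left multiplication as an algebra homomorphism. -/
noncomputable def lmulHom : B →ₐ[K] End (facObj f V) :=
  AlgHom.ofLinearMap
    { toFun := lmul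
      map_add' := fun a b => fac_ext fun v => by
        rw [lmul_gen, MulOpposite.op_add, add_smul, ModuleCat.hom_add, LinearMap.add_apply, lmul_gen,
          lmul_gen]
      map_smul' := fun k a => fac_ext fun v => by
        change _ = op (algebraMap K B k) • ModuleCat.Hom.hom (lmul a) _
        rw [lmul_gen, lmul_gen, ← mul_smul, ← op_mul, ← Algebra.commutes, Algebra.smul_def] }
    (fac_ext fun v => (lmul_gen 1 v).trans (one_smul _ _))
    (fun a b => fac_ext fun v => by
      change ModuleCat.Hom.hom (lmul (a * b)) _ =
        ModuleCat.Hom.hom (lmul a) (ModuleCat.Hom.hom (lmul b) _)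
      rw [lmul_gen, lmul_gen, _root_.map_smul, lmul_gen, op_mul, mul_smul])

end

open TwoAQFT

variable {K : Type u} [Field K] {C : Type v} [Category.{w} C] {P : Orthogonality C}
  (A : AQFT K P)

/-- The generator of the free module of rank one. -/
noncomputable def ptGen (t : C) : (facObj (alg A (POp.zero P t)) fun i => i.elim : ModuleCat _) :=
  (gen (alg A (POp.zero P t))).toFun fun i => i.elim

lemma emptyIso_gen {I : Type} [Finite I] [IsEmpty I] {c : I → C} {t : C} (f : POp P c t)
    (X : ∀ i, ModuleCat.{u} (A.obj.obj (c i))ᵐᵒᵖ) (x : ∀ i, X i) :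
    ModuleCat.Hom.hom ((incl A).emptyIso f X).hom ((gen (alg A f)).toFun x) = ptGen A t := by
  have key : ∀ {c : Empty → C} (f : POp P c t) (X : ∀ i, ModuleCat.{u} (A.obj.obj (c i))ᵐᵒᵖ)
      (x : ∀ i, X i), ModuleCat.Hom.hom (eqToIso ((incl A).obj_eq_pt f X)).hom
        ((gen (alg A f)).toFun x) = ptGen A t := by
    intro c f X x
    obtain rfl : c = fun i => i.elim := funext fun i => i.elim
    obtain rfl : f = POp.zero P t := POp.ext (funext fun i => i.elim)
    obtain rfl : X = fun i => i.elim := funext fun i => i.elim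
    obtain rfl : x = fun i => i.elim := funext fun i => i.elim
    rfl
  exact chase (fperm_gen (V := X) (Equiv.equivOfIsEmpty Empty I)
    (alg_perm A _ f _ rfl) x) (key _ _ _)

lemma ptIso_gen {I : Type} [Finite I] {c : I → C} {t : C} (f : POp P c t) :
    ModuleCat.Hom.hom ((incl A).ptIso f).hom ((gen (alg A f)).toFun fun i => ptGen A (c i)) =
      ptGen A t :=
  chase (fcomp_gen (X := fun _ (j : Empty) => j.elim) (alg_commute A f)
    (alg_comp A f fun i => POp.zero P (c i)) fun _ j => j.elim) (emptyIso_gen A _ _ _)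

/-- The action of an algebra on itself by left multiplications. -/
noncomputable def unitHom (t : C) : A.obj.obj t →ₐ[K] End ((incl A).pt t) :=
  lmulHom (f := alg A (POp.zero P t)) (V := fun i => i.elim)

lemma unitHom_gen {t : C} (a : A.obj.obj t) :
    ModuleCat.Hom.hom (unitHom A t a) (ptGen A t) = op a • ptGen A t := lmul_gen _ _

lemma unitHom_naturality {c d : C} (f : c ⟶ d) (a : A.obj.obj c) :
    (incl A).mulHom f (unitHom A c a) = unitHom A d ((A.obj.map f).hom a) := by
  rw [mulHom_apply, mul_iff]
  refine fac_ext₂ fun x => ?_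
  obtain rfl : x = fun _ i => i.elim := funext fun _ => funext fun i => i.elim
  have h1 : (gen (alg A (POp.unary (P := P) f))).toFun (fun _ => op a • ptGen A c) =
    op ((A.obj.map f).hom a) • (gen (alg A (POp.unary (P := P) f))).toFun (fun _ => ptGen A c) :=
    gen_eq_smul (f := alg A (POp.unary (P := P) f)) (x := fun _ => op a • ptGen A c)
      (y := fun _ => ptGen A c) () a (fun j hj => absurd rfl hj) rfl
  have h2 := ptIso_gen A (POp.unary (P := P) f)
  refine Eq.trans (chase ((fmap_gen' fun _ => unitHom_gen A a).trans h1) (chase_smul h2 _))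
    (Eq.symm (chase h2 (unitHom_gen A _)))

/-- The unit of the adjunction between inclusion and truncation. -/
noncomputable def inclUnit : A ⟶ trunc (incl A) :=
  ObjectProperty.homMk
    { app := fun c => AlgCat.ofHom (unitHom A c)
      naturality := fun c d f => AlgCat.hom_ext _ (AlgHom.ext fun a =>
        (unitHom_naturality A f a).symm) }

variable {A}

/-- The morphism `A ⟶ trunc B` which corresponds to a `1`-morphism `incl A ⟶ B` under the
adjunction between inclusion and truncation. -/
noncomputable def adjunct {B : TwoAQFT K P} (ζ : Hom (incl A) B) : A ⟶ trunc B :=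
  inclUnit A ≫ truncHom ζ

/-- A categorified algebraic quantum field theory `B` is truncated if the counit
`ε : incl (trunc B) ⟶ B`, i.e. the `1`-morphism corresponding to the identity of `trunc B` under the
adjunction between inclusion and truncation, is an equivalence. -/
def IsTruncated (B : TwoAQFT K P) : Prop :=
  ∃ ε : Hom (incl (trunc B)) B, adjunct ε = 𝟙 (trunc B) ∧ IsEquivalence ε

end Adjunction

section EquivariantModules

variable {K : Type u} [Field K] {G : Type u} [Group G] {A : Type u} [Ring A] [Algebra K A]

/-- `G`-equivariant right modules over an algebra with an action of `G` by automorphisms. -/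
structure GMod (α : G →* (A →ₐ[K] A)) where
  mod : ModuleCat.{u} Aᵐᵒᵖ
  rep : Representation K G mod
  rep_smul : ∀ (g : G) (a : A) (v : mod), rep g (op a • v) = op (α g a) • rep g v

variable {α : G →* (A →ₐ[K] A)}

namespace GMod

/-- The `G`-equivariant module homomorphisms. -/
def homs (V W : GMod α) : Submodule K (V.mod ⟶ W.mod) where
  carrier := {h | ∀ g v, h.hom (V.rep g v) = W.rep g (h.hom v)}
  add_mem' {h h'} H H' g v := by
    rw [ModuleCat.hom_add, LinearMap.add_apply, LinearMap.add_apply, H, H', _root_.map_add]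
  zero_mem' g v := by
    rw [ModuleCat.hom_zero, LinearMap.zero_apply, LinearMap.zero_apply, _root_.map_zero]
  smul_mem' k h H g v := by
    change k • h.hom _ = W.rep g (k • h.hom _)
    rw [H, _root_.map_smul]

instance : Category (GMod α) where
  Hom V W := homs V W
  id V := ⟨𝟙 V.mod, fun _ _ => rfl⟩
  comp h h' := ⟨h.1 ≫ h'.1, fun g v => by
    rw [ModuleCat.hom_comp, LinearMap.comp_apply, LinearMap.comp_apply, h.2, h'.2]⟩
  id_comp h := Subtype.ext (Category.id_comp h.1)
  comp_id h := Subtype.ext (Category.comp_id h.1)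
  assoc h h' h'' := Subtype.ext (Category.assoc h.1 h'.1 h''.1)

instance : Preadditive (GMod α) where
  homGroup V W := inferInstanceAs (AddCommGroup (homs V W))
  add_comp _ _ _ f f' g := Subtype.ext (Preadditive.add_comp _ _ _ f.1 f'.1 g.1)
  comp_add _ _ _ f g g' := Subtype.ext (Preadditive.comp_add _ _ _ f.1 g.1 g'.1)

instance : Linear K (GMod α) where
  homModule V W := inferInstanceAs (Module K (homs V W))
  smul_comp _ _ _ r f g := Subtype.ext (Linear.smul_comp _ _ _ r f.1 g.1)
  comp_smul _ _ _ f r g := Subtype.ext (Linear.comp_smul _ _ _ f.1 r g.1)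

/-- The functor which forgets the action of `G`. -/
def forget (α : G →* (A →ₐ[K] A)) : GMod α ⥤ ModuleCat.{u} Aᵐᵒᵖ where
  obj V := V.mod
  map h := h.1

instance : (forget α).Faithful where
  map_injective h := Subtype.ext h

/-- Isomorphisms of equivariant modules. -/
def isoMk {V W : GMod α} (e : V.mod ≅ W.mod)
    (h : ∀ g v, e.hom.hom (V.rep g v) = W.rep g (e.hom.hom v)) : V ≅ W where
  hom := ⟨e.hom, h⟩
  inv := ⟨e.inv, fun g v => by
    have h1 : e.hom.hom (e.inv.hom v) = v := by rw [← ModuleCat.comp_apply, e.inv_hom_id]; rfl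
    have h2 : ∀ x, e.inv.hom (e.hom.hom x) = x := fun x => by
      rw [← ModuleCat.comp_apply, e.hom_inv_id]; rfl
    rw [← h2 (V.rep g (e.inv.hom v)), h, h1]⟩
  hom_inv_id := Subtype.ext e.hom_inv_id
  inv_hom_id := Subtype.ext e.inv_hom_id

instance : (forget α).ReflectsIsomorphisms where
  reflects {V W} f hf :=
    inferInstanceAs (IsIso (isoMk (@asIso _ _ V.mod W.mod f.1 hf) f.2).hom)

section Colimits

variable {J : Type u} [Category.{u} J] (F : J ⥤ GMod α)

/-- The components of a cocone. -/
def leg (c : Cocone (F ⋙ forget α)) (j : J) : (F.obj j).mod →ₗ[Aᵐᵒᵖ] c.pt := (c.ι.app j).hom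

variable {F} in
lemma leg_induction {c : Cocone (F ⋙ forget α)} (hc : IsColimit c) {p : c.pt → Prop} (h0 : p 0)
    (ha : ∀ x y, p x → p y → p (x + y)) (hι : ∀ j x, p (leg F c j x)) (x : c.pt) : p x :=
  colimit_induction hc h0 ha hι x

/-- The action of `G` on a colimit. -/
noncomputable def colimitRep {c : Cocone (F ⋙ forget α)} (hc : IsColimit c) :
    { ρ : Representation K G c.pt // (∀ (g : G) (a : A) (v : c.pt), ρ g (op a • v) = op (α g a) • ρ g v) ∧
      ∀ (g : G) (j : J) (x : (F.obj j).mod),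
        ρ g (leg F c j x) = leg F c j ((F.obj j).rep g x) } := by
  let t : G → Cocone (F ⋙ forget α) := fun g =>
    { pt := balTwist c.pt (α g)
      ι :=
        { app := fun j => ModuleCat.ofHom (X := (F.obj j).mod) (Y := balTwist c.pt (α g))
            { toFun := fun x => leg F c j ((F.obj j).rep g x)
              map_add' := fun x y => by rw [_root_.map_add, _root_.map_add]; rfl
              map_smul' := fun a x => by
                have := (F.obj j).rep_smul g a.unop x
                rw [op_unop] at this
                rw [this]
                exact _root_.map_smul (leg F c j) _ _ }
          naturality := fun j k φ => ModuleCat.hom_ext (LinearMap.ext fun (x : (F.obj j).mod) => by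
            change leg F c k ((F.obj k).rep g ((F.map φ).1.hom x)) =
              leg F c j ((F.obj j).rep g x)
            rw [← (F.map φ).2]
            exact LinearMap.congr_fun (congrArg ModuleCat.Hom.hom (c.w φ)) _) } }
  let D : G → c.pt →+ c.pt := fun g =>
    { toFun := (hc.desc (t g)).hom
      map_zero' := _root_.map_zero _
      map_add' := _root_.map_add _ }
  have hDs : ∀ g a v, D g (op a • v) = op (α g a) • D g v := fun g a v =>
    _root_.map_smul (hc.desc (t g)).hom (op a) v
  have hD : ∀ g j (x : (F.obj j).mod), D g (leg F c j x) =
      leg F c j ((F.obj j).rep g x) := fun g j x =>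
    LinearMap.congr_fun (congrArg ModuleCat.Hom.hom (hc.fac (t g) j)) x
  exact ⟨
    { toFun := fun g =>
        { toFun := D g
          map_add' := (D g).map_add
          map_smul' := fun k v => by
            rw [RingHom.id_apply, smul_eq, smul_eq, hDs, AlgHom.commutes] }
      map_one' := LinearMap.ext fun v => by
        change D 1 v = v
        induction v using leg_induction hc with
        | h0 => exact _root_.map_zero _
        | ha x y hx hy => rw [_root_.map_add, hx, hy]
        | hι j x => rw [hD, _root_.map_one]; rfl
      map_mul' := fun g h => LinearMap.ext fun v => by
        change D (g * h) v = D g (D h v)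
        induction v using leg_induction hc with
        | h0 => simp only [_root_.map_zero]
        | ha x y hx hy => simp only [_root_.map_add, hx, hy]
        | hι j x =>
          rw [hD, hD, hD, _root_.map_mul]; rfl }, hDs, hD⟩

/-- The colimit of equivariant modules. -/
noncomputable def colimitCocone {c : Cocone (F ⋙ forget α)} (hc : IsColimit c) : Cocone F where
  pt := ⟨c.pt, (colimitRep F hc).1, (colimitRep F hc).2.1⟩
  ι :=
    { app := fun j => ⟨c.ι.app j, fun g x => ((colimitRep F hc).2.2 g j x).symm⟩
      naturality := fun j k φ => Subtype.ext (c.ι.naturality φ) }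

/-- It is indeed a colimit. -/
noncomputable def isColimit {c : Cocone (F ⋙ forget α)} (hc : IsColimit c) :
    IsColimit (colimitCocone F hc) where
  desc s := ⟨hc.desc ((forget α).mapCocone s), fun g v => by
    let d : c.pt →ₗ[Aᵐᵒᵖ] s.pt.mod := (hc.desc ((forget α).mapCocone s)).hom
    have h1 : ∀ j (x : (F.obj j).mod), d (leg F c j x) = (s.ι.app j).1.hom x := fun j x =>
        LinearMap.congr_fun (congrArg ModuleCat.Hom.hom (hc.fac ((forget α).mapCocone s) j)) x
    change d ((colimitRep F hc).1 g v) = s.pt.rep g (d v)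
    induction v using leg_induction hc with
    | h0 => simp only [_root_.map_zero]
    | ha x y hx hy => simp only [_root_.map_add, hx, hy]
    | hι j x =>
      rw [(colimitRep F hc).2.2, h1, h1, (s.ι.app j).2]
      rfl⟩
  fac s j := Subtype.ext (hc.fac ((forget α).mapCocone s) j)
  uniq s m hm := Subtype.ext (hc.uniq ((forget α).mapCocone s) m.1 fun j => congrArg Subtype.val (hm j))

instance : HasColimitsOfSize.{u, u} (GMod α) where
  has_colimits_of_shape _ _ := ⟨fun F => ⟨⟨_, isColimit F (colimit.isColimit (F ⋙ forget α))⟩⟩⟩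

instance : PreservesColimitsOfSize.{u, u} (forget α) where
  preservesColimitsOfShape := ⟨fun {F} =>
    preservesColimit_of_preserves_colimit_cocone (isColimit F (colimit.isColimit (F ⋙ forget α)))
      (colimit.isColimit (F ⋙ forget α))⟩

end Colimits

end GMod

end EquivariantModules

section EquivariantModules

variable {K : Type u} [Field K] {G : Type u} [Group G]

namespace GMod

section Generator

variable {A : Type u} [Ring A] [Algebra K A] (α : G →* (A →ₐ[K] A))

/-- The right module of functions on `G` with values in `A`. -/
def generatorMod (G A : Type u) [Ring A] : ModuleCat.{u} Aᵐᵒᵖ := ModuleCat.of Aᵐᵒᵖ (G → A)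

/-- The equivariant module of functions on `G`. -/
def generator : GMod α where
  mod := generatorMod G A
  rep :=
    { toFun := fun g =>
        { toFun := fun (φ : G → A) => (fun k => α g (φ (g⁻¹ * k)) : G → A)
          map_add' := fun (φ ψ : G → A) => funext fun k => _root_.map_add (α g) (φ _) (ψ _)
          map_smul' := fun r (φ : G → A) => funext fun k => by
            change α g (φ (g⁻¹ * k) * algebraMap K A r) = α g (φ (g⁻¹ * k)) * algebraMap K A r
            rw [_root_.map_mul, AlgHom.commutes] }
      map_one' := LinearMap.ext fun (φ : G → A) => funext fun k => by
        change α 1 (φ (1⁻¹ * k)) = φ k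
        rw [_root_.map_one, inv_one, one_mul]; rfl
      map_mul' := fun g h => LinearMap.ext fun (φ : G → A) => funext fun k => by
        change α (g * h) (φ ((g * h)⁻¹ * k)) = α g (α h (φ (h⁻¹ * (g⁻¹ * k))))
        rw [_root_.map_mul, mul_inv_rev, mul_assoc]; rfl }
  rep_smul g a φ := funext fun k => _root_.map_mul (α g) ((φ : G → A) (g⁻¹ * k)) a

variable {α}

/-- The homomorphism out of the generator determined by an element. -/
noncomputable def generatorHom [Fintype G] (V : GMod α) (v : V.mod) : generator α ⟶ V :=
  ⟨ModuleCat.ofHom (X := generatorMod G A)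
    { toFun := fun (φ : G → A) => ∑ h : G, op (φ h) • V.rep h v
      map_add' := fun (φ ψ : G → A) => by
        rw [← Finset.sum_add_distrib]
        exact Finset.sum_congr rfl fun h _ => add_smul (op (φ h)) (op (ψ h)) _
      map_smul' := fun a (φ : G → A) => by
        rw [RingHom.id_apply, Finset.smul_sum]
        exact Finset.sum_congr rfl fun h _ => mul_smul a (op (φ h)) _ },
    fun g (φ : G → A) => by
      change ∑ k : G, op (α g (φ (g⁻¹ * k))) • V.rep k v =
        V.rep g (∑ h : G, op (φ h) • V.rep h v)
      rw [_root_.map_sum]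
      refine (Fintype.sum_equiv (Equiv.mulLeft g) _ _ fun h => ?_).symm
      rw [V.rep_smul, Equiv.coe_mulLeft, inv_mul_cancel_left, _root_.map_mul]
      rfl⟩

open Classical in
/-- The generating element. -/
noncomputable def generatorElt (α : G →* (A →ₐ[K] A)) : (generator α).mod :=
  (Pi.single 1 1 : G → A)

lemma generatorHom_elt [Fintype G] (V : GMod α) (v : V.mod) :
    (generatorHom V v).1.hom (generatorElt α) = v := by
  classical
  change ∑ h : G, op ((Pi.single 1 1 : G → A) h) • V.rep h v = v
  rw [Finset.sum_eq_single 1]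
  · rw [Pi.single_eq_same, op_one, one_smul, _root_.map_one]; rfl
  · intro h _ hh
    rw [Pi.single_eq_of_ne hh, MulOpposite.op_zero, zero_smul]
  · simp

lemma eq_generatorHom [Fintype G] (V : GMod α) (m : generator α ⟶ V) :
    m = generatorHom V (m.1.hom (generatorElt α)) := by
  classical
  refine Subtype.ext (ModuleCat.hom_ext (LinearMap.ext fun (φ : G → A) => ?_))
  let M : (generatorMod G A) →ₗ[Aᵐᵒᵖ] V.mod := m.1.hom
  change M φ = ∑ h : G, op (φ h) • V.rep h (M (generatorElt α))
  have h1 : ∀ h, op (φ h) • V.rep h (M (generatorElt α)) = M (Pi.single h (φ h) : G → A) := by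
    intro h
    have h2 : M ((generator α).rep h (generatorElt α)) = V.rep h (M (generatorElt α)) := m.2 h _
    rw [← h2]
    refine (_root_.map_smul M (op (φ h)) _).symm.trans (congrArg M (funext fun k => ?_))
    change α h ((Pi.single 1 1 : G → A) (h⁻¹ * k)) * φ h = (Pi.single h (φ h) : G → A) k
    by_cases hk : k = h
    · subst hk
      rw [inv_mul_cancel, Pi.single_eq_same, Pi.single_eq_same, _root_.map_one, one_mul]
    · rw [Pi.single_eq_of_ne hk, Pi.single_eq_of_ne (by rwa [ne_eq, inv_mul_eq_one, eq_comm]),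
        _root_.map_zero, zero_mul]
  rw [Finset.sum_congr rfl fun h _ => h1 h]
  refine Eq.trans ?_ (_root_.map_sum M (fun h => (Pi.single h (φ h) : G → A)) _)
  exact congrArg M (Finset.univ_sum_single φ).symm

lemma generatorHom_naturality [Fintype G] {V W : GMod α} (f : V ⟶ W) (v : V.mod) :
    generatorHom W (f.1.hom v) = generatorHom V v ≫ f := by
  refine ((eq_generatorHom W (generatorHom V v ≫ f)).trans ?_).symm
  congr 1
  exact congrArg f.1.hom (generatorHom_elt V v)

instance [Finite G] : IsLocallyPresentable.{u} (GMod α) := by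
  have := Fintype.ofFinite G
  have : PreservesFilteredColimits (forget α ⋙ CategoryTheory.forget (ModuleCat.{u} Aᵐᵒᵖ)) :=
    inferInstance
  exact isLocallyPresentable_of (generator α) (forget α ⋙ CategoryTheory.forget (ModuleCat.{u} Aᵐᵒᵖ))
    (NatIso.ofComponents (fun V => Equiv.toIso
      { toFun := fun v : V.mod => generatorHom V v
        invFun := fun m => m.1.hom (generatorElt α)
        left_inv := generatorHom_elt V
        right_inv := fun m => (eq_generatorHom V m).symm })
      (fun {V W} f => by
        ext v
        exact generatorHom_naturality f v))

end Generator

end GMod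

section EquivariantFactorization

variable {I : Type} {A : I → Type u} [∀ i, Ring (A i)] [∀ i, Algebra K (A i)] {B : Type u}
  [Ring B] [Algebra K B] {α : ∀ i, G →* (A i →ₐ[K] A i)} {β : G →* (B →ₐ[K] B)}
  (f : ∀ i, A i →ₐ[K] B) (hf : ∀ i g a, f i (α i g a) = β g (f i a))

/-- The identity map to a twisted module. -/
noncomputable def twistEquiv (M : ModuleCat.{u} Bᵐᵒᵖ) (φ : B →ₐ[K] B) : M ≃+ balTwist M φ :=
  AddEquiv.refl M

lemma twistEquiv_smul (M : ModuleCat.{u} Bᵐᵒᵖ) (φ : B →ₐ[K] B) (b : B) (x : M) :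
    twistEquiv M φ (op (φ b) • x) = op b • twistEquiv M φ x := rfl

lemma twistEquiv_symm_smul (M : ModuleCat.{u} Bᵐᵒᵖ) (φ : B →ₐ[K] B) (b : B) (x : balTwist M φ) :
    (twistEquiv M φ).symm (op b • x) = op (φ b) • (twistEquiv M φ).symm x := rfl

/-- The action of a group element on `facObj f V`, as a homomorphism to a twisted module. -/
noncomputable def gactHom (V : ∀ i, GMod (α i)) (g : G) :
    facObj f (fun i => (V i).mod) ⟶ balTwist (facObj f fun i => (V i).mod) (β g) :=
  fdesc
    { toFun := fun v => twistEquiv _ _ ((gen f).toFun fun i => (V i).rep g (v i))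
      map_add := fun v i x y => by
        simp only [Function.apply_update (fun i => (V i).rep g), _root_.map_add]
        exact (congrArg _ ((gen f).map_add ..)).trans (_root_.map_add _ _ _)
      map_act := fun v i a x => by
        simp only [Function.apply_update (fun i => (V i).rep g), (V i).rep_smul]
        rw [← twistEquiv_smul, ← hf]
        exact congrArg _ ((gen f).map_act ..) }

/-- The action of a group element on `facObj f V`. -/
noncomputable def gact (V : ∀ i, GMod (α i)) (g : G) :
    facObj f (fun i => (V i).mod) →+ facObj f (fun i => (V i).mod) :=
  (twistEquiv _ (β g)).symm.toAddMonoidHom.comp (gactHom f hf V g).hom.toAddMonoidHom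

lemma gact_gen (V : ∀ i, GMod (α i)) (g : G) (v : ∀ i, (V i).mod) :
    gact f hf V g ((gen f).toFun v) = (gen f).toFun fun i => (V i).rep g (v i) :=
  ((twistEquiv _ (β g)).symm_apply_eq).2 (fdesc_gen _ _)

lemma gact_smul (V : ∀ i, GMod (α i)) (g : G) (b : B) (x : facObj f (fun i => (V i).mod)) :
    gact f hf V g (op b • x) = op (β g b) • gact f hf V g x :=
  (congrArg _ (_root_.map_smul (gactHom f hf V g).hom (op b) x)).trans
    (twistEquiv_symm_smul _ _ _ _)

/-- The diagonal representation. -/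
noncomputable def gfacRep (V : ∀ i, GMod (α i)) :
    Representation K G (facObj f fun i => (V i).mod) where
  toFun g :=
    { toFun := gact f hf V g
      map_add' := (gact f hf V g).map_add
      map_smul' := fun k x => by
        rw [RingHom.id_apply, smul_eq, smul_eq, gact_smul, AlgHom.commutes] }
  map_one' := LinearMap.ext fun x => by
    change gact f hf V 1 x = x
    induction x using fac_induction with
    | h0 => exact _root_.map_zero _
    | ha x y hx hy => rw [_root_.map_add, hx, hy]
    | hs b x hx => rw [gact_smul, hx, _root_.map_one]; rfl
    | hg v => simp only [gact_gen, _root_.map_one, Module.End.one_apply]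
  map_mul' g h := LinearMap.ext fun x => by
    change gact f hf V (g * h) x = gact f hf V g (gact f hf V h x)
    induction x using fac_induction with
    | h0 => simp only [_root_.map_zero]
    | ha x y hx hy => simp only [_root_.map_add, hx, hy]
    | hs b x hx => rw [gact_smul, gact_smul, gact_smul, hx, _root_.map_mul]; rfl
    | hg v => simp only [gact_gen, _root_.map_mul, Module.End.mul_apply]

/-- The factorization product of equivariant modules, with the diagonal action. -/
noncomputable def gfac (V : ∀ i, GMod (α i)) : GMod β where
  mod := facObj f fun i => (V i).mod
  rep := gfacRep f hf V
  rep_smul := gact_smul f hf V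

lemma gfac_gen (V : ∀ i, GMod (α i)) (g : G) (v : ∀ i, (V i).mod) :
    (gfac f hf V).rep g ((gen f).toFun v) = (gen f).toFun fun i => (V i).rep g (v i) :=
  gact_gen f hf V g v

/-- Equivariance can be tested on the generators. -/
lemma equivariant_of_gen {V : ∀ i, GMod (α i)} {W : GMod β}
    (m : facObj f (fun i => (V i).mod) ⟶ W.mod)
    (h : ∀ g v, m.hom ((gen f).toFun fun i => (V i).rep g (v i)) =
      W.rep g (m.hom ((gen f).toFun v))) (g : G) (x : facObj f fun i => (V i).mod) :
    m.hom (gact f hf V g x) = W.rep g (m.hom x) := by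
  induction x using fac_induction with
  | h0 => simp only [_root_.map_zero]
  | ha x y hx hy => simp only [_root_.map_add, hx, hy]
  | hs b x hx => rw [gact_smul, _root_.map_smul, _root_.map_smul, W.rep_smul, hx]
  | hg v => rw [gact_gen, h]

/-- A homomorphism out of `gfac` from one which is equivariant on generators. -/
noncomputable def gfacHom {V : ∀ i, GMod (α i)} {W : GMod β}
    (m : facObj f (fun i => (V i).mod) ⟶ W.mod)
    (h : ∀ g v, m.hom ((gen f).toFun fun i => (V i).rep g (v i)) =
      W.rep g (m.hom ((gen f).toFun v))) : gfac f hf V ⟶ W :=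
  ⟨m, equivariant_of_gen f hf m h⟩

/-- The factorization product functor of equivariant modules. -/
noncomputable def gfacFunctor : (∀ i, GMod (α i)) ⥤ GMod β where
  obj := gfac f hf
  map {V W} h := gfacHom f hf (W := gfac f hf W) (fmap f fun i => (h i).1) fun g v =>
    (fmap_gen' fun i => (h i).2 g (v i)).trans
      ((gfac_gen f hf W g _).symm.trans (congrArg _ (fmap_gen _ v).symm))
  map_id V := Subtype.ext fmap_id
  map_comp h h' := Subtype.ext (fmap_comp _ _)

lemma gfacFunctor_isMulti [Finite I] : IsMulti K (gfacFunctor f hf) :=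
  isMulti_of
    (fun _ _ i p q r h hi => Subtype.ext (fmap_add f i _ _ _
      (fun j hj => ⟨congrArg Subtype.val (h j hj).1, congrArg Subtype.val (h j hj).2⟩)
      (congrArg Subtype.val hi)))
    (fun _ _ i p q k h hi => Subtype.ext (fmap_smul f i _ _ k
      (fun j hj => congrArg Subtype.val (h j hj)) (congrArg Subtype.val hi)))
    (fun i J _ F c h hc => by
      let U : (∀ j, GMod (α j)) ⥤ ∀ j, ModuleCat.{u} (A j)ᵐᵒᵖ := Functor.pi fun j => GMod.forget (α j)
      have h1 := facFunctor_isColimit f i (F ⋙ U) (U.mapCocone c)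
        (fun j hj x => have := h j hj x; (GMod.forget (α j)).map_isIso (c.ι.app x j))
        (isColimitOfPreserves (GMod.forget (α i)) hc.some)
      have : ReflectsColimitsOfShape J (GMod.forget β) :=
        reflectsColimitsOfShape_of_reflectsIsomorphisms
      exact ⟨isColimitOfReflects (GMod.forget β) h1.some⟩)

end EquivariantFactorization

end EquivariantModules

section EquivariantCoherences

variable {K : Type u} [Field K] {G : Type u} [Group G] {I : Type} {A : I → Type u}
  [∀ i, Ring (A i)] [∀ i, Algebra K (A i)] {B : Type u} [Ring B] [Algebra K B]
  {α : ∀ i, G →* (A i →ₐ[K] A i)} {β : G →* (B →ₐ[K] B)} {f : ∀ i, A i →ₐ[K] B}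

/-- The coherence for composition of operations. -/
noncomputable def gfcomp [Finite I] {J : I → Type} {A' : ∀ i, J i → Type u}
    [∀ i j, Ring (A' i j)] [∀ i j, Algebra K (A' i j)] {g : ∀ i j, A' i j →ₐ[K] A i}
    {γ : ∀ i j, G →* (A' i j →ₐ[K] A' i j)} {fg : ∀ p : (Σ i, J i), A' p.1 p.2 →ₐ[K] B}
    (hf : ∀ i s a, f i (α i s a) = β s (f i a))
    (hg : ∀ i j s a, g i j (γ i j s a) = α i s (g i j a))
    (hfg' : ∀ p s a, fg p (γ p.1 p.2 s a) = β s (fg p a))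
    (hcomm : ∀ i j, i ≠ j → ∀ a b, Commute (f i a) (f j b))
    (hfg : ∀ i j a, fg ⟨i, j⟩ a = f i (g i j a)) (X : ∀ i j, GMod (γ i j)) :
    gfac f hf (fun i => gfac (g i) (hg i) (X i)) ≅ gfac fg hfg' (fun p => X p.1 p.2) :=
  (GMod.isoMk (V := gfac fg hfg' (fun p => X p.1 p.2))
    (W := gfac f hf (fun i => gfac (g i) (hg i) (X i)))
    (fcomp (X := fun i j => (X i j).mod) hcomm hfg).symm
    (equivariant_of_gen fg hfg' (W := gfac f hf (fun i => gfac (g i) (hg i) (X i))) _ fun s x =>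
      (fcomp_inv_gen (X := fun i j => (X i j).mod) hcomm hfg _).trans
        (((congrArg (gen f).toFun (funext fun i => (gfac_gen (g i) (hg i) (X i) s _).symm)).trans
          (gfac_gen f hf (fun i => gfac (g i) (hg i) (X i)) s _).symm).trans
            (congrArg _ (fcomp_inv_gen (X := fun i j => (X i j).mod) hcomm hfg x).symm)))).symm

/-- The coherence for operadic units. -/
noncomputable def gfunit {e : ∀ _ : Unit, B →ₐ[K] B} (he : ∀ x b, e x b = b)
    (hf : ∀ i s a, e i (β s a) = β s (e i a)) (M : GMod β) :
    M ≅ gfac (α := fun _ => β) e hf (fun _ => M) :=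
  GMod.isoMk (W := gfac (α := fun _ => β) e hf (fun _ => M)) (funit he M.mod) fun s x =>
    (gfac_gen (α := fun _ => β) e hf (fun _ => M) s fun _ => x).symm

/-- The coherence for permutations. -/
noncomputable def gfperm {J : Type} (σ : J ≃ I) {f' : ∀ j, A (σ j) →ₐ[K] B}
    (hf : ∀ i s a, f i (α i s a) = β s (f i a))
    (hf' : ∀ j s a, f' j (α (σ j) s a) = β s (f' j a))
    (h : ∀ j a, f' j a = f (σ j) a) (V : ∀ i, GMod (α i)) :
    gfac f hf V ≅ gfac f' hf' (fun j => V (σ j)) :=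
  GMod.isoMk (V := gfac f hf V) (W := gfac f' hf' (fun j => V (σ j)))
    (fperm (V := fun i => (V i).mod) σ h)
    (equivariant_of_gen f hf (W := gfac f' hf' (fun j => V (σ j))) _ fun s x =>
      (fperm_gen (V := fun i => (V i).mod) σ h _).trans
        ((gfac_gen f' hf' (fun j => V (σ j)) s _).symm.trans
          (congrArg _ (fperm_gen (V := fun i => (V i).mod) σ h x).symm)))

end EquivariantCoherences

section Gauging

variable {K : Type u} [Field K] {C : Type v} [Category.{w} C] {P : Orthogonality C}
  {G : Type u} [Group G] (A : AQFT K P) (ρ : G →* Aut A)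

/-- The action of the group on the algebra assigned to an object. -/
def act (c : C) : G →* (A.obj.obj c →ₐ[K] A.obj.obj c) where
  toFun g := ((ρ g).hom.hom.app c).hom
  map_one' := by rw [_root_.map_one]; rfl
  map_mul' g h := by rw [_root_.map_mul]; rfl

lemma alg_act {I : Type} {c : I → C} {t : C} (f : POp P c t) (i : I) (g : G)
    (a : A.obj.obj (c i)) : alg A f i (act A ρ (c i) g a) = act A ρ t g (alg A f i a) :=
  AlgHom.congr_fun (congrArg AlgCat.Hom.hom ((ρ g).hom.hom.naturality (f.hom i)).symm) a

/-- The categorified orbifold theory, which assigns the categories of equivariant modules. -/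
noncomputable def gauge [Finite G] : TwoAQFT K P where
  cat c := { carrier := GMod (act A ρ c) }
  prod f := gfacFunctor (alg A f) (alg_act A ρ f)
  isMulti f := gfacFunctor_isMulti (alg A f) (alg_act A ρ f)
  comp f g X := gfcomp (alg_act A ρ f) (fun i => alg_act A ρ (g i)) (alg_act A ρ _)
    (alg_commute A f) (alg_comp A f g) X
  unit X := gfunit (alg_one A) (alg_act A ρ _) X
  perm σ _ _ f f' h X :=
    gfperm σ (alg_act A ρ f) (alg_act A ρ f') (alg_perm A σ f f' h) X
  comp_naturality f g X Y h := Subtype.ext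
    (fcomp_naturality (alg_commute A f) (alg_comp A f g) fun i j => (h i j).1)
  unit_naturality {_ X Y} h := Subtype.ext ((incl A).unit_naturality (X := X.mod) (Y := Y.mod) h.1)
  perm_naturality σ _ _ f f' hf _ _ h := Subtype.ext
    ((incl A).perm_naturality σ f f' hf fun i => (h i).1)
  assoc f g h X := Subtype.ext ((incl A).assoc f g h fun i j l => (X i j l).mod)
  unit_comp f X := Subtype.ext ((incl A).unit_comp f fun i => (X i).mod)
  comp_unit f X := Subtype.ext ((incl A).comp_unit f fun i => (X i).mod)
  perm_refl f X := Iso.ext (Subtype.ext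
    (congrArg Iso.hom ((incl A).perm_refl f fun i => (X i).mod)))
  perm_trans σ τ _ _ f X := Subtype.ext ((incl A).perm_trans σ τ f fun i => (X i).mod)
  perm_comp σ _ _ _ _ _ f g X := Subtype.ext ((incl A).perm_comp σ f g fun i j => (X i j).mod)
  comp_perm τ _ _ _ f g X := Subtype.ext ((incl A).comp_perm τ f g fun i j => (X i j).mod)

end Gauging

section HopfGalois

variable {K : Type u} [Field K] {A : Type u} [Ring A] [Algebra K A]

section Comodule

variable {H : Type u} [Ring H] [Algebra K H] (δ : A →ₐ[K] A ⊗[K] H)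

/-- The subalgebra of coaction invariants, i.e. `δ a = a ⊗ 1`. -/
def coinvariants : Subalgebra K A := AlgHom.equalizer δ Algebra.TensorProduct.includeLeft

/-- The relations `a b ⊗ a' = a ⊗ b a'` which define the tensor product over a subalgebra. -/
def tensorRel (B : Subalgebra K A) : Submodule K (A ⊗[K] A) :=
  Submodule.span K {z | ∃ (a a' : A) (b : B), z = (a * b) ⊗ₜ[K] a' - a ⊗ₜ[K] (b * a')}

/-- The map `a ⊗ a' ↦ (a ⊗ 1) δ(a')`. -/
noncomputable def preCanonical : A ⊗[K] A →ₗ[K] A ⊗[K] H :=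
  TensorProduct.lift ((LinearMap.mul K (A ⊗[K] H)).compl₁₂
    (Algebra.TensorProduct.includeLeft : A →ₐ[K] A ⊗[K] H).toLinearMap δ.toLinearMap)

/-- The canonical map `A ⊗_B A → A ⊗ H` where `B` is the subalgebra of coaction invariants. -/
noncomputable def canonicalMap :
    ((A ⊗[K] A) ⧸ tensorRel (coinvariants δ)) →ₗ[K] A ⊗[K] H :=
  (tensorRel (coinvariants δ)).liftQ (preCanonical δ) (by
    rw [tensorRel, Submodule.span_le]
    rintro z ⟨a, a', ⟨b, hb⟩, rfl⟩
    rw [SetLike.mem_coe, LinearMap.mem_ker, map_sub, sub_eq_zero]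
    have hb' : δ b = (Algebra.TensorProduct.includeLeft : A →ₐ[K] A ⊗[K] H) b := hb
    change (Algebra.TensorProduct.includeLeft : A →ₐ[K] A ⊗[K] H) (a * b) * δ a' =
      (Algebra.TensorProduct.includeLeft : A →ₐ[K] A ⊗[K] H) a * δ (b * a')
    rw [_root_.map_mul, _root_.map_mul, hb', mul_assoc])

lemma canonicalMap_mk (a a' : A) :
    canonicalMap δ (Submodule.Quotient.mk (a ⊗ₜ[K] a')) = (a ⊗ₜ[K] (1 : H)) * δ a' := rfl

/-- The Hopf-Galois condition on the extension of an `H`-comodule algebra over its subalgebra of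
coaction invariants. -/
def IsHopfGalois : Prop := Function.Bijective (canonicalMap δ)

end Comodule

variable {G : Type u} [Group G] [Finite G] (α : G →* (A →ₐ[K] A))

open Classical in
/-- The coaction of the algebra of functions on a finite group which corresponds to an action. -/
noncomputable def coaction : A →ₐ[K] A ⊗[K] (G → K) :=
  letI := Fintype.ofFinite G
  ((Algebra.TensorProduct.piScalarRight K K A G).symm : (G → A) →ₐ[K] A ⊗[K] (G → K)).comp
    (AlgHom.pi fun g => α g)

lemma piScalarRight_coaction [Fintype G] [DecidableEq G] (a : A) :
    Algebra.TensorProduct.piScalarRight K K A G (coaction α a) = fun g => α g a := by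
  obtain rfl := Subsingleton.elim ‹Fintype G› (Fintype.ofFinite G)
  obtain rfl := Subsingleton.elim ‹DecidableEq G› (fun a b => Classical.propDecidable (a = b))
  exact AlgEquiv.apply_symm_apply _ _

lemma coaction_apply [Fintype G] [DecidableEq G] (a : A) :
    coaction α a = ∑ g : G, α g a ⊗ₜ[K] (Pi.single g 1 : G → K) := by
  apply (Algebra.TensorProduct.piScalarRight K K A G).injective
  rw [piScalarRight_coaction, _root_.map_sum]
  funext h
  simp [Finset.sum_apply, Pi.single_apply]

lemma mem_coinvariants_coaction (a : A) :
    a ∈ coinvariants (coaction α) ↔ ∀ g, α g a = a := by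
  classical
  have := Fintype.ofFinite G
  change coaction α a = a ⊗ₜ[K] (1 : G → K) ↔ _
  rw [← (Algebra.TensorProduct.piScalarRight K K A G).injective.eq_iff, piScalarRight_coaction,
    funext_iff]
  simp

end HopfGalois

end OrbifoldAQFT

open OrbifoldAQFT

/-!
Write `A` for the algebra at an object `c`, and `R` for its invariants. The truncation of the
orbifold theory at `c` is the endomorphism algebra of the pointing, the free equivariant module of
rank one, and evaluation at its generator identifies this algebra with `R` (`endHom`). The counit is
therefore the `1`-morphism with components `M ↦ M ⊗_R A`, where `G` acts on `A` only (`induceHom`,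
`counit`, `adjunct_counit`). All its coherences are equalities of homomorphisms out of iterated
induced modules, which agree on pure tensors.

The Hopf-Galois condition amounts to the existence of Galois coordinates: finitely many `xᵢ`, `yᵢ`
in `A` such that `∑ xᵢ g(yᵢ)` is `1` for `g = 1` and `0` otherwise (`isHopfGalois_iff`). Surjectivity
of the canonical map provides them, and they give an explicit inverse.

If Galois coordinates exist, then `M ↦ M ⊗_R A` is an equivalence onto equivariant modules
(`induce_isEquivalence`): the canonical map `V^G ⊗_R A → V` has the inverse
`v ↦ ∑ (∑_g g(v xᵢ)) ⊗ yᵢ`, and `M → (M ⊗_R A)^G` is bijective by averaging over `G`, where `|G|` is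
invertible as the characteristic is `0`. A `1`-morphism whose components are equivalences of
categories is an equivalence, the coherences of the inverse being obtained by conjugation
(`isEquivalence_of_app`).

Conversely, let some `1`-morphism from an inclusion to the orbifold theory be an equivalence. Free
modules of rank one separate morphisms of modules, hence the pointing separates morphisms of
equivariant modules. Since morphisms from the pointing to `V` are invariant elements of `V`, every
equivariant module is generated by its invariant elements (`invariantSpan_eq_top`). For the module
of functions `G → A`, whose invariant elements are the functions `k ↦ k(a)`, expressing the delta
function at `1` in terms of them yields Galois coordinates (`exists_isGaloisSystem`).
-/

namespace OrbifoldAQFT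

/-! ### Galois coordinates -/

section GaloisCoordinates

variable {K : Type u} [Field K] {G : Type u} [Group G] {A : Type u} [Ring A] [Algebra K A]
  (α : G →* (A →ₐ[K] A))

/-- Galois coordinates `(xᵢ, yᵢ)` of an action: `∑ xᵢ g(yᵢ)` is `1` for `g = 1` and `0`
otherwise. -/
structure IsGaloisSystem (S : Finset (A × A)) : Prop where
  sum_mul : ∑ p ∈ S, p.1 * p.2 = 1
  sum_mul_act : ∀ g, g ≠ 1 → ∑ p ∈ S, p.1 * α g p.2 = 0

/-- The map `a ⊗ a' ↦ (g ↦ a · g(a'))`, i.e. the canonical map before passing to the quotient,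
with `A ⊗ O(G)` identified with the functions `G → A`. -/
noncomputable def galoisMap : A ⊗[K] A →ₗ[K] (G → A) :=
  LinearMap.pi fun g => TensorProduct.lift ((LinearMap.mul K A).compl₂ (α g).toLinearMap)

@[simp]
lemma galoisMap_tmul (a a' : A) (g : G) : galoisMap α (a ⊗ₜ[K] a') g = a * α g a' := rfl

lemma act_act_inv (g : G) (a : A) : α g (α g⁻¹ a) = a := by
  have : α (g * g⁻¹) a = α g (α g⁻¹ a) := by rw [_root_.map_mul]; rfl
  rw [← this, mul_inv_cancel, _root_.map_one]
  rfl

variable {α} in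
/-- The elements `g(xᵢ)`, `yᵢ` are Galois coordinates on the other side. -/
lemma IsGaloisSystem.sum_act_mul {S : Finset (A × A)} (hS : IsGaloisSystem α S) (g : G)
    (hg : g ≠ 1) : ∑ p ∈ S, α g p.1 * p.2 = 0 := by
  have h := congrArg (α g) (hS.sum_mul_act g⁻¹ (inv_ne_one.2 hg))
  simpa only [_root_.map_sum, _root_.map_mul, act_act_inv, _root_.map_zero] using h

/-- The sum over the orbit of an element, as an element of the subalgebra of invariants. -/
noncomputable def orbitSum [Fintype G] (a : A) : coinvariants (coaction α) :=
  ⟨∑ g, α g a, (mem_coinvariants_coaction α _).2 fun h => by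
    rw [_root_.map_sum]
    refine Fintype.sum_equiv (Equiv.mulLeft h) _ _ fun g => ?_
    rw [Equiv.coe_mulLeft, _root_.map_mul]
    rfl⟩

lemma coe_orbitSum [Fintype G] (a : A) : (orbitSum α a : A) = ∑ g, α g a := rfl

variable {α} in
/-- An element is recovered from the orbit sums of its products with Galois coordinates. -/
lemma IsGaloisSystem.sum_orbitSum_mul [Fintype G] {S : Finset (A × A)} (hS : IsGaloisSystem α S)
    (a : A) : ∑ p ∈ S, (∑ g, α g (a * p.1)) * p.2 = a := by
  simp_rw [Finset.sum_mul, _root_.map_mul, mul_assoc]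
  rw [Finset.sum_comm]
  simp_rw [← Finset.mul_sum]
  rw [Finset.sum_eq_single 1 (fun g _ hg => by rw [hS.sum_act_mul g hg, mul_zero])
    (fun h => absurd (Finset.mem_univ _) h)]
  simp only [_root_.map_one, AlgHom.one_apply, hS.sum_mul, _root_.mul_one]

variable [Finite G]

lemma piScalarRight_preCanonical [Fintype G] [DecidableEq G] (z : A ⊗[K] A) :
    Algebra.TensorProduct.piScalarRight K K A G (preCanonical (coaction α) z) = galoisMap α z := by
  induction z with
  | zero => simp only [_root_.map_zero]
  | add x y hx hy => simp only [_root_.map_add, hx, hy]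
  | tmul a a' =>
    change Algebra.TensorProduct.piScalarRight K K A G ((a ⊗ₜ[K] 1) * coaction α a') = _
    rw [_root_.map_mul, piScalarRight_coaction]
    funext g
    simp

/-- The Hopf-Galois condition amounts to the existence of Galois coordinates: surjectivity of the
canonical map produces them, and they provide an explicit inverse. -/
theorem isHopfGalois_iff :
    IsHopfGalois (coaction α) ↔ ∃ S : Finset (A × A), IsGaloisSystem α S := by
  classical
  have := Fintype.ofFinite G
  let e := Algebra.TensorProduct.piScalarRight K K A G
  constructor
  · rintro ⟨-, h⟩
    obtain ⟨z, hz⟩ := h (e.symm (Pi.single 1 1))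
    obtain ⟨z, rfl⟩ := Submodule.Quotient.mk_surjective _ z
    have h1 : galoisMap α z = Pi.single 1 1 := by
      rw [← piScalarRight_preCanonical]
      exact (congrArg e hz).trans (e.apply_symm_apply _)
    obtain ⟨S, rfl⟩ := TensorProduct.exists_finset z
    have h2 : ∀ g, ∑ p ∈ S, p.1 * α g p.2 = (Pi.single 1 1 : G → A) g := fun g => by
      rw [← h1, _root_.map_sum, Finset.sum_apply]
      rfl
    refine ⟨S, ?_, fun g hg => by rw [h2, Pi.single_eq_of_ne hg]⟩
    have := h2 1
    rwa [_root_.map_one, Pi.single_eq_same] at this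
  · rintro ⟨S, hS⟩
    -- the inverse `φ ↦ ∑ᵢ ∑_g φ(g) g(xᵢ) ⊗ yᵢ` of the canonical map
    let inv : (G → A) → A ⊗[K] A := fun φ => ∑ p ∈ S, (∑ g, φ g * α g p.1) ⊗ₜ[K] p.2
    let N := tensorRel (coinvariants (coaction α))
    have hinv : ∀ z, N.mkQ (inv (galoisMap α z)) = N.mkQ z := by
      intro z
      induction z with
      | zero => simp [inv]
      | add x y hx hy =>
        have h1 : inv (galoisMap α x + galoisMap α y) =
            inv (galoisMap α x) + inv (galoisMap α y) := by
          simp only [inv, Pi.add_apply, add_mul, Finset.sum_add_distrib, TensorProduct.add_tmul]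
        rw [(galoisMap α).map_add, h1, _root_.map_add, _root_.map_add, hx, hy]
      | tmul a a' =>
        have h1 : ∀ x y : A, N.mkQ ((a * orbitSum α x) ⊗ₜ[K] y) =
            N.mkQ (a ⊗ₜ[K] ((orbitSum α x : A) * y)) := fun x y =>
          (Submodule.Quotient.eq N).2 (Submodule.subset_span ⟨a, y, orbitSum α x, rfl⟩)
        have h2 : ∀ p ∈ S, N.mkQ ((∑ g, galoisMap α (a ⊗ₜ[K] a') g * α g p.1) ⊗ₜ[K] p.2) =
            N.mkQ (a ⊗ₜ[K] ((∑ g, α g (a' * p.1)) * p.2)) := fun p _ => by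
          rw [← coe_orbitSum, ← h1, coe_orbitSum, Finset.mul_sum]
          simp only [galoisMap_tmul, _root_.map_mul, mul_assoc]
        rw [_root_.map_sum, Finset.sum_congr rfl h2, ← _root_.map_sum, ← TensorProduct.tmul_sum,
          hS.sum_orbitSum_mul]
    refine ⟨fun z z' h => ?_, fun y => ?_⟩
    · obtain ⟨z, rfl⟩ := N.mkQ_surjective z
      obtain ⟨z', rfl⟩ := N.mkQ_surjective z'
      have h1 : galoisMap α z = galoisMap α z' := by
        rw [← piScalarRight_preCanonical, ← piScalarRight_preCanonical]
        exact congrArg e h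
      rw [← hinv z, ← hinv z', h1]
    · refine ⟨N.mkQ (inv (e y)), e.injective ?_⟩
      refine (piScalarRight_preCanonical α _).trans (funext fun h => ?_)
      have h1 : ∀ p ∈ S, galoisMap α ((∑ g, e y g * α g p.1) ⊗ₜ[K] p.2) h =
          ∑ g, e y g * (α g p.1 * α h p.2) := fun p _ => by
        rw [galoisMap_tmul, Finset.sum_mul]
        simp only [mul_assoc]
      simp only [inv]
      rw [_root_.map_sum, Finset.sum_apply, Finset.sum_congr rfl h1, Finset.sum_comm]
      simp_rw [← Finset.mul_sum]
      have h2 : ∀ g, ∑ p ∈ S, α g p.1 * α h p.2 = α g (∑ p ∈ S, p.1 * α (g⁻¹ * h) p.2) := by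
        intro g
        simp only [_root_.map_sum, _root_.map_mul, AlgHom.mul_apply, act_act_inv]
      rw [Finset.sum_eq_single h]
      · rw [h2, inv_mul_cancel, _root_.map_one]
        exact (congrArg (fun z => e y h * α h z) hS.sum_mul).trans (by
          rw [_root_.map_one, _root_.mul_one])
      · intro g _ hg
        rw [h2, hS.sum_mul_act _ (by rwa [ne_eq, inv_mul_eq_one]), _root_.map_zero, mul_zero]
      · exact fun hh => absurd (Finset.mem_univ _) hh

end GaloisCoordinates

/-! ### Objectwise equivalences are equivalences -/

namespace TwoAQFT

variable {K : Type u} [Field K] {C : Type v} [Category.{w} C] {P : Orthogonality C}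

lemma prod_map_comp (B : TwoAQFT K P) {I : Type} [Finite I] {c : I → C} {t : C} (f : POp P c t)
    {X Y Z : ∀ i, B.cat (c i)} (h : ∀ i, X i ⟶ Y i) (k : ∀ i, Y i ⟶ Z i) :
    (B.prod f).map (fun i => h i ≫ k i) = (B.prod f).map h ≫ (B.prod f).map k :=
  (B.prod f).map_comp h k

lemma prod_map_id (B : TwoAQFT K P) {I : Type} [Finite I] {c : I → C} {t : C} (f : POp P c t)
    (X : ∀ i, B.cat (c i)) : (B.prod f).map (fun i => 𝟙 (X i)) = 𝟙 _ :=
  (B.prod f).map_id X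

/-- Functoriality of the factorization products for isomorphisms. -/
def prodIso (B : TwoAQFT K P) {I : Type} [Finite I] {c : I → C} {t : C} (f : POp P c t)
    {X Y : ∀ i, B.cat (c i)} (e : ∀ i, X i ≅ Y i) : (B.prod f).obj X ≅ (B.prod f).obj Y where
  hom := (B.prod f).map fun i => (e i).hom
  inv := (B.prod f).map fun i => (e i).inv
  hom_inv_id := by rw [← prod_map_comp]; simp only [Iso.hom_inv_id, prod_map_id]
  inv_hom_id := by rw [← prod_map_comp]; simp only [Iso.inv_hom_id, prod_map_id]

variable {A B : TwoAQFT K P} (ζ : Hom A B) [∀ c, (ζ.app c).IsEquivalence]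

/-- The counit of the objectwise equivalence. -/
noncomputable def Hom.cou {c : C} (Y : B.cat c) : (ζ.app c).obj ((ζ.app c).inv.obj Y) ≅ Y :=
  (ζ.app c).asEquivalence.counitIso.app Y

/-- The unit of the objectwise equivalence. -/
noncomputable def Hom.uni {c : C} (X : A.cat c) : X ≅ (ζ.app c).inv.obj ((ζ.app c).obj X) :=
  (ζ.app c).asEquivalence.unitIso.app X

lemma Hom.map_uni_cou {c : C} (X : A.cat c) :
    (ζ.app c).map (ζ.uni X).hom ≫ (ζ.cou ((ζ.app c).obj X)).hom = 𝟙 _ :=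
  (ζ.app c).asEquivalence.functor_unitIso_comp X

lemma Hom.cou_naturality {c : C} {X Y : B.cat c} (h : X ⟶ Y) :
    (ζ.app c).map ((ζ.app c).inv.map h) ≫ (ζ.cou Y).hom = (ζ.cou X).hom ≫ h :=
  (ζ.app c).asEquivalence.counitIso.hom.naturality h

/-- The structure isomorphisms of the inverse, obtained from those of `ζ` by conjugation. -/
noncomputable def Hom.invIso {I : Type} [Finite I] {c : I → C} {t : C} (f : POp P c t)
    (Y : ∀ i, B.cat (c i)) :
    (A.prod f).obj (fun i => (ζ.app (c i)).inv.obj (Y i)) ≅ (ζ.app t).inv.obj ((B.prod f).obj Y) :=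
  (ζ.app t).preimageIso ((ζ.iso f fun i => (ζ.app (c i)).inv.obj (Y i)).symm ≪≫
    B.prodIso f (fun i => ζ.cou (Y i)) ≪≫ (ζ.cou ((B.prod f).obj Y)).symm)

lemma Hom.invIso_spec {I : Type} [Finite I] {c : I → C} {t : C} (f : POp P c t)
    (Y : ∀ i, B.cat (c i)) :
    (ζ.iso f fun i => (ζ.app (c i)).inv.obj (Y i)).hom ≫ (ζ.app t).map (ζ.invIso f Y).hom ≫
      (ζ.cou ((B.prod f).obj Y)).hom = (B.prod f).map fun i => (ζ.cou (Y i)).hom := by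
  simp [Hom.invIso, prodIso]

/-- Morphisms into objects in the image of the inverse are tested after applying `ζ`. -/
lemma Hom.ext_inv {c : C} {W : B.cat c} {X : A.cat c} {Y : B.cat c} (e : W ⟶ (ζ.app c).obj X)
    [IsIso e] {m n : X ⟶ (ζ.app c).inv.obj Y}
    (h : e ≫ (ζ.app c).map m ≫ (ζ.cou Y).hom = e ≫ (ζ.app c).map n ≫ (ζ.cou Y).hom) : m = n :=
  (ζ.app c).map_injective ((cancel_mono _).1 ((cancel_epi e).1 h))

/-- The inverse of an objectwise equivalence. -/
noncomputable def Hom.invHom : Hom B A where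
  app c := (ζ.app c).inv
  additive c := by
    have : (ζ.app c).asEquivalence.functor.Additive := ζ.additive c
    exact inferInstanceAs ((ζ.app c).asEquivalence.inverse.Additive)
  linear c := by
    have : (ζ.app c).asEquivalence.functor.Additive := ζ.additive c
    have : (ζ.app c).asEquivalence.functor.Linear K := ζ.linear c
    exact inferInstanceAs ((ζ.app c).asEquivalence.inverse.Linear K)
  cocontinuous c := inferInstance
  iso f Y := ζ.invIso f Y
  naturality f X Y h := by
    apply ζ.ext_inv (ζ.iso f _).hom
    have h1 := ζ.naturality f fun i => (ζ.app _).inv.map (h i)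
    rw [Functor.map_comp, Functor.map_comp, Category.assoc, Category.assoc, cou_naturality,
      reassoc_of% ζ.invIso_spec f X, ← reassoc_of% h1, ζ.invIso_spec]
    refine (B.prod_map_comp f _ _).symm.trans (Eq.trans ?_ (B.prod_map_comp f _ _))
    exact congrArg (B.prod f).map (funext fun i => ζ.cou_naturality (h i))
  comp f g X := by
    apply ζ.ext_inv (B.prodIso f (fun i => ζ.iso (g i) _) ≪≫ ζ.iso f _).hom
    have h1 := ζ.comp f g fun i j => (ζ.app _).inv.obj (X i j)
    have h2 := B.comp_naturality f g fun i j => (ζ.cou (X i j)).hom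
    have h3 := ζ.naturality f fun i => (ζ.invIso (g i) (X i)).hom
    have h4 : (B.prod f).map (fun i => (ζ.iso (g i) fun j => (ζ.app _).inv.obj (X i j)).hom) ≫
        (B.prod f).map (fun i => (ζ.app _).map (ζ.invIso (g i) (X i)).hom) ≫
          (B.prod f).map (fun i => (ζ.cou ((B.prod (g i)).obj (X i))).hom) =
        (B.prod f).map fun i => (B.prod (g i)).map fun j => (ζ.cou (X i j)).hom := by
      rw [← prod_map_comp, ← prod_map_comp]
      exact congrArg (B.prod f).map (funext fun i => ζ.invIso_spec (g i) (X i))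
    simp only [Iso.trans_hom, prodIso, Functor.map_comp, Category.assoc]
    rw [← reassoc_of% h1, ζ.invIso_spec, cou_naturality, ← reassoc_of% h3,
      reassoc_of% ζ.invIso_spec f]
    rw [← reassoc_of% h4] at h2
    exact h2.symm
  unit {t} X := by
    apply ζ.ext_inv (𝟙 _)
    have h1 := ζ.unit ((ζ.app t).inv.obj X)
    have h2 := B.unit_naturality (ζ.cou X).hom
    simp only [Functor.map_comp, Category.assoc, Category.id_comp]
    rw [cou_naturality, ← h1, Category.assoc, ζ.invIso_spec]
    exact h2.symm
  perm σ _ _ f X := by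
    apply ζ.ext_inv (ζ.iso f _).hom
    have h1 := ζ.perm σ f fun i => (ζ.app _).inv.obj (X i)
    have h2 := B.perm_naturality σ f _ rfl fun i => (ζ.cou (X i)).hom
    simp only [Functor.map_comp, Category.assoc]
    rw [← reassoc_of% h1, ζ.invIso_spec (f.perm σ), cou_naturality, reassoc_of% ζ.invIso_spec f]
    exact h2.symm

/-- Modifications with invertible components are invertible. -/
def homIsoMk {ζ κ : Hom A B} (e : ∀ c, ζ.app c ≅ κ.app c)
    (h : ∀ {I : Type} [Finite I] {c : I → C} {t : C} (f : POp P c t) (X : ∀ i, A.cat (c i)),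
      (B.prod f).map (fun i => (e (c i)).hom.app (X i)) ≫ (κ.iso f X).hom =
        (ζ.iso f X).hom ≫ (e t).hom.app ((A.prod f).obj X)) : ζ ≅ κ where
  hom := ⟨fun c => (e c).hom, h⟩
  inv := ⟨fun c => (e c).inv, fun {I _ c t} f X => by
    have h1 := h f X
    rw [← cancel_epi (B.prodIso f fun i => (e (c i)).app (X i)).hom,
      ← cancel_mono ((e t).hom.app ((A.prod f).obj X))]
    have h2 : (B.prod f).map (fun i => (e (c i)).hom.app (X i)) ≫
        (B.prod f).map (fun i => (e (c i)).inv.app (X i)) = 𝟙 _ := by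
      rw [← prod_map_comp]
      simp only [Iso.hom_inv_id_app, prod_map_id]
    simp only [Category.assoc, Iso.inv_hom_id_app, Category.comp_id]
    rw [← h1, ← Category.assoc, ← Category.assoc]
    refine (congrArg (fun z => (z ≫ _) ≫ _) h2).trans ?_
    rw [Category.id_comp]
    rfl⟩
  hom_inv_id := Modification.ext (funext fun c => (e c).hom_inv_id)
  inv_hom_id := Modification.ext (funext fun c => (e c).inv_hom_id)

/-- A `1`-morphism whose components are equivalences of categories is an equivalence. -/
theorem isEquivalence_of_app : IsEquivalence ζ := by
  refine ⟨ζ.invHom, ⟨homIsoMk (fun c => (ζ.app c).asEquivalence.unitIso) fun f X => ?_⟩,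
    ⟨homIsoMk (fun c => (ζ.app c).asEquivalence.counitIso) fun f X => ?_⟩⟩
  · apply ζ.ext_inv (ζ.iso f X).hom
    have h1 := ζ.naturality f fun i => (ζ.uni (X i)).hom
    have h2 : (B.prod f).map (fun i => (ζ.app _).map (ζ.uni (X i)).hom) ≫
        (B.prod f).map (fun i => (ζ.cou ((ζ.app _).obj (X i))).hom) = 𝟙 _ := by
      rw [← prod_map_comp, ← prod_map_id]
      exact congrArg (B.prod f).map (funext fun i => ζ.map_uni_cou (X i))
    change (ζ.iso f X).hom ≫ (ζ.app _).map ((A.prod f).map (fun i => (ζ.uni (X i)).hom) ≫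
        (ζ.invIso f fun i => (ζ.app _).obj (X i)).hom ≫ (ζ.app _).inv.map (ζ.iso f X).hom) ≫ _ =
      (ζ.iso f X).hom ≫ (ζ.app _).map (𝟙 _ ≫ (ζ.uni _).hom) ≫ (ζ.cou _).hom
    rw [Category.id_comp, ζ.map_uni_cou, Functor.map_comp, Functor.map_comp]
    simp only [Category.assoc]
    rw [ζ.cou_naturality, ← reassoc_of% h1, reassoc_of% ζ.invIso_spec f, reassoc_of% h2,
      Category.comp_id]
  · exact (Category.comp_id _).trans ((ζ.invIso_spec f X).symm.trans (Category.assoc _ _ _).symm)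

end TwoAQFT

/-! ### Induction of modules to equivariant modules -/

section Induction

variable {K : Type u} [Field K] {G : Type u} [Group G] {A B : Type u} [Ring A] [Algebra K A]
  [Ring B] [Algebra K B] {α : G →* (A →ₐ[K] A)}

variable (G) in
/-- Modules with the trivial action of `G`. -/
def trivialAction : ModuleCat.{u} Bᵐᵒᵖ ⥤ GMod (K := K) (1 : G →* (B →ₐ[K] B)) where
  obj M := ⟨M, 1, fun _ _ _ => rfl⟩
  map h := ⟨h, fun _ _ => rfl⟩

instance {J : Type u} [Category.{u} J] :
    PreservesColimitsOfShape J (trivialAction (K := K) G (B := B)) := by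
  have h1 : ReflectsColimitsOfShape J (GMod.forget (1 : G →* (B →ₐ[K] B))) :=
    reflectsColimitsOfShape_of_reflectsIsomorphisms
  have h2 : PreservesColimitsOfShape J
      (trivialAction (K := K) G (B := B) ⋙ GMod.forget (1 : G →* (B →ₐ[K] B))) :=
    inferInstanceAs (PreservesColimitsOfShape J (𝟭 (ModuleCat.{u} Bᵐᵒᵖ)))
  exact preservesColimitsOfShape_of_reflects_of_preserves _
    (GMod.forget (1 : G →* (B →ₐ[K] B)))

variable (φ : B →ₐ[K] A) (hφ : ∀ g b, α g (φ b) = φ b)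

/-- The functor `M ↦ M ⊗_B A`, where `G` acts on `A` by automorphisms which fix the image of
`B`. -/
noncomputable def induce : ModuleCat.{u} Bᵐᵒᵖ ⥤ GMod α :=
  trivialAction G ⋙ Functor.pi' (fun _ : Unit => 𝟭 (GMod (1 : G →* (B →ₐ[K] B)))) ⋙
    gfacFunctor (α := fun _ => 1) (fun _ : Unit => φ) fun _ g b => (hφ g b).symm

lemma slot_const {D : Type (u + 1)} [Category.{u} D] (X : Unit → D) :
    slot X () = Functor.pi' fun _ : Unit => 𝟭 D := slot_unit X

instance induce_additive : (induce φ hφ).Additive where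
  map_add {M N h h'} := Subtype.ext (fmap_add (fun _ : Unit => φ) () _ _ _
    (fun j hj => absurd rfl hj) rfl)

instance induce_linear : (induce φ hφ).Linear K where
  map_smul h k := Subtype.ext (fmap_smul (fun _ : Unit => φ) () _ _ k
    (fun j hj => absurd rfl hj) rfl)

instance induce_preservesColimits : PreservesColimitsOfSize.{u, u} (induce φ hφ) where
  preservesColimitsOfShape {J} _ := by
    have h := (gfacFunctor_isMulti (α := fun _ => 1) (β := α) (fun _ : Unit => φ)
      fun _ g b => (hφ g b).symm).cocontinuous (fun _ => (trivialAction G).obj (ModuleCat.of _ B)) ()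
    rw [slot_const] at h
    exact inferInstanceAs (PreservesColimitsOfShape J (trivialAction G ⋙ (_ ⋙ _)))

/-- The action of `G` on generators of an induced module is trivial. -/
lemma induce_rep_gen (M : ModuleCat.{u} Bᵐᵒᵖ) (g : G) (m : Unit → M) :
    ((induce φ hφ).obj M).rep g ((gen fun _ : Unit => φ).toFun m) =
      (gen fun _ : Unit => φ).toFun m :=
  gfac_gen (α := fun _ => 1) (fun _ : Unit => φ) (fun _ g b => (hφ g b).symm)
    (fun _ => (trivialAction G).obj M) g m

end Induction

/-! ### The `1`-morphism of induction -/

section InductionHom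

variable {K : Type u} [Field K] {C : Type v} [Category.{w} C] {P : Orthogonality C}
  {G : Type u} [Group G]

/-- The components of a morphism of algebraic quantum field theories. -/
abbrev algApp {T A : AQFT K P} (φ : T ⟶ A) (c : C) : T.obj.obj c →ₐ[K] A.obj.obj c :=
  (φ.hom.app c).hom

lemma alg_algApp {T A : AQFT K P} (φ : T ⟶ A) {I : Type} {c : I → C} {t : C} (f : POp P c t)
    (i : I) (a : T.obj.obj (c i)) : alg A f i (algApp φ (c i) a) = algApp φ t (alg T f i a) :=
  AlgHom.congr_fun (congrArg AlgCat.Hom.hom (φ.hom.naturality (f.hom i)).symm) a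

variable {T A : AQFT K P} (ρ : G →* Aut A) (φ : T ⟶ A)

section

variable {I : Type} {c : I → C} {t : C} (f : POp P c t)

/-- The comparison `(⨂ Vᵢ) ⊗_{⨂ T(cᵢ)} A(t) ≅ ((⨂ Vᵢ) ⊗_{⨂ T(cᵢ)} T(t)) ⊗_{T(t)} A(t)`. -/
noncomputable def collapse (X : ∀ i, ModuleCat.{u} (T.obj.obj (c i))ᵐᵒᵖ) :
    facObj (fun p : (Σ _ : I, Unit) => (alg A f p.1).comp (algApp φ (c p.1)))
        (fun p => X p.1) ≅
      facObj (fun _ : Unit => algApp φ t) fun _ => facObj (alg T f) X :=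
  fperm (V := fun p : (Σ _ : I, Unit) => X p.1) (f' := fun q : (Σ _ : Unit, I) =>
      (algApp φ t).comp (alg T f q.2))
      ((sigmaUnitLeft I).trans (sigmaUnitRight I).symm)
      (fun q a => (alg_algApp φ f q.2 a).symm) ≪≫
    (fcomp (f := fun _ : Unit => algApp φ t) (g := fun _ => alg T f) (X := fun _ => X)
      (fun i j h => absurd rfl h) fun _ _ _ => rfl).symm

lemma collapse_gen (X : ∀ i, ModuleCat.{u} (T.obj.obj (c i))ᵐᵒᵖ)
    (v : ∀ p : (Σ _ : I, Unit), X p.1) :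
    (collapse φ f X).hom.hom ((gen fun p : (Σ _ : I, Unit) =>
        (alg A f p.1).comp (algApp φ (c p.1))).toFun v) =
      (gen fun _ : Unit => algApp φ t).toFun fun _ => (gen (alg T f)).toFun fun i => v ⟨i, ()⟩ :=
  chase (fperm_gen (V := fun p : (Σ _ : I, Unit) => X p.1) _ _ v)
    (fcomp_inv_gen (f := fun _ : Unit => algApp φ t) (g := fun _ => alg T f) (X := fun _ => X)
      (fun i j h => absurd rfl h) (fun _ _ _ => rfl) _)

variable (hφ : ∀ c g b, act A ρ c g (algApp φ c b) = algApp φ c b)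

/-- The structure isomorphisms of the induction morphism. -/
noncomputable def induceIso [Finite I] (X : ∀ i, ModuleCat.{u} (T.obj.obj (c i))ᵐᵒᵖ) :
    gfac (alg A f) (alg_act A ρ f) (fun i => (induce (algApp φ (c i)) (hφ (c i))).obj (X i)) ≅
      (induce (algApp φ t) (hφ t)).obj (facObj (alg T f) X) :=
  gfcomp (J := fun _ => Unit) (g := fun i _ => algApp φ (c i)) (γ := fun _ _ => 1)
      (fg := fun p : (Σ _ : I, Unit) => (alg A f p.1).comp (algApp φ (c p.1)))
      (alg_act A ρ f) (fun i _ g b => (hφ (c i) g b).symm)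
      (fun p g b => (congrArg (alg A f p.1) (hφ (c p.1) g b).symm).trans (alg_act A ρ f p.1 g _))
      (alg_commute A f) (fun _ _ _ => rfl) (fun i _ => (trivialAction G).obj (X i)) ≪≫
    GMod.isoMk (V := gfac (α := fun _ => 1) (fun p : (Σ _ : I, Unit) =>
        (alg A f p.1).comp (algApp φ (c p.1))) _ fun p => (trivialAction G).obj (X p.1))
      (collapse φ f X)
      (equivariant_of_gen (α := fun _ => 1) (fun p : (Σ _ : I, Unit) =>
        (alg A f p.1).comp (algApp φ (c p.1))) _ (V := fun p => (trivialAction G).obj (X p.1))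
        (W := (induce (algApp φ t) (hφ t)).obj (facObj (alg T f) X)) _ fun g v => by
          refine (collapse_gen φ f X v).trans ?_
          refine Eq.trans ?_ (congrArg _ (collapse_gen φ f X v).symm)
          exact (induce_rep_gen (algApp φ t) (hφ t) _ g _).symm)

lemma induceIso_gen [Finite I] (X : ∀ i, ModuleCat.{u} (T.obj.obj (c i))ᵐᵒᵖ) (x : ∀ i, X i) :
    (induceIso ρ φ f hφ X).hom.1.hom ((gen (alg A f)).toFun fun i =>
        (gen fun _ : Unit => algApp φ (c i)).toFun fun _ => x i) =
      (gen fun _ : Unit => algApp φ t).toFun fun _ => (gen (alg T f)).toFun x :=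
  chase (fcomp_gen (f := alg A f) (g := fun i (_ : Unit) => algApp φ (c i))
    (X := fun i _ => X i) (alg_commute A f) (fun _ _ _ => rfl) fun i _ => x i)
    (collapse_gen φ f X fun p => x p.1)

end

variable (hφ : ∀ c g b, act A ρ c g (algApp φ c b) = algApp φ c b)

/-- A morphism of algebraic quantum field theories `T ⟶ A` whose components take values in the
invariants induces a `1`-morphism to the categorified orbifold theory. -/
noncomputable def induceHom [Finite G] : TwoAQFT.Hom (incl T) (gauge A ρ) where
  app c := induce (algApp φ c) (hφ c)
  additive c := induce_additive (algApp φ c) (hφ c)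
  linear c := induce_linear (algApp φ c) (hφ c)
  cocontinuous c := induce_preservesColimits (algApp φ c) (hφ c)
  iso f X := induceIso ρ φ f hφ X
  naturality {I _ c t} f X Y h := Subtype.ext <| fac_ext₂ (f := alg A f)
    (g := fun i (_ : Unit) => algApp φ (c i)) (X := fun i _ => X i) fun x => by
      refine (chase (fmap_gen' fun i => fmap_gen (fun _ => h i) (x i))
        (induceIso_gen ρ φ f hφ Y fun i => (h i).hom (x i ()))).trans (Eq.symm ?_)
      exact chase (induceIso_gen ρ φ f hφ X fun i => x i ()) (fmap_gen' fun _ => fmap_gen h _)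
  comp {I _ J _ c d t} f g X := Subtype.ext <| fac_ext₃ (f := alg A f)
    (g := fun i => alg A (g i)) (h := fun i j (_ : Unit) => algApp φ (d i j))
    (Y := fun i j _ => X i j) (fg := alg A (f.comp g)) (alg_commute A f) (alg_comp A f g)
    fun x => by
      refine (chase (fcomp_gen (alg_commute A f) (alg_comp A f g) _)
        (induceIso_gen ρ φ (f.comp g) hφ (fun p => X p.1 p.2) fun p => x p.1 p.2 ())).trans
          (Eq.symm ?_)
      exact chase (fmap_gen' fun i => induceIso_gen ρ φ (g i) hφ (X i) fun j => x i j ())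
        (chase (induceIso_gen ρ φ f hφ _ _)
          (fmap_gen' fun _ => fcomp_gen (alg_commute T f) (alg_comp T f g) _))
  unit {t} X := Subtype.ext <| fac_ext fun x =>
    Eq.trans (chase (funit_hom (alg_one A) _ _) (induceIso_gen ρ φ (POp.one P t) hφ (fun _ => X) x))
      (fmap_gen' fun _ => funit_hom (alg_one T) _ _).symm
  perm {I J _ _} σ {c t} f X := Subtype.ext <| fac_ext₂ (f := alg A f)
    (g := fun i (_ : Unit) => algApp φ (c i)) (X := fun i _ => X i) fun x =>
      Eq.trans (chase (fperm_gen σ (alg_perm A σ f _ rfl) _)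
          (induceIso_gen ρ φ (f.perm σ) hφ (fun j => X (σ j)) fun j => x (σ j) ()))
        (Eq.symm (chase (induceIso_gen ρ φ f hφ X fun i => x i ())
          (fmap_gen' fun _ => fperm_gen σ (alg_perm T σ f _ rfl) _)))

end InductionHom

/-! ### The pointing of the orbifold theory -/

section FreeModule

variable {K : Type u} [Field K] {I : Type} [IsEmpty I] {A : I → Type u} [∀ i, Ring (A i)]
  [∀ i, Algebra K (A i)] {B : Type u} [Ring B] [Algebra K B] {f : ∀ i, A i →ₐ[K] B}
  {V : ∀ i, ModuleCat.{u} (A i)ᵐᵒᵖ}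

variable (f V) in
/-- The coordinate on the free module of rank one, with respect to its generator. -/
noncomputable def coord : facObj f V ⟶ ModuleCat.of Bᵐᵒᵖ B :=
  fdesc (W := ModuleCat.of Bᵐᵒᵖ B)
    { toFun := fun _ => (1 : B)
      map_add := fun _ i => isEmptyElim i
      map_act := fun _ i => isEmptyElim i }

lemma coord_gen (v : ∀ i, V i) : (coord f V).hom ((gen f).toFun v) = (1 : B) := fdesc_gen _ _

lemma coord_smul_gen (b : B) (v : ∀ i, V i) :
    (coord f V).hom (op b • (gen f).toFun v) = b := by
  refine (chase_smul (coord_gen v) _).trans ?_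
  exact _root_.one_mul b

lemma eq_coord_smul (x : facObj f V) (v : ∀ i, V i) :
    x = op ((coord f V).hom x : B) • (gen f).toFun v := by
  induction x using fac_induction with
  | h0 => rw [_root_.map_zero]; exact (zero_smul Bᵐᵒᵖ _).symm
  | ha x y hx hy =>
    rw [_root_.map_add]
    refine (congrArg₂ (· + ·) hx hy).trans ?_
    exact (add_smul (op ((coord f V).hom x : B)) (op ((coord f V).hom y : B)) _).symm
  | hs b x hx =>
    rw [_root_.map_smul]
    refine (congrArg (op b • ·) hx).trans ?_
    exact (mul_smul (op b) (op ((coord f V).hom x : B)) _).symm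
  | hg w =>
    obtain rfl : w = v := funext fun i => isEmptyElim i
    rw [coord_gen]
    exact (one_smul _ _).symm

end FreeModule

section Pointing

open TwoAQFT

variable {K : Type u} [Field K] {C : Type v} [Category.{w} C] {P : Orthogonality C}
  {G : Type u} [Group G] [Finite G] (A : AQFT K P) (ρ : G →* Aut A)

/-- The pointing of the orbifold theory, as an equivariant module. -/
noncomputable def gpt (t : C) : GMod (act A ρ t) := (gauge A ρ).pt t

/-- The generator of the pointing of the orbifold theory. -/
noncomputable def gptGen (t : C) : (gpt A ρ t).mod :=
  (gen (alg A (POp.zero P t))).toFun fun i => i.elim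

lemma gptGen_rep (t : C) (g : G) : (gpt A ρ t).rep g (gptGen A ρ t) = gptGen A ρ t := by
  refine (gfac_gen (alg A (POp.zero P t)) (alg_act A ρ _) _ g _).trans ?_
  exact congrArg (gen (alg A (POp.zero P t))).toFun (funext fun i => i.elim)

/-- The coordinate of an element of the pointing with respect to its generator. -/
noncomputable def gptCoord (t : C) : (gpt A ρ t).mod ⟶ ModuleCat.of _ (A.obj.obj t) :=
  coord (alg A (POp.zero P t)) _

lemma gptCoord_smul {t : C} (a : A.obj.obj t) :
    (gptCoord A ρ t).hom (op a • gptGen A ρ t) = a :=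
  coord_smul_gen a _

lemma eq_gptCoord_smul {t : C} (x : (gpt A ρ t).mod) :
    x = op ((gptCoord A ρ t).hom x : A.obj.obj t) • gptGen A ρ t := eq_coord_smul x _

lemma gpt_hom_ext {t : C} {W : GMod (act A ρ t)} {m n : gpt A ρ t ⟶ W}
    (h : m.1.hom (gptGen A ρ t) = n.1.hom (gptGen A ρ t)) : m = n := by
  refine Subtype.ext (ModuleCat.hom_ext (LinearMap.ext fun x => ?_))
  rw [eq_gptCoord_smul A ρ x]
  exact (chase_smul h _).trans (_root_.map_smul n.1.hom _ _).symm

/-- The homomorphism out of the pointing which is determined by an invariant element. -/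
noncomputable def gptHom {t : C} (W : GMod (act A ρ t)) (w : W.mod) (hw : ∀ g, W.rep g w = w) :
    gpt A ρ t ⟶ W :=
  gfacHom (alg A (POp.zero P t)) (alg_act A ρ _)
    (fdesc
      { toFun := fun _ => w
        map_add := fun _ i => i.elim
        map_act := fun _ i => i.elim })
    fun g v => by rw [fdesc_gen, fdesc_gen, hw]

lemma gptHom_gen {t : C} (W : GMod (act A ρ t)) (w : W.mod) (hw : ∀ g, W.rep g w = w) :
    (gptHom A ρ W w hw).1.hom (gptGen A ρ t) = w := fdesc_gen _ _

variable {A ρ} in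
/-- The linear map underlying an endomorphism of the pointing. -/
noncomputable def endLin {t : C} (h : End ((gauge A ρ).pt t)) :
    (gpt A ρ t).mod →ₗ[(A.obj.obj t)ᵐᵒᵖ] (gpt A ρ t).mod :=
  (show gpt A ρ t ⟶ gpt A ρ t from h).1.hom

/-- The element of the algebra by which an endomorphism of the pointing multiplies. -/
noncomputable def endElt {t : C} (h : End ((gauge A ρ).pt t)) : A.obj.obj t :=
  (gptCoord A ρ t).hom (endLin h (gptGen A ρ t))

lemma endLin_gptGen {t : C} (h : End ((gauge A ρ).pt t)) :
    endLin h (gptGen A ρ t) = op (endElt A ρ h) • gptGen A ρ t :=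
  eq_gptCoord_smul A ρ _

lemma endElt_eq_iff {t : C} (h : End ((gauge A ρ).pt t)) (a : A.obj.obj t) :
    endElt A ρ h = a ↔ endLin h (gptGen A ρ t) = op a • gptGen A ρ t := by
  rw [endLin_gptGen]
  refine ⟨fun h => by rw [h], fun h => ?_⟩
  rw [← gptCoord_smul A ρ (endElt A ρ _), h, gptCoord_smul]

/-- The identification of the endomorphisms of the pointing with elements of the algebra, as an
algebra homomorphism. -/
noncomputable def endHom (t : C) : End ((gauge A ρ).pt t) →ₐ[K] A.obj.obj t :=
  AlgHom.ofLinearMap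
    { toFun := endElt A ρ
      map_add' := fun h h' => _root_.map_add (gptCoord A ρ t).hom _ _
      map_smul' := fun k h => by
        have h1 : endLin (k • h) (gptGen A ρ t) = k • endLin h (gptGen A ρ t) := rfl
        rw [endElt_eq_iff, RingHom.id_apply, h1, smul_eq, endLin_gptGen, ← mul_smul, ← op_mul,
          ← Algebra.commutes, Algebra.smul_def] }
    ((endElt_eq_iff A ρ _ _).2 (one_smul _ _).symm)
    (fun h h' => (endElt_eq_iff A ρ _ _).2 (by
      have h1 : endLin (h * h') (gptGen A ρ t) = endLin h (endLin h' (gptGen A ρ t)) := rfl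
      rw [h1, endLin_gptGen, _root_.map_smul, endLin_gptGen, ← mul_smul, ← op_mul]
      rfl))

lemma endHom_injective (t : C) : Function.Injective (endHom A ρ t) := fun h h' e =>
  gpt_hom_ext A ρ (by
    have := (endElt_eq_iff A ρ h _).1 e
    exact this.trans (endLin_gptGen A ρ h').symm)

lemma act_endHom (t : C) (g : G) (h : End ((gauge A ρ).pt t)) :
    act A ρ t g (endHom A ρ t h) = endHom A ρ t h := by
  refine ((endElt_eq_iff A ρ h _).2 ?_).symm
  have h1 : endLin h ((gpt A ρ t).rep g (gptGen A ρ t)) =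
    (gpt A ρ t).rep g (endLin h (gptGen A ρ t)) :=
    (show gpt A ρ t ⟶ gpt A ρ t from h).2 g (gptGen A ρ t)
  rw [gptGen_rep] at h1
  rw [h1, endLin_gptGen, GMod.rep_smul, gptGen_rep]
  rfl

lemma exists_endHom_eq (t : C) (a : A.obj.obj t) (ha : ∀ g, act A ρ t g a = a) :
    ∃ h, endHom A ρ t h = a :=
  ⟨gptHom A ρ (gpt A ρ t) (op a • gptGen A ρ t)
      (fun g => by rw [GMod.rep_smul, ha, gptGen_rep]),
    (endElt_eq_iff A ρ _ _).2 (gptHom_gen A ρ _ _ _)⟩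

lemma gauge_emptyIso_gen {I : Type} [Finite I] [IsEmpty I] {c : I → C} {t : C} (f : POp P c t)
    (X : ∀ i, GMod (act A ρ (c i))) (x : ∀ i, (X i).mod) :
    ((gauge A ρ).emptyIso f X).hom.1.hom ((gen (alg A f)).toFun x) = gptGen A ρ t := by
  have key : ∀ {c : Empty → C} (f : POp P c t) (X : ∀ i, GMod (act A ρ (c i)))
      (x : ∀ i, (X i).mod), (eqToIso ((gauge A ρ).obj_eq_pt f X)).hom.1.hom
        ((gen (alg A f)).toFun x) = gptGen A ρ t := by
    intro c f X x
    obtain rfl : c = fun i => i.elim := funext fun i => i.elim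
    obtain rfl : f = POp.zero P t := POp.ext (funext fun i => i.elim)
    obtain rfl : X = fun i => i.elim := funext fun i => i.elim
    obtain rfl : x = fun i => i.elim := funext fun i => i.elim
    rfl
  exact chase (fperm_gen (V := fun i => (X i).mod) (Equiv.equivOfIsEmpty Empty I)
    (alg_perm A _ f _ rfl) x) (key _ _ _)

lemma gauge_ptIso_gen {I : Type} [Finite I] {c : I → C} {t : C} (f : POp P c t) :
    ((gauge A ρ).ptIso f).hom.1.hom ((gen (alg A f)).toFun fun i => gptGen A ρ (c i)) =
      gptGen A ρ t :=
  chase (fcomp_gen (X := fun i (j : Empty) => (j.elim : GMod (act A ρ (j.elim : C))).mod)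
    (alg_commute A f)
    (alg_comp A f fun i => POp.zero P (c i)) fun _ j => j.elim) (gauge_emptyIso_gen A ρ _ _ _)

lemma endHom_naturality {c d : C} (f : c ⟶ d) (h : End ((gauge A ρ).pt c)) :
    endHom A ρ d ((gauge A ρ).mulHom f h) = (A.obj.map f).hom (endHom A ρ c h) := by
  refine (endElt_eq_iff A ρ _ _).2 ?_
  let q : facObj (alg A (POp.unary (P := P) f)) (fun _ => (gpt A ρ c).mod) :=
    (gen (alg A (POp.unary (P := P) f))).toFun fun _ => gptGen A ρ c
  let m : facObj (alg A (POp.unary (P := P) f)) (fun _ => (gpt A ρ c).mod) ⟶ (gpt A ρ d).mod :=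
    ((gauge A ρ).ptIso (POp.unary (P := P) f)).hom.1
  let n : facObj (alg A (POp.unary (P := P) f)) (fun _ => (gpt A ρ c).mod) ⟶
      facObj (alg A (POp.unary (P := P) f)) (fun _ => (gpt A ρ c).mod) :=
    fmap _ fun _ => (show gpt A ρ c ⟶ gpt A ρ c from h).1
  have h0 : m.hom q = gptGen A ρ d := gauge_ptIso_gen A ρ (POp.unary (P := P) f)
  have h1 : endLin ((gauge A ρ).mulHom f h) (m.hom q) = m.hom (n.hom q) :=
    LinearMap.congr_fun (congrArg ModuleCat.Hom.hom (congrArg Subtype.val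
      ((gauge A ρ).hom_mul (POp.unary f) fun _ => h))) q
  have h2 : n.hom q = op ((A.obj.map f).hom (endHom A ρ c h)) • q :=
    (fmap_gen' fun _ => endLin_gptGen A ρ h).trans
      (gen_eq_smul (f := alg A (POp.unary (P := P) f)) () _ (fun j hj => absurd rfl hj) rfl)
  rw [← h0, h1, h2, _root_.map_smul]

/-- The morphism `trunc (gauge A ρ) ⟶ A` which identifies the truncation with the invariants. -/
noncomputable def endMorphism : trunc (gauge A ρ) ⟶ A :=
  ObjectProperty.homMk
    { app := fun c => AlgCat.ofHom (endHom A ρ c)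
      naturality := fun c d f => AlgCat.hom_ext _ (AlgHom.ext fun h => endHom_naturality A ρ f h) }

/-- The counit at the orbifold theory, which induces modules over the invariants. -/
noncomputable def counit : Hom (incl (trunc (gauge A ρ))) (gauge A ρ) :=
  induceHom ρ (endMorphism A ρ) (act_endHom A ρ)

lemma counit_ptIso_gen (t : C) :
    (show gpt A ρ t ⟶ (induce (endHom A ρ t) (act_endHom A ρ t)).obj
      ((incl (trunc (gauge A ρ))).pt t) from ((counit A ρ).ptIso t).hom).1.hom (gptGen A ρ t) =
      (gen fun _ : Unit => endHom A ρ t).toFun fun _ => ptGen (trunc (gauge A ρ)) t := by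
  let T := trunc (gauge A ρ)
  let X : ∀ i : Empty, ModuleCat.{u} (T.obj.obj (i.elim : C))ᵐᵒᵖ := fun i => i.elim
  let Y : ∀ i : Empty, GMod (act A ρ (i.elim : C)) := fun i =>
    (induce (endHom A ρ _) (act_endHom A ρ _)).obj (X i)
  let f : POp P (fun i : Empty => i.elim) t := POp.zero P t
  let e : facObj (alg A f) (fun i => (Y i).mod) ⟶ (gpt A ρ t).mod :=
    ((gauge A ρ).emptyIso f Y).hom.1
  let p : (gpt A ρ t).mod ⟶ ((induce (endHom A ρ t) (act_endHom A ρ t)).obj ((incl T).pt t)).mod :=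
    ((counit A ρ).ptIso t).hom.1
  have h1 : e.hom ((gen (alg A f)).toFun fun i => i.elim) = gptGen A ρ t :=
    gauge_emptyIso_gen A ρ f Y _
  have h2 : e ≫ p = (induceIso ρ (endMorphism A ρ) f (act_endHom A ρ) X).hom.1 :=
    congrArg Subtype.val ((counit A ρ).emptyIso_ptIso t)
  have h3 := congrArg (fun m => ModuleCat.Hom.hom m ((gen (alg A f)).toFun fun i => i.elim)) h2
  have h4 := induceIso_gen ρ (endMorphism A ρ) f (act_endHom A ρ) X fun i => i.elim
  have h5 : p.hom (e.hom ((gen (alg A f)).toFun fun i => i.elim)) = _ := h3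
  change p.hom (gptGen A ρ t) = _
  rw [← h1, h5]
  refine Eq.trans ?_ h4
  congr 2
  exact funext fun i => i.elim

lemma adjunct_counit : adjunct (counit A ρ) = 𝟙 (trunc (gauge A ρ)) := by
  refine ObjectProperty.hom_ext _ (NatTrans.ext (funext fun t => AlgCat.hom_ext _
    (AlgHom.ext fun h => ?_)))
  change ((counit A ρ).ptIso t).hom ≫ ((counit A ρ).app t).map (unitHom _ t h) ≫
    ((counit A ρ).ptIso t).inv = (h : End ((gauge A ρ).pt t))
  refine (Category.assoc _ _ _).symm.trans
    ((Iso.comp_inv_eq ((counit A ρ).ptIso t) (g := (h : End ((gauge A ρ).pt t)))).2 ?_)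
  refine gpt_hom_ext A ρ (W := (induce (endHom A ρ t) (act_endHom A ρ t)).obj
      ((incl (trunc (gauge A ρ))).pt t)) ?_
  have h1 := counit_ptIso_gen A ρ t
  refine (chase h1 (fmap_gen' fun _ => unitHom_gen (trunc (gauge A ρ)) h)).trans ?_
  refine Eq.symm ((chase (endLin_gptGen A ρ h) (chase_smul h1 _)).trans ?_)
  exact (gen_eq_smul (f := fun _ : Unit => endHom A ρ t) () _ (fun j hj => absurd rfl hj) rfl).symm

end Pointing

/-! ### Galois descent for equivariant modules -/

section Descent

variable {K : Type u} [Field K] {G : Type u} [Group G] {A B : Type u} [Ring A] [Algebra K A]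
  [Ring B] [Algebra K B] {α : G →* (A →ₐ[K] A)}

/-- Elements of an induced module are sums of the elements `v ⊗ a`. -/
lemma fac_induction_smul {I : Type} {A' : I → Type u} [∀ i, Ring (A' i)] [∀ i, Algebra K (A' i)]
    {f : ∀ i, A' i →ₐ[K] A} {V : ∀ i, ModuleCat.{u} (A' i)ᵐᵒᵖ} {p : facObj f V → Prop} (h0 : p 0)
    (ha : ∀ x y, p x → p y → p (x + y)) (hs : ∀ (a : A) v, p (op a • (gen f).toFun v)) (x) :
    p x := by
  suffices h : ∀ a : A, p (op a • x) by simpa only [op_one, one_smul] using h 1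
  induction x using fac_induction with
  | h0 => intro a; rwa [smul_zero]
  | ha x y hx hy => intro a; rw [smul_add]; exact ha _ _ (hx a) (hy a)
  | hs b x hx => intro a; rw [← mul_smul, ← op_mul]; exact hx _
  | hg v => exact fun a => hs a v

/-- The additive maps `A → M`, as a right `A`-module by `(w · a)(x) = w(a x)`. -/
def Coinduced (A M : Type u) [Ring A] [AddCommGroup M] : Type u := A →+ M

instance (A M : Type u) [Ring A] [AddCommGroup M] : AddCommGroup (Coinduced A M) :=
  inferInstanceAs (AddCommGroup (A →+ M))

instance (A M : Type u) [Ring A] [AddCommGroup M] : Module Aᵐᵒᵖ (Coinduced A M) where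
  smul a w := AddMonoidHom.comp w (AddMonoidHom.mulLeft a.unop)
  one_smul w := AddMonoidHom.ext fun x => congrArg w.toFun (_root_.one_mul x)
  mul_smul a b w := AddMonoidHom.ext fun x => congrArg w.toFun (mul_assoc b.unop a.unop x)
  smul_zero a := rfl
  smul_add a w w' := rfl
  add_smul a b w := AddMonoidHom.ext fun x =>
    (congrArg w.toFun (add_mul a.unop b.unop x)).trans (w.map_add' _ _)
  zero_smul w := AddMonoidHom.ext fun x => (congrArg w.toFun (zero_mul x)).trans w.map_zero'

variable (φ : B →ₐ[K] A)

/-- If `A` has a `B`-linear retraction onto `B`, then `M` embeds into the induced module. -/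
lemma gen_injective_of_retraction (E : A →+ B) (hE : ∀ b a, E (φ b * a) = b * E a) (hE1 : E 1 = 1)
    (M : ModuleCat.{u} Bᵐᵒᵖ) (m m' : M)
    (h : (gen (fun _ : Unit => φ) (V := fun _ => M)).toFun (fun _ => m) =
      (gen (fun _ : Unit => φ)).toFun (fun _ => m')) : m = m' := by
  -- the adjunct of the retraction `m ⊗ a ↦ m · E(a)`
  let F : M → Coinduced A M := fun m =>
    ({ toFun := fun a => op (E a) • m
       map_zero' := by rw [_root_.map_zero, MulOpposite.op_zero, zero_smul]
       map_add' := fun a a' => by rw [_root_.map_add, MulOpposite.op_add, add_smul] } : A →+ M)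
  let ψ : Bal (fun _ : Unit => φ) (fun _ => M) (ModuleCat.of Aᵐᵒᵖ (Coinduced A M)) :=
    { toFun := fun v => F (v ())
      map_add := fun v i x y => by
        simp only [Function.update_self]
        exact AddMonoidHom.ext fun a => smul_add (op (E a)) x y
      map_act := fun v i b x => by
        simp only [Function.update_self]
        refine AddMonoidHom.ext fun a => ?_
        change op (E a) • op b • x = op (E (φ b * a)) • x
        rw [hE, op_mul, mul_smul] }
  have h1 := congrArg (fdesc ψ).hom h
  rw [fdesc_gen, fdesc_gen] at h1
  have h2 : op (E 1) • m = op (E 1) • m' := congrArg (fun w : A →+ M => w 1) h1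
  rwa [hE1, op_one, one_smul, one_smul] at h2

/-- Multiples of the orbit sum are additive maps to the invariants: the orbit sum itself for `k = 1`,
and a retraction onto the invariants for `k = 1 / |G|`. -/
lemma exists_average [Fintype G] (hinj : Function.Injective φ)
    (hrange : ∀ a, (∀ g, α g a = a) → ∃ b, φ b = a) (k : K) :
    ∃ E : A →+ B, ∀ a, φ (E a) = k • ∑ g, α g a := by
  choose e he using fun a => hrange (k • ∑ g, α g a) fun h => by
    rw [_root_.map_smul]
    exact congrArg (k • ·) ((mem_coinvariants_coaction α _).1 (orbitSum α a).2 h)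
  exact ⟨{ toFun := e
           map_zero' := hinj (by simp [he])
           map_add' := fun a a' => hinj (by
            simp only [he, _root_.map_add, Finset.sum_add_distrib, smul_add]) }, he⟩

variable (hφ : ∀ g b, α g (φ b) = φ b)

/-- The invariant elements of an equivariant module, as a module over an algebra which acts by
invariant elements. -/
noncomputable def invariants (V : GMod α) : Submodule Bᵐᵒᵖ (balTwist V.mod φ) where
  carrier := {v | ∀ g, V.rep g v = v}
  add_mem' {v w} hv hw g := (_root_.map_add (V.rep g) v w).trans (congrArg₂ (· + ·) (hv g) (hw g))
  zero_mem' g := _root_.map_zero (V.rep g)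
  smul_mem' b v hv g := by
    refine (V.rep_smul g (φ b.unop) v).trans ?_
    rw [hφ]
    exact congrArg (op (φ b.unop) • ·) (hv g)

/-- The invariant elements, as a right module. -/
noncomputable def invariantsMod (V : GMod α) : ModuleCat.{u} Bᵐᵒᵖ := ModuleCat.of _ (invariants φ hφ V)

/-- The invariant element, as an element of the equivariant module. -/
noncomputable def invVal {V : GMod α} (m : invariantsMod φ hφ V) : V.mod := m.1

lemma invVal_add {V : GMod α} (m n : invariantsMod φ hφ V) :
    invVal φ hφ (m + n) = invVal φ hφ m + invVal φ hφ n := rfl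

lemma invVal_smul {V : GMod α} (b : B) (m : invariantsMod φ hφ V) :
    invVal φ hφ (op b • m) = op (φ b) • invVal φ hφ m := rfl

lemma rep_invVal {V : GMod α} (m : invariantsMod φ hφ V) (g : G) :
    V.rep g (invVal φ hφ m) = invVal φ hφ m := m.2 g

/-- The homomorphism `V^G ⊗_B A → V`, `v ⊗ a ↦ v · a`. -/
noncomputable def descentHom (V : GMod α) : (induce φ hφ).obj (invariantsMod φ hφ V) ⟶ V :=
  gfacHom (α := fun _ => 1) (V := fun _ => (trivialAction G).obj (invariantsMod φ hφ V))
    (fun _ : Unit => φ) (fun _ g b => (hφ g b).symm)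
    (fdesc
      { toFun := fun v : Unit → invariantsMod φ hφ V => invVal φ hφ (v ())
        map_add := fun v i x y => by
          simp only [Function.update_self]
          exact invVal_add φ hφ x y
        map_act := fun v i a x => by
          simp only [Function.update_self]
          exact invVal_smul φ hφ a x })
    fun g v => by
      rw [fdesc_gen, fdesc_gen]
      exact (rep_invVal φ hφ _ g).symm

lemma descentHom_gen (V : GMod α) (m : Unit → invariantsMod φ hφ V) :
    (descentHom φ hφ V).1.hom ((gen fun _ : Unit => φ).toFun m) = invVal φ hφ (m ()) :=
  fdesc_gen _ _

/-- The sum over the orbit of an element of an equivariant module. -/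
noncomputable def orbitSumMod [Fintype G] (V : GMod α) (v : V.mod) : invariantsMod φ hφ V :=
  ⟨∑ g, V.rep g v, fun h => by
    refine (_root_.map_sum (V.rep h) _ _).trans ?_
    refine Fintype.sum_equiv (Equiv.mulLeft h) _ _ fun g => ?_
    rw [Equiv.coe_mulLeft, _root_.map_mul]
    rfl⟩

lemma invVal_orbitSumMod [Fintype G] (V : GMod α) (v : V.mod) :
    invVal φ hφ (orbitSumMod φ hφ V v) = ∑ g, V.rep g v := rfl

variable [Finite G] {S : Finset (A × A)}

/-- Galois descent: an equivariant module is induced from its invariant elements, since Galois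
coordinates `(xᵢ, yᵢ)` give the inverse `v ↦ ∑ᵢ tr(v xᵢ) ⊗ yᵢ` of the canonical homomorphism. -/
lemma descentHom_bijective (hS : IsGaloisSystem α S) (hinj : Function.Injective φ)
    (hrange : ∀ a, (∀ g, α g a = a) → ∃ b, φ b = a) (V : GMod α) :
    Function.Bijective (descentHom φ hφ V).1.hom := by
  have := Fintype.ofFinite G
  let q : invariantsMod φ hφ V → facObj (fun _ : Unit => φ) (fun _ => invariantsMod φ hφ V) :=
    fun m => (gen fun _ : Unit => φ).toFun fun _ => m
  have hq : ∀ b m, q (op b • m) = op (φ b) • q m := fun b m =>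
    gen_eq_smul (f := fun _ : Unit => φ) () b (fun j hj => absurd rfl hj) rfl
  have hqa : ∀ m n, q (m + n) = q m + q n := fun m n =>
    gen_eq_add (f := fun _ : Unit => φ) () (fun j hj => absurd rfl hj) rfl
  let d : facObj (fun _ : Unit => φ) (fun _ => invariantsMod φ hφ V) →ₗ[Aᵐᵒᵖ] V.mod :=
    (descentHom φ hφ V).1.hom
  have hd : ∀ m, d (q m) = invVal φ hφ m := fun m => descentHom_gen φ hφ V _
  let r : V.mod → facObj (fun _ : Unit => φ) (fun _ => invariantsMod φ hφ V) := fun v =>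
    ∑ p ∈ S, op p.2 • q (orbitSumMod φ hφ V (op p.1 • v))
  have htr : ∀ v w : V.mod, orbitSumMod φ hφ V (v + w) =
      orbitSumMod φ hφ V v + orbitSumMod φ hφ V w := fun v w => Subtype.ext (by
    change ∑ g, V.rep g (v + w) = ∑ g, V.rep g v + ∑ g, V.rep g w
    simp only [_root_.map_add, Finset.sum_add_distrib])
  have hr : ∀ v w, r (v + w) = r v + r w := fun v w => by
    simp only [r, smul_add, htr, hqa, Finset.sum_add_distrib]
  refine ⟨Function.LeftInverse.injective (g := r) fun x => ?_, fun v => ⟨r v, ?_⟩⟩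
  · change r (d x) = x
    induction x using fac_induction_smul with
    | h0 =>
      have h0 := hr 0 0
      rw [add_zero, left_eq_add] at h0
      rw [_root_.map_zero, h0]
    | ha x y hx hy => rw [_root_.map_add, hr, hx, hy]
    | hs a m =>
      obtain ⟨E, hE⟩ := exists_average φ hinj hrange 1
      have h1 : ∀ x, orbitSumMod φ hφ V (op x • invVal φ hφ (m ())) = op (E x) • m () := by
        intro x
        refine Subtype.ext ?_
        change ∑ g, V.rep g (op x • invVal φ hφ (m ())) = op (φ (E x)) • invVal φ hφ (m ())
        rw [hE, one_smul, Finset.op_sum, Finset.sum_smul]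
        simp only [V.rep_smul, rep_invVal]
      rw [_root_.map_smul]
      change r (op a • d (q (m ()))) = op a • q (m ())
      simp only [r, hd, ← mul_smul, ← op_mul, h1, hq]
      rw [← Finset.sum_smul, ← Finset.op_sum]
      congr 2
      simp only [hE, one_smul]
      exact hS.sum_orbitSum_mul a
  · change d (r v) = v
    simp only [r, _root_.map_sum, _root_.map_smul, hd, invVal_orbitSumMod, V.rep_smul,
      Finset.smul_sum, ← mul_smul, ← op_mul]
    rw [Finset.sum_comm]
    simp_rw [← Finset.sum_smul, ← Finset.op_sum]
    rw [Finset.sum_eq_single 1 (fun g _ hg => by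
      rw [hS.sum_act_mul g hg, MulOpposite.op_zero, zero_smul])
      (fun h => absurd (Finset.mem_univ _) h)]
    simp only [_root_.map_one, AlgHom.one_apply, hS.sum_mul, op_one, one_smul, Module.End.one_apply]

/-- For a Galois extension, induction is an equivalence between modules over the invariants and
equivariant modules. -/
theorem induce_isEquivalence [CharZero K] (hS : IsGaloisSystem α S)
    (hinj : Function.Injective φ) (hrange : ∀ a, (∀ g, α g a = a) → ∃ b, φ b = a) : (induce φ hφ).IsEquivalence := by
  have := Fintype.ofFinite G
  have hcard : ((Fintype.card G : K))⁻¹ * (Fintype.card G : K) = 1 :=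
    inv_mul_cancel₀ (Nat.cast_ne_zero.2 Fintype.card_ne_zero)
  obtain ⟨E, hE⟩ := exists_average φ hinj hrange ((Fintype.card G : K)⁻¹)
  have hEφ : ∀ b a, E (φ b * a) = b * E a := fun b a => hinj (by
    simp only [hE, _root_.map_mul, hφ, ← Finset.mul_sum, mul_smul_comm])
  have hE1 : E 1 = 1 := hinj (by
    simp only [hE, _root_.map_one, Finset.sum_const, Finset.card_univ, ← Nat.cast_smul_eq_nsmul K,
      smul_smul, hcard, one_smul])
  let q : ∀ M : ModuleCat.{u} Bᵐᵒᵖ, M → ((induce φ hφ).obj M).mod :=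
    fun M m => (gen (fun _ : Unit => φ) (V := fun _ => M)).toFun fun _ => m
  have hq : ∀ M b m, q M (op b • m) = op (φ b) • q M m := fun M b m =>
    gen_eq_smul (f := fun _ : Unit => φ) () b (fun j hj => absurd rfl hj) rfl
  have hqa : ∀ M m n, q M (m + n) = q M m + q M n := fun M m n =>
    gen_eq_add (f := fun _ : Unit => φ) () (fun j hj => absurd rfl hj) rfl
  have hqi : ∀ M, Function.Injective (q M) := fun M m m' h =>
    gen_injective_of_retraction φ E hEφ hE1 M m m' h
  have hqr : ∀ M g m, ((induce φ hφ).obj M).rep g (q M m) = q M m := fun M g m =>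
    induce_rep_gen φ hφ M g _
  have hqm : ∀ {M N} (h : M ⟶ N) m, ((induce φ hφ).map h).1.hom (q M m) = q N (h.hom m) :=
    fun h m => fmap_gen (f := fun _ : Unit => φ) (fun _ => h) fun _ => m
  -- averaging over `G` maps the induced module to the image of `M`
  let av : ∀ M, ((induce φ hφ).obj M).mod →ₗ[K] ((induce φ hφ).obj M).mod := fun M =>
    (Fintype.card G : K)⁻¹ • ∑ g, ((induce φ hφ).obj M).rep g
  have hav : ∀ M (x : facObj (fun _ : Unit => φ) fun _ => M), ∃ m, av M x = q M m := by
    intro M x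
    induction x using fac_induction_smul with
    | h0 =>
      refine ⟨0, (_root_.map_zero (av M)).trans ?_⟩
      have h0 := hqa M 0 0
      rw [add_zero, left_eq_add] at h0
      exact h0.symm
    | ha x y hx hy =>
      obtain ⟨m, hm⟩ := hx
      obtain ⟨n, hn⟩ := hy
      exact ⟨m + n, (_root_.map_add (av M) x y).trans
        ((congrArg₂ (· + ·) hm hn).trans (hqa M m n).symm)⟩
    | hs a m =>
      refine ⟨op (E a) • m (), ?_⟩
      have h1 : ∀ g, ((induce φ hφ).obj M).rep g (op a • q M (m ())) =
          op (α g a) • q M (m ()) := fun g => by rw [GMod.rep_smul, hqr]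
      change (Fintype.card G : K)⁻¹ • (∑ g, ((induce φ hφ).obj M).rep g) (op a • q M (m ())) = _
      rw [LinearMap.sum_apply, Finset.sum_congr rfl fun g _ => h1 g, ← Finset.sum_smul,
        ← Finset.op_sum, hq, hE, smul_eq, ← mul_smul, ← op_mul, ← Algebra.commutes,
        Algebra.smul_def]
  have hinv : ∀ M (x : ((induce φ hφ).obj M).mod), (∀ g, ((induce φ hφ).obj M).rep g x = x) →
      ∃ m, q M m = x := by
    intro M x hx
    obtain ⟨m, hm⟩ := hav M x
    refine ⟨m, hm.symm.trans ?_⟩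
    change (Fintype.card G : K)⁻¹ • (∑ g, ((induce φ hφ).obj M).rep g) x = x
    rw [LinearMap.sum_apply, Finset.sum_congr rfl fun g _ => hx g, Finset.sum_const,
      Finset.card_univ, ← Nat.cast_smul_eq_nsmul K, smul_smul, hcard, one_smul]
  have hff : (induce φ hφ).Full := ⟨fun {M N} h => by
    choose e he using fun m => hinv N (h.1.hom (q M m)) fun g => by rw [← h.2, hqr]
    refine ⟨ModuleCat.ofHom
      { toFun := e
        map_add' := fun m n => hqi N (by rw [hqa, he, he, he, hqa, _root_.map_add])
        map_smul' := fun b m => hqi N (by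
          rw [RingHom.id_apply, ← op_unop b, hq, he, he, hq, _root_.map_smul]) }, ?_⟩
    exact Subtype.ext (fac_ext fun v => (hqm _ (v ())).trans (he (v ())))⟩
  have hfa : (induce φ hφ).Faithful := ⟨fun {M N h h'} e => by
    ext m
    apply hqi N
    rw [← hqm, ← hqm, e]⟩
  have hes : (induce φ hφ).EssSurj := ⟨fun V => ⟨invariantsMod φ hφ V, ⟨by
    have := (ConcreteCategory.isIso_iff_bijective (descentHom φ hφ V).1).2
      (descentHom_bijective φ hφ hS hinj hrange V)
    have : IsIso ((GMod.forget α).map (descentHom φ hφ V)) := this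
    have := isIso_of_reflects_iso (descentHom φ hφ V) (GMod.forget α)
    exact asIso (descentHom φ hφ V)⟩⟩⟩
  exact { }

end Descent

/-! ### Generation by invariants yields Galois coordinates -/

section Generation

variable {K : Type u} [Field K] {G : Type u} [Group G] {A : Type u} [Ring A] [Algebra K A]
  {α : G →* (A →ₐ[K] A)}

/-- The submodule generated by the invariant elements. -/
def invariantSpan (V : GMod α) : Submodule Aᵐᵒᵖ V.mod :=
  Submodule.span Aᵐᵒᵖ {v | ∀ g, V.rep g v = v}

lemma rep_mem_invariantSpan (V : GMod α) (g : G) {v : V.mod} (hv : v ∈ invariantSpan V) :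
    V.rep g v ∈ invariantSpan V := by
  induction hv using Submodule.span_induction with
  | mem x hx => exact Submodule.subset_span (by rw [hx g]; exact hx)
  | zero => rw [_root_.map_zero]; exact Submodule.zero_mem _
  | add x y _ _ hx hy => rw [_root_.map_add]; exact Submodule.add_mem _ hx hy
  | smul a x _ hx =>
    rw [← op_unop a, V.rep_smul]
    exact Submodule.smul_mem _ _ hx

/-- A group element acts on an equivariant module by a semilinear map. -/
noncomputable def repSemilinear (V : GMod α) (g : G) :
    V.mod →ₛₗ[RingHom.op (α g : A →+* A)] V.mod where
  toFun := V.rep g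
  map_add' := _root_.map_add _
  map_smul' a v := V.rep_smul g a.unop v

/-- The action of a group element on the quotient by the invariant elements. -/
noncomputable def quotAct (V : GMod α) (g : G) :
    V.mod ⧸ invariantSpan V →ₛₗ[RingHom.op (α g : A →+* A)] V.mod ⧸ invariantSpan V :=
  (invariantSpan V).mapQ _ (repSemilinear V g) fun _ hv => rep_mem_invariantSpan V g hv

lemma quotAct_mk (V : GMod α) (g : G) (v : V.mod) :
    quotAct V g ((invariantSpan V).mkQ v) = (invariantSpan V).mkQ (V.rep g v) := rfl

/-- The largest quotient of an equivariant module in which the invariant elements vanish. -/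
noncomputable def invariantQuot (V : GMod α) : GMod α where
  mod := ModuleCat.of Aᵐᵒᵖ (V.mod ⧸ invariantSpan V)
  rep :=
    { toFun := fun g =>
        { toFun := quotAct V g
          map_add' := _root_.map_add _
          map_smul' := fun k v => by
            refine ((quotAct V g).map_smulₛₗ (op (algebraMap K A k)) v).trans ?_
            change op (α g (algebraMap K A k)) • quotAct V g v = op (algebraMap K A k) • _
            rw [AlgHom.commutes] }
      map_one' := LinearMap.ext fun v => by
        obtain ⟨v, rfl⟩ := (invariantSpan V).mkQ_surjective v
        exact (quotAct_mk V 1 v).trans (by rw [_root_.map_one]; rfl)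
      map_mul' := fun g h => LinearMap.ext fun v => by
        obtain ⟨v, rfl⟩ := (invariantSpan V).mkQ_surjective v
        exact (quotAct_mk V (g * h) v).trans (by rw [_root_.map_mul]; rfl) }
  rep_smul g a v := (quotAct V g).map_smulₛₗ (op a) v

/-- The quotient map. -/
noncomputable def toInvariantQuot (V : GMod α) : V ⟶ invariantQuot V :=
  ⟨ModuleCat.ofHom (Y := ModuleCat.of Aᵐᵒᵖ (V.mod ⧸ invariantSpan V)) (invariantSpan V).mkQ,
    fun g v => rfl⟩

lemma galoisMap_mul_tmul (z : A ⊗[K] A) (a : A) (g : G) :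
    galoisMap α (z * (1 ⊗ₜ a)) g = galoisMap α z g * α g a := by
  induction z with
  | zero => simp
  | add x y hx hy =>
    rw [add_mul, _root_.map_add, _root_.map_add, Pi.add_apply, Pi.add_apply, hx, hy, add_mul]
  | tmul b b' => simp [mul_assoc]

/-- Galois coordinates exist if the generator is generated by its invariant elements, the
functions `k ↦ k(a)`. -/
lemma exists_isGaloisSystem (h : invariantSpan (GMod.generator α) = ⊤) :
    ∃ S : Finset (A × A), IsGaloisSystem α S := by
  classical
  have key : ∀ ψ ∈ invariantSpan (GMod.generator α), ∃ z : A ⊗[K] A,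
      ∀ k : G, (ψ : G → A) k = α k (galoisMap α z k⁻¹) := by
    intro ψ hψ
    induction hψ using Submodule.span_induction with
    | mem ψ hψ =>
      -- an invariant function is determined by its value at `1`
      refine ⟨(ψ : G → A) 1 ⊗ₜ 1, fun k => ?_⟩
      have h1 : α k ((ψ : G → A) (k⁻¹ * k)) = (ψ : G → A) k := congrFun (hψ k) k
      rw [inv_mul_cancel] at h1
      rw [galoisMap_tmul, _root_.map_one, _root_.mul_one, h1]
    | zero => exact ⟨0, fun k => by rw [_root_.map_zero]; exact (_root_.map_zero (α k)).symm⟩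
    | add x y _ _ hx hy =>
      obtain ⟨z, hz⟩ := hx
      obtain ⟨z', hz'⟩ := hy
      refine ⟨z + z', fun k => ?_⟩
      rw [_root_.map_add]
      exact (congrArg₂ (· + ·) (hz k) (hz' k)).trans (_root_.map_add (α k) _ _).symm
    | smul a x _ hx =>
      obtain ⟨z, hz⟩ := hx
      refine ⟨z * (1 ⊗ₜ a.unop), fun k => ?_⟩
      rw [galoisMap_mul_tmul, _root_.map_mul, act_act_inv, ← hz]
      rfl
  obtain ⟨z, hz⟩ := key (GMod.generatorElt α) (h ▸ Submodule.mem_top)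
  obtain ⟨S, rfl⟩ := TensorProduct.exists_finset z
  have h1 : ∀ g, ∑ p ∈ S, p.1 * α g p.2 = galoisMap α (∑ p ∈ S, p.1 ⊗ₜ[K] p.2) g := fun g => by
    rw [_root_.map_sum, Finset.sum_apply]
    rfl
  have h2 : ∀ g, galoisMap α (∑ p ∈ S, p.1 ⊗ₜ[K] p.2) g = α g ((Pi.single 1 1 : G → A) g⁻¹) := by
    intro g
    have := (hz g⁻¹).symm
    rw [inv_inv] at this
    have h3 := (act_act_inv α g (galoisMap α (∑ p ∈ S, p.1 ⊗ₜ[K] p.2) g)).symm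
    rw [this] at h3
    exact h3
  refine ⟨S, ?_, fun g hg => ?_⟩
  · have h3 := h1 1
    rw [h2, _root_.map_one, inv_one, Pi.single_eq_same] at h3
    exact h3
  · rw [h1, h2, Pi.single_eq_of_ne (inv_ne_one.2 hg), _root_.map_zero]

end Generation

/-! ### Truncatedness and the Hopf-Galois condition -/

section Truncated

open TwoAQFT

variable {K : Type u} [Field K] {C : Type v} [Category.{w} C] {P : Orthogonality C}
  {G : Type u} [Group G] [Finite G] (A : AQFT K P) (ρ : G →* Aut A)

/-- The pointing of an inclusion separates morphisms, since it is a free module of rank one. -/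
lemma incl_pt_hom_ext (T : AQFT K P) {t : C} {M N : ModuleCat.{u} (T.obj.obj t)ᵐᵒᵖ} {m n : M ⟶ N}
    (h : ∀ s : facObj (alg T (POp.zero P t)) (fun i => i.elim) ⟶ M, s ≫ m = s ≫ n) : m = n := by
  refine ModuleCat.hom_ext (LinearMap.ext fun x => ?_)
  let s : facObj (alg T (POp.zero P t)) (fun i => i.elim) ⟶ M :=
    fdesc
      { toFun := fun _ => x
        map_add := fun _ i => i.elim
        map_act := fun _ i => i.elim }
  have hs : s.hom (ptGen T t) = x := fdesc_gen _ _
  have h1 : m.hom (s.hom (ptGen T t)) = n.hom (s.hom (ptGen T t)) :=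
    congrArg (fun r => ModuleCat.Hom.hom r (ptGen T t)) (h s)
  rwa [hs] at h1

/-- The components of an equivalence are equivalences of categories. -/
lemma app_isEquivalence {A B : TwoAQFT K P} {ζ : Hom A B} (hζ : IsEquivalence ζ) (c : C) :
    (ζ.app c).IsEquivalence := by
  obtain ⟨κ, ⟨η⟩, ⟨ε⟩⟩ := hζ
  refine Functor.IsEquivalence.mk' (κ.app c)
    { hom := η.hom.app c
      inv := η.inv.app c
      hom_inv_id := ?_
      inv_hom_id := ?_ }
    { hom := ε.hom.app c
      inv := ε.inv.app c
      hom_inv_id := ?_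
      inv_hom_id := ?_ }
  · exact congrArg (fun Γ => Modification.app Γ c) η.hom_inv_id
  · exact congrArg (fun Γ => Modification.app Γ c) η.inv_hom_id
  · exact congrArg (fun Γ => Modification.app Γ c) ε.hom_inv_id
  · exact congrArg (fun Γ => Modification.app Γ c) ε.inv_hom_id

/-- The pointings of a categorified theory which is equivalent to an inclusion separate
morphisms. -/
lemma pt_hom_ext_of_isEquivalence {T : AQFT K P} {B : TwoAQFT K P} {ζ : Hom (incl T) B}
    (hζ : IsEquivalence ζ) {t : C} {V W : B.cat t} {m n : V ⟶ W}
    (h : ∀ s : B.pt t ⟶ V, s ≫ m = s ≫ n) : m = n := by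
  have := app_isEquivalence hζ
  have h1 : ∀ s : (incl T).pt t ⟶ (ζ.app t).inv.obj V,
      s ≫ (ζ.app t).inv.map m = s ≫ (ζ.app t).inv.map n := by
    intro s
    apply (ζ.app t).map_injective
    rw [← cancel_mono (ζ.cou W).hom, ← cancel_epi (ζ.ptIso t).hom]
    have h2 := h ((ζ.ptIso t).hom ≫ (ζ.app t).map s ≫ (ζ.cou V).hom)
    simp only [Category.assoc, ← ζ.cou_naturality] at h2
    simpa only [Functor.map_comp, Category.assoc] using h2
  have h3 : (ζ.app t).inv.map m = (ζ.app t).inv.map n := incl_pt_hom_ext T h1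
  rw [← cancel_epi (ζ.cou V).hom, ← ζ.cou_naturality, ← ζ.cou_naturality, h3]

/-- Over a truncated orbifold theory, every equivariant module is generated by its invariant
elements, since these are the morphisms out of the pointing. -/
lemma invariantSpan_eq_top (h : IsTruncated (gauge A ρ)) (c : C) (V : GMod (act A ρ c)) :
    invariantSpan V = ⊤ := by
  obtain ⟨ε, -, hε⟩ := h
  have h0 : toInvariantQuot V = 0 := by
    refine pt_hom_ext_of_isEquivalence (B := gauge A ρ) hε (fun s => ?_)
    let s' : gpt A ρ c ⟶ V := s
    refine gpt_hom_ext A ρ (W := invariantQuot V) ((Submodule.Quotient.mk_eq_zero _).2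
      (Submodule.subset_span fun g => ?_) : (invariantSpan V).mkQ (s'.1.hom (gptGen A ρ c)) = 0)
    have h1 := s'.2 g (gptGen A ρ c)
    rw [gptGen_rep] at h1
    exact h1.symm
  rw [eq_top_iff]
  intro v _
  exact (Submodule.Quotient.mk_eq_zero _).1
    (LinearMap.congr_fun (congrArg ModuleCat.Hom.hom (congrArg Subtype.val h0)) v)

/-- The categorified orbifold theory is truncated exactly if all extensions of the invariants are
Hopf-Galois, both being equivalent to the existence of Galois coordinates at every object. -/
theorem isTruncated_gauge_iff [CharZero K] :
    IsTruncated (gauge A ρ) ↔ ∀ c : C, IsHopfGalois (coaction (act A ρ c)) := by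
  refine ⟨fun h c => (isHopfGalois_iff _).2
    (exists_isGaloisSystem (invariantSpan_eq_top A ρ h c _)), fun h => ?_⟩
  refine ⟨counit A ρ, adjunct_counit A ρ, ?_⟩
  have : ∀ c, ((counit A ρ).app c).IsEquivalence := fun c => by
    obtain ⟨S, hS⟩ := (isHopfGalois_iff _).1 (h c)
    exact induce_isEquivalence (endHom A ρ c) (act_endHom A ρ c) hS (endHom_injective A ρ c)
      (exists_endHom_eq A ρ c)
  exact isEquivalence_of_app (counit A ρ)

end Truncated

end OrbifoldAQFT

theorem mainTheorem2 {K : Type u} [Field K] [CharZero K] {C : Type v} [Category.{w} C]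
    (P : Orthogonality C) {G : Type u} [Group G] [Finite G] (A : AQFT.{u, v, w} K P)
    (ρ : G →* Aut A) :
    IsTruncated (gauge A ρ) ↔ ∀ c : C, IsHopfGalois (coaction (act A ρ c)) :=
  isTruncated_gauge_iff A ρ
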